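/- **Conventions.** A metric space is *geodesic* if every two points are joined by a geodesic, and *homogeneous* if its isometry group acts transitively. A complete geodesic metric space $F$ is *tree-graded* with respect to a collection of closed geodesic non-empty subsets (*pieces*) if (T1) every two different pieces have at most one common point, and (T2) every non-trivial simple geodesic triangle (a simple loop composed of three geodesics, some of which may be single points) is contained in one piece. The *transversal tree* $T_x$ at $x\in F$ is the set of all $y\in F$ such that every geodesic from $x$ to $y$ meets every piece in at most one point. Let $\mathcal T$ be the universal $\mathbb R$-tree of degree continuum, i.e. the non-empty complete $\mathbb R$-tree in which the complement of every point has exactly continuum many connected components. Explicitly, $\mathcal T$ is the set of functions $f:(-\infty,\rho_f)\to\mathbb R$, $\rho_f\in\mathbb R$, that vanish near $-\infty$ and are piecewise constant from the right (every $t<\rho_f$ has some $\varepsilon>0$ such that $f$ is constant on $[t,t+\varepsilon)$), with $\mathrm{dist}(f,g)=(\rho_f-s)+(\rho_g-s)$, where $s$ is the supremum of the $t\le\min(\rho_f,\rho_g)$ with $f=g$ on $(-\infty,t)$. **Tree product.** Let $\mathcal P=\{M_i\mid i\in I\}$ be a set of complete geodesic metric spaces and put $M_0=\mathcal T$, where $0\notin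 I$. Let $\Omega=\bigsqcup_{\alpha\in I\cup\{0\}}\Omega_\alpha$, where $\Omega_\alpha$ is the set of pairs of distinct points of $M_\alpha$, and put $\overline{(x,y)}=(y,x)$. The tree product $\Pi\mathcal P$ is the set of partial functions $f:\mathbb R\to\Omega$ such that 1. the domain $A_f$ is a dense open subset of an interval $(0,d(f))$, $0\le d(f)<\infty$ (if $d(f)=0$, then $f$ is the empty function $f_\emptyset$); 2. $f$ is locally constant on $A_f$; 3. if $f$ has the value $(x,y)$ on a maximal sub-interval $u$ of $A_f$, then $|u|=\mathrm{dist}(x,y)$; 4. no two consecutive values of $f$ (on maximal sub-intervals $(a,b)$, $(b,c)$ of $A_f$) have the form $(x_1,x_2),(x_2,x_3)$; 5. for no $p$ and $q>0$ with $(p-q,p+q)\subseteq(0,d(f))$ do the partial functions $f$ and $t\mapsto\overline{f(2p-t)}$ coincide on $(p-q,p+q)$. For $f,g\in\Pi\mathcal P$ let $s=\mathrm{div}(f,g)$ be the supremum of all $s'\in[0,\min(d(f),d(g))]$ such that $f$ and $g$ coincide, as partial functions, on $(0,s')$. Let $(s,a)$ and $(s,b)$ be the maximal (possibly empty) sub-intervals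 of $A_f$ and $A_g$ starting at $s$. If both are non-empty and $f$, $g$ take on them values $(x,y)$, $(x,y')$ with the same first point $x$ in the same $M_\alpha$, put $$D(f,g)=d(f)-a+d(g)-b+\mathrm{dist}(y,y');$$ otherwise put $D(f,g)=d(f)-s+d(g)-s$. For $(x,y)\in\Omega$ let $f\sqcup\mathbf C_{(x,y)}$ denote $f$ followed by the constant value $(x,y)$ on $(d(f),d(f)+\mathrm{dist}(x,y))$. The pieces of $\Pi\mathcal P$ are the sets $$\{f\}\cup\{f\sqcup\mathbf C_{(x,y)}\mid y\in M_i\setminus\{x\}\},$$ where $i\in I$, $x\in M_i$ and $f\in\Pi\mathcal P$ is such that $f$ does not have a last value of the form $(z,x)\in\Omega_i$. **Theorem.** The space $\mathcal T$ described explicitly above is a universal $\mathbb R$-tree of degree continuum. For every set $\mathcal P=\{M_i\mid i\in I\}$ of complete geodesic metric spaces, $D$ is a metric on $\Pi\mathcal P$, and with this metric $\Pi\mathcal P$ is complete, homogeneous, and tree-graded with respect to the pieces above. Every piece is isometric to some $M_i$, $i\in I$, and every transversal tree $T_f$, $f\in\Pi\mathcal P$, is isometric to $\mathcal T$. -/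

import Mathlib

open Set

universe u v

namespace TreeGraded

noncomputable section

/-! ## Geodesic, homogeneous and tree-graded metric spaces -/

/-- `γ` restricted to `[0, dist x y]` is a geodesic from `x` to `y`, parametrized by length. -/
def IsGeodesic {X : Type u} [MetricSpace X] (γ : ℝ → X) (x y : X) : Prop :=
  γ 0 = x ∧ γ (dist x y) = y ∧
    ∀ s ∈ Icc (0 : ℝ) (dist x y), ∀ t ∈ Icc (0 : ℝ) (dist x y), dist (γ s) (γ t) = |s - t|

/-- Every two points can be joined by a geodesic. -/
def IsGeodesicSpace (X : Type u) [MetricSpace X] : Prop :=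
  ∀ x y : X, ∃ γ : ℝ → X, IsGeodesic γ x y

/-- The isometry group acts transitively. -/
def IsHomogeneous (X : Type u) [MetricSpace X] : Prop :=
  ∀ x y : X, ∃ φ : X ≃ᵢ X, φ x = y

/-- `c`, restricted to `[0, L]` with `L > 0`, is a non-trivial simple loop composed of three
geodesics (some of which may be single points), parametrized by length. -/
def IsSimpleGeodesicTriangle {X : Type u} [MetricSpace X] (c : ℝ → X) (L : ℝ) : Prop :=
  0 < L ∧ c 0 = c L ∧ InjOn c (Ico 0 L) ∧
    ∃ p q : ℝ, 0 ≤ p ∧ p ≤ q ∧ q ≤ L ∧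
      (∀ s ∈ Icc 0 p, ∀ t ∈ Icc 0 p, dist (c s) (c t) = |s - t|) ∧
      (∀ s ∈ Icc p q, ∀ t ∈ Icc p q, dist (c s) (c t) = |s - t|) ∧
      (∀ s ∈ Icc q L, ∀ t ∈ Icc q L, dist (c s) (c t) = |s - t|)

/-- `X` is tree-graded with respect to the collection `P` of pieces. -/
structure IsTreeGraded (X : Type u) [MetricSpace X] (P : Set (Set X)) : Prop where
  complete : CompleteSpace X
  geodesic : IsGeodesicSpace X
  piece_nonempty : ∀ S ∈ P, S.Nonempty
  piece_closed : ∀ S ∈ P, IsClosed S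
  piece_geodesic : ∀ S ∈ P, IsGeodesicSpace S
  /-- Two different pieces have at most one common point. -/
  inter_subsingleton : ∀ S ∈ P, ∀ S' ∈ P, S ≠ S' → (S ∩ S').Subsingleton
  /-- Every non-trivial simple geodesic triangle is contained in one piece. -/
  triangle_subset : ∀ (c : ℝ → X) (L : ℝ), IsSimpleGeodesicTriangle c L →
    ∃ S ∈ P, c '' Icc 0 L ⊆ S

/-- The transversal tree at `x`: all points `y` such that every geodesic from `x` to `y` meets
every piece in at most one point. -/
def transversalTree {X : Type u} [MetricSpace X] (P : Set (Set X)) (x : X) : Set X :=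
  {y | ∀ γ : ℝ → X, IsGeodesic γ x y →
    ∀ S ∈ P, (γ '' Icc 0 (dist x y) ∩ S).Subsingleton}

/-! ## The universal `ℝ`-tree of degree continuum -/

/-- An `ℝ`-tree: a geodesic metric space that is `0`-hyperbolic (four-point condition). -/
def IsRTree (X : Type u) [MetricSpace X] : Prop :=
  IsGeodesicSpace X ∧ ∀ x y z w : X,
    dist x y + dist z w ≤ max (dist x z + dist y w) (dist x w + dist y z)

/-- A non-empty complete `ℝ`-tree of degree continuum: the complement of each point has exactly
continuum many connected components. -/
def IsUniversalRTree (X : Type u) [MetricSpace X] : Prop :=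
  Nonempty X ∧ CompleteSpace X ∧ IsRTree X ∧
    ∀ x : X, Cardinal.mk (ConnectedComponents ({x}ᶜ : Set X)) = Cardinal.continuum

/-- The explicit model of the universal `ℝ`-tree of degree continuum: functions
`f : (-∞, ρ) → ℝ`, where `ρ` depends on `f`, that vanish near `-∞` and are piecewise constant
from the right. The value `0` at the points outside `(-∞, ρ)` is only a normalization. -/
@[ext]
structure UTree : Type where
  ρ : ℝ
  toFun : ℝ → ℝ
  off : ∀ t, ρ ≤ t → toFun t = 0
  zero_near_bot : ∃ τ, ∀ t < τ, toFun t = 0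
  right_const : ∀ t < ρ, ∃ ε > 0, ∀ r ∈ Ico t (t + ε), r < ρ → toFun r = toFun t

namespace UTree

/-- The numbers `t` such that `f` and `g` are both defined and agree on `(-∞, t)`. -/
def agree (f g : UTree) : Set ℝ :=
  {t | t ≤ f.ρ ∧ t ≤ g.ρ ∧ ∀ r < t, f.toFun r = g.toFun r}

/-- The point where `f` and `g` separate. -/
def sep (f g : UTree) : ℝ := sSup (agree f g)

theorem agree_nonempty (f g : UTree) : (agree f g).Nonempty := by
  obtain ⟨a, ha⟩ := f.zero_near_bot
  obtain ⟨b, hb⟩ := g.zero_near_bot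
  refine ⟨min (min a b) (min f.ρ g.ρ), ?_, ?_, ?_⟩
  · exact (min_le_right _ _).trans (min_le_left _ _)
  · exact (min_le_right _ _).trans (min_le_right _ _)
  · intro r hr
    have h1 : r < min a b := hr.trans_le (min_le_left _ _)
    rw [ha r (h1.trans_le (min_le_left _ _)), hb r (h1.trans_le (min_le_right _ _))]

theorem agree_bdd (f g : UTree) : BddAbove (agree f g) := ⟨f.ρ, fun _ h => h.1⟩

theorem sep_mem (f g : UTree) : sep f g ∈ agree f g := by
  refine ⟨csSup_le (agree_nonempty f g) fun _ h => h.1,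
    csSup_le (agree_nonempty f g) fun _ h => h.2.1, fun r hr => ?_⟩
  obtain ⟨t, ht, hrt⟩ := exists_lt_of_lt_csSup (agree_nonempty f g) hr
  exact ht.2.2 r hrt

theorem le_sep {f g : UTree} {t : ℝ} (h : t ∈ agree f g) : t ≤ sep f g :=
  le_csSup (agree_bdd f g) h

theorem sep_self (f : UTree) : sep f f = f.ρ :=
  le_antisymm (sep_mem f f).1 (le_sep ⟨le_rfl, le_rfl, fun _ _ => rfl⟩)

theorem sep_comm (f g : UTree) : sep f g = sep g f := by
  have h : ∀ f g : UTree, sep f g ≤ sep g f := fun f g =>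
    le_sep ⟨(sep_mem f g).2.1, (sep_mem f g).1, fun r hr => ((sep_mem f g).2.2 r hr).symm⟩
  exact le_antisymm (h f g) (h g f)

theorem min_le_sep (f g h : UTree) : min (sep f g) (sep g h) ≤ sep f h := by
  refine le_sep ⟨(min_le_left _ _).trans (sep_mem f g).1,
    (min_le_right _ _).trans (sep_mem g h).2.1, fun r hr => ?_⟩
  rw [(sep_mem f g).2.2 r (hr.trans_le (min_le_left _ _)),
    (sep_mem g h).2.2 r (hr.trans_le (min_le_right _ _))]

/-- The distance is `(ρ_f - s) + (ρ_g - s)`, where `s` is the separation point. -/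
instance : MetricSpace UTree where
  dist f g := (f.ρ - sep f g) + (g.ρ - sep f g)
  dist_self f := by
    rw [sep_self]; ring
  dist_comm f g := by
    rw [sep_comm f g]; ring
  dist_triangle f g h := by
    have h1 := min_le_sep f g h
    have h2 := (sep_mem f g).2.1
    have h3 := (sep_mem g h).1
    rcases min_le_iff.1 h1 with h | h <;> linarith
  eq_of_dist_eq_zero {f g} h := by
    change (f.ρ - sep f g) + (g.ρ - sep f g) = 0 at h
    obtain ⟨h1, h2, h3⟩ := sep_mem f g
    have e1 : sep f g = f.ρ := by linarith
    have e2 : sep f g = g.ρ := by linarith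
    refine UTree.ext (e1.symm.trans e2) (funext fun r => ?_)
    by_cases hr : r < sep f g
    · exact h3 r hr
    · rw [f.off r (by linarith), g.off r (by linarith)]

end UTree

/-! ## Tree products -/

/-- An element of `Ω = ⨆ⱼ Ωⱼ`, where `Ωⱼ` is the set of all pairs `(src, tgt)` of distinct points
of `M j`. -/
structure Letter {J : Type v} (M : J → Type u) where
  idx : J
  src : M idx
  tgt : M idx
  ne : src ≠ tgt

namespace Letter

variable {J : Type v} {M : J → Type u}

/-- The first point of a pair, as a point of the disjoint union of the spaces. -/
def start (l : Letter M) : Σ j, M j := ⟨l.idx, l.src⟩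

/-- The second point of a pair, as a point of the disjoint union of the spaces. -/
def finish (l : Letter M) : Σ j, M j := ⟨l.idx, l.tgt⟩

/-- `(x, y) ↦ (y, x)`. -/
def bar (l : Letter M) : Letter M := ⟨l.idx, l.tgt, l.src, l.ne.symm⟩

/-- The distance between the two points of a pair. -/
def length [∀ j, MetricSpace (M j)] (l : Letter M) : ℝ := dist l.src l.tgt

end Letter

open Classical in
/-- The distance of two points of the same space `M j`, seen in the disjoint union
(only used for two such points). -/
def sigmaDist {J : Type v} {M : J → Type u} [∀ j, MetricSpace (M j)] (p q : Σ j, M j) : ℝ :=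
  if h : p.1 = q.1 then dist (cast (congrArg M h) p.2) q.2 else 0

theorem sigmaDist_mk {J : Type v} {M : J → Type u} [∀ j, MetricSpace (M j)] (j : J) (x y : M j) :
    sigmaDist (⟨j, x⟩ : Σ j, M j) ⟨j, y⟩ = dist x y := by
  simp [sigmaDist]

/-- `]a, b[` is a maximal (non-empty) open sub-interval of the bounded open set `A`. -/
def IsMaxInterval (A : Set ℝ) (a b : ℝ) : Prop :=
  a < b ∧ Ioo a b ⊆ A ∧ a ∉ A ∧ b ∉ A

/-- The domain of a partial function. -/
def pdom {α : Type u} (f : ℝ → Option α) : Set ℝ := {t | (f t).isSome}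

/-- The set underlying the tree product of the spaces `M j`: partial functions from `ℝ` to `Ω`
subject to the conditions below. The number `len`, called `d(f)` in the conditions, is determined
by the partial function. -/
structure Word {J : Type v} (M : J → Type u) [∀ j, MetricSpace (M j)] where
  toFun : ℝ → Option (Letter M)
  len : ℝ
  len_nonneg : 0 ≤ len
  /-- The domain is a dense open subset of `]0, d(f)[`. -/
  isOpen_dom : IsOpen (pdom toFun)
  dom_subset : pdom toFun ⊆ Ioo 0 len
  dom_dense : Ioo 0 len ⊆ closure (pdom toFun)
  /-- The function is locally constant on its domain. -/
  locally_const : ∀ t ∈ pdom toFun, ∃ ε > 0, ∀ r ∈ Ioo (t - ε) (t + ε), toFun r = toFun t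
  /-- On a maximal interval with value `(x, y)`, the length is `dist x y`. -/
  length_eq : ∀ a b, IsMaxInterval (pdom toFun) a b →
    ∀ t ∈ Ioo a b, ∀ l, toFun t = some l → b - a = l.length
  /-- No fake exits: no two consecutive values have the form `(x₁, x₂)`, `(x₂, x₃)`. -/
  no_fake_exit : ∀ a b c, IsMaxInterval (pdom toFun) a b → IsMaxInterval (pdom toFun) b c →
    ∀ t ∈ Ioo a b, ∀ r ∈ Ioo b c, ∀ l l', toFun t = some l → toFun r = some l' →
      l.finish ≠ l'.start
  /-- No backtracking: on no interval `]p - q, p + q[` in `]0, d(f)[` does the partial function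
  coincide with the bar of its reflection in `p`. -/
  no_backtrack : ∀ p q, 0 < q → Ioo (p - q) (p + q) ⊆ Ioo 0 len →
    ∃ t ∈ Ioo (p - q) (p + q), (toFun (2 * p - t)).map Letter.bar ≠ toFun t

namespace Word

variable {J : Type v} {M : J → Type u} [∀ j, MetricSpace (M j)]

/-- The point of diverging: the supremum of the numbers `s` for which `f` and `g` coincide, as
partial functions, on `]0, s[`, where `0 ≤ s ≤ min (d(f), d(g))`. -/
def div (f g : Word M) : ℝ :=
  sSup {s | 0 ≤ s ∧ s ≤ f.len ∧ s ≤ g.len ∧ ∀ t ∈ Ioo 0 s, f.toFun t = g.toFun t}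

/-- The right end `a ≥ s` of the maximal (possibly empty) sub-interval `]s, a[` of the domain. -/
def blockEnd (f : Word M) (s : ℝ) : ℝ :=
  sSup {a | s ≤ a ∧ Ioo s a ⊆ pdom f.toFun}

/-- The constant value of `f` on `]s, blockEnd f s[`, if this interval is non-empty. -/
def blockLetter (f : Word M) (s : ℝ) : Option (Letter M) :=
  if s < f.blockEnd s then f.toFun ((s + f.blockEnd s) / 2) else none

open Classical in
/-- The distance function `D` of the tree product. -/
def D (f g : Word M) : ℝ :=
  let s := div f g
  match f.blockLetter s, g.blockLetter s with
  | some l, some l' =>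
      if l.start = l'.start then
        f.len - f.blockEnd s + (g.len - g.blockEnd s) + sigmaDist l.finish l'.finish
      else f.len - s + (g.len - s)
  | _, _ => f.len - s + (g.len - s)

/-- `g = f ⊔ C_l`: the word `f` followed by the constant function `l` on an interval of length
`dist (l.src) (l.tgt)`. -/
def IsAppend (f : Word M) (l : Letter M) (g : Word M) : Prop :=
  g.len = f.len + l.length ∧ (∀ t < f.len, g.toFun t = f.toFun t) ∧ g.toFun f.len = none ∧
    ∀ t ∈ Ioo f.len (f.len + l.length), g.toFun t = some l

/-- The last value of `f` exists and has second point `x`. -/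
def EndsAt (f : Word M) (x : Σ j, M j) : Prop :=
  ∃ a l, IsMaxInterval (pdom f.toFun) a f.len ∧ (∀ t ∈ Ioo a f.len, f.toFun t = some l) ∧
    l.finish = x

/-- The copy of `M j` whose point nearest to the empty word is `f`, attached to `f` at `x`. -/
def copyAt (f : Word M) (j : J) (x : M j) : Set (Word M) :=
  {g | g = f ∨ ∃ y : M j, ∃ h : x ≠ y, IsAppend f ⟨j, x, y, h⟩ g}

end Word

/-- The given spaces together with the universal `ℝ`-tree (at the additional index `none`). -/
def withTree {I : Type v} (M : I → Type u) : Option I → Type u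
  | none => ULift.{u} UTree
  | some i => M i

instance withTree.metricSpace {I : Type v} (M : I → Type u) [inst : ∀ i, MetricSpace (M i)] :
    ∀ j, MetricSpace (withTree M j)
  | none => inferInstanceAs (MetricSpace (ULift.{u} UTree))
  | some i => inst i

/-- The tree product of the spaces `M i`. -/
abbrev TreeProduct {I : Type v} (M : I → Type u) [∀ i, MetricSpace (M i)] : Type (max u v) :=
  Word (withTree M)

/-- The pieces of the tree product: the copies of the spaces `M i` (but not of the universal
`ℝ`-tree). A copy attached at a word `f` that ends at `x` is the copy that `f` has just traversed;
it occurs under the shorter word at which `f` entered it. -/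
def pieces {I : Type v} (M : I → Type u) [∀ i, MetricSpace (M i)] : Set (Set (TreeProduct M)) :=
  {S | ∃ (f : TreeProduct M) (i : I) (x : M i),
    ¬ f.EndsAt ⟨some i, x⟩ ∧ S = f.copyAt (some i) x}

end

end TreeGraded

open TreeGraded

/-!
An element of the tree product is treated as a word in the letters `(x, y) ∈ Ω`, whose letters need
not be well-ordered in any way: the letter `(x, y)` stands for the path from `x` to `y` in its
space, and the word is a path that leaves the empty word without backtracking. Forgetting all
conditions, one gets *routes*, the partial functions on intervals `]0, len[`; they form a monoid
under concatenation, with reversal as an anti-automorphism. The conditions on words say that a route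
is *reduced*: it consists of blocks of the right lengths, and at every cut the germ read backwards
and the germ read forwards are transverse (`Route.Reduced`, `Word.reduced`, `Route.toWord`). This is
a local condition, so that reduced routes can be glued along a common factor (`Route.Reduced.glue`).

*The metric.* Two words `f`, `g` split after their longest common initial part, and either they
leave it transversally, or they leave it by letters `(x, y)` and `(x, z)`. Cancelling the common
part and replacing the two letters with `(y, z)` in `f⁻¹ g` gives a reduced word `Word.diff f g`,
and `D f g` is its length (`Word.D_eq_len_diff`). The map `Word.diff e` is a left translation with
inverse `Word.diff e⁻¹` that takes `e` to the empty word. It respects initial parts and the copies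
of the spaces, hence it is an isometry (`Word.le_D_of_moves`), which turns the triangle inequality into
the obvious one at the empty word and proves homogeneity (`Word.diffEquiv`).

*Geodesics and completeness.* A geodesic from the empty word to `g` runs through the initial parts
of `g`, and inside of the letters along geodesics of the spaces (`Word.exists_geodesic_one`). A
Cauchy sequence has long common initial parts, so that it converges to their union, or it runs in
one copy of a complete space up to short remainders (`Word.completeSpace`).

*Pieces.* Two copies of spaces with two common points coincide: move one of the points to the empty
word; the other one is then a single letter, which determines the copy
(`Word.range_app_eq_range_app`). An initial part of a word separates this word from the words
without this initial part, and similarly for the words that begin at a given point of a space. A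
simple loop cannot cross a separating point (`not_separated_of_simple_loop`), so that every simple
loop lies in one copy of a space (`Word.exists_copy_of_simple_loop`). This space is not the
`ℝ`-tree, which contains no simple loops.

*Transversal trees.* By homogeneity only the one at the empty word matters. It consists of the words
all of whose letters come from the universal `ℝ`-tree (`transversalTree_one`), because a geodesic
runs through the copy of every space whose letter occurs in the word. These words form a complete
`ℝ`-tree with continuum many directions at every point (`Word.isRTree_wordsOver`,
`Word.mk_dir_wordsOver`). Such a tree is unique up to isometry (`IsRTree.nonempty_isometryEquiv`):
by Zorn's lemma there is a maximal isometry between convex subsets under the side condition that at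
each point at most two or all directions are used. In the first case continuum many directions are
unused on both sides, so that the isometry could be extended; hence all directions are used
everywhere, and the isometry is onto.
-/

namespace TreeGraded

noncomputable section

open Filter Topology

variable {J : Type v} {M : J → Type u}

/-! ### Routes: the monoid of partial functions under concatenation -/

theorem Letter.start_ne_finish (l : Letter M) : l.start ≠ l.finish := by
  intro h
  have h' : (⟨l.idx, l.src⟩ : Σ j, M j) = ⟨l.idx, l.tgt⟩ := h
  rw [Sigma.mk.injEq] at h'
  exact l.ne (eq_of_heq h'.2)

@[simp] theorem Letter.map_bar_bar (o : Option (Letter M)) :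
    (o.map Letter.bar).map Letter.bar = o := by
  cases o <;> rfl

variable (M) in
/-- A partial function from `ℝ` to the letters, supported in an interval `]0, len[`. Routes are
the elements of the tree product stripped of all conditions on the domain and on the values. -/
structure Route where
  toFun : ℝ → Option (Letter M)
  len : ℝ
  len_nonneg : 0 ≤ len
  supp : ∀ t, t ∉ Ioo 0 len → toFun t = none

namespace Route

instance : CoeFun (Route M) fun _ => ℝ → Option (Letter M) := ⟨toFun⟩

theorem supp_left (r : Route M) {t : ℝ} (h : t ≤ 0) : r t = none :=
  r.supp t fun h' => absurd h'.1 (not_lt.2 h)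

theorem supp_right (r : Route M) {t : ℝ} (h : r.len ≤ t) : r t = none :=
  r.supp t fun h' => absurd h'.2 (not_lt.2 h)

theorem mem_of_eq_some (r : Route M) {t : ℝ} {l : Letter M} (h : r t = some l) :
    t ∈ Ioo 0 r.len := by
  by_contra h'
  rw [r.supp t h'] at h
  cases h

theorem ext_len {r s : Route M} (hl : r.len = s.len) (h : ∀ t ∈ Ioo 0 r.len, r t = s t) :
    r = s := by
  have hf : r.toFun = s.toFun := by
    funext t
    by_cases ht : t ∈ Ioo 0 r.len
    · exact h t ht
    · rw [r.supp t ht, s.supp t (hl ▸ ht)]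
  cases r; cases s
  simp only at hl hf
  subst hl hf
  rfl

/-- Concatenation of routes. -/
instance : Mul (Route M) where
  mul r s :=
    { toFun := fun t => if t < r.len then r t else s (t - r.len)
      len := r.len + s.len
      len_nonneg := add_nonneg r.len_nonneg s.len_nonneg
      supp := by
        intro t ht
        split_ifs with h
        · refine r.supp t fun h' => ht ⟨h'.1, ?_⟩
          linarith [h'.2, s.len_nonneg]
        · refine s.supp _ fun h' => ht ⟨?_, ?_⟩
          · linarith [h'.1, r.len_nonneg]
          · linarith [h'.2] }

instance : One (Route M) where
  one := ⟨fun _ => none, 0, le_rfl, fun _ _ => rfl⟩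

@[simp] theorem len_mul (r s : Route M) : (r * s).len = r.len + s.len := rfl

@[simp] theorem len_one : (1 : Route M).len = 0 := rfl

theorem mul_apply (r s : Route M) (t : ℝ) :
    (r * s) t = if t < r.len then r t else s (t - r.len) := rfl

theorem mul_apply_left (r s : Route M) {t : ℝ} (h : t ≤ r.len) : (r * s) t = r t := by
  rw [mul_apply]
  split_ifs with h'
  · rfl
  · rw [supp_right r (not_lt.1 h'), supp_left s (by linarith)]

theorem mul_apply_right (r s : Route M) {t : ℝ} (h : r.len ≤ t) :
    (r * s) t = s (t - r.len) := by
  rw [mul_apply, if_neg (not_lt.2 h)]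

theorem mul_apply_add (r s : Route M) {t : ℝ} (h : 0 ≤ t) : (r * s) (r.len + t) = s t := by
  rw [mul_apply_right _ _ (by linarith), add_sub_cancel_left]

@[simp] theorem mul_apply_len (r s : Route M) : (r * s) r.len = none := by
  rw [mul_apply_left _ _ le_rfl, supp_right _ le_rfl]

theorem eq_one_of_len {r : Route M} (h : r.len = 0) : r = 1 :=
  ext_len h fun t ht => absurd (ht.1.trans ht.2) (by rw [h]; exact lt_irrefl _)

instance : Monoid (Route M) where
  mul_assoc r s t := by
    refine ext_len (by simp only [len_mul]; ring) fun x _ => ?_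
    simp only [mul_apply, len_mul]
    by_cases h1 : x < r.len
    · rw [if_pos (by linarith [s.len_nonneg]), if_pos h1, if_pos h1]
    · by_cases h2 : x < r.len + s.len
      · rw [if_pos h2, if_neg h1, if_neg h1, if_pos (by linarith)]
      · rw [if_neg h2, if_neg h1, if_neg (by linarith), sub_sub]
  one_mul r := by
    refine ext_len (by simp) fun x hx => ?_
    simp only [len_mul, len_one, zero_add] at hx
    rw [mul_apply_right _ _ (by simpa using hx.1.le)]
    simp
  mul_one r := by
    refine ext_len (by simp) fun x hx => ?_
    simp only [len_mul, len_one, add_zero] at hx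
    rw [mul_apply_left _ _ hx.2.le]

/-- The route `r` run backwards. -/
def rev (r : Route M) : Route M where
  toFun t := (r (r.len - t)).map Letter.bar
  len := r.len
  len_nonneg := r.len_nonneg
  supp t ht := by
    rw [r.supp _ fun h => ht ⟨by linarith [h.2], by linarith [h.1]⟩]
    rfl

@[simp] theorem len_rev (r : Route M) : r.rev.len = r.len := rfl

theorem rev_apply (r : Route M) (t : ℝ) : r.rev t = (r (r.len - t)).map Letter.bar := rfl

@[simp] theorem rev_rev (r : Route M) : r.rev.rev = r := by
  refine ext_len rfl fun t _ => ?_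
  rw [rev_apply, rev_apply, Letter.map_bar_bar, len_rev, sub_sub_cancel]

@[simp] theorem rev_one : (1 : Route M).rev = 1 := eq_one_of_len rfl

@[simp] theorem rev_mul (r s : Route M) : (r * s).rev = s.rev * r.rev := by
  refine ext_len (by simp [add_comm]) fun t _ => ?_
  rw [rev_apply]
  rcases le_total t s.len with h | h
  · rw [mul_apply_left s.rev r.rev h, mul_apply_right r s (by simp; linarith), rev_apply]
    congr 2
    simp; ring
  · rw [mul_apply_right s.rev r.rev h, mul_apply_left r s (by simp; linarith), rev_apply]
    congr 2
    simp; ring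

theorem mul_left_inj_of_len {r s r' s' : Route M} (h : r * s = r' * s') (hl : r.len = r'.len) :
    r = r' ∧ s = s' := by
  have h2 : s.len = s'.len := by
    have := congrArg len h
    simp only [len_mul] at this
    linarith
  refine ⟨ext_len hl fun t ht => ?_, ext_len h2 fun t ht => ?_⟩
  · rw [← mul_apply_left r s ht.2.le, h, mul_apply_left r' s' (hl ▸ ht.2.le)]
  · rw [← mul_apply_add r s ht.1.le, h, hl, mul_apply_add r' s' ht.1.le]

theorem mul_left_cancel' {r s s' : Route M} (h : r * s = r * s') : s = s' :=
  (mul_left_inj_of_len h rfl).2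

/-- A route can be cut at every point outside of its domain. -/
theorem exists_split (r : Route M) {s : ℝ} (h0 : 0 ≤ s) (h1 : s ≤ r.len) (hs : r s = none) :
    ∃ p q : Route M, r = p * q ∧ p.len = s := by
  refine ⟨⟨fun t => if t < s then r t else none, s, h0, fun t ht => ?_⟩,
    ⟨fun t => if 0 < t then r (s + t) else none, r.len - s, by linarith, fun t ht => ?_⟩,
    ext_len ?_ fun t ht => ?_, rfl⟩
  · split_ifs with h
    · exact r.supp_left (not_lt.1 fun h' => ht ⟨h', h⟩)
    · rfl
  · split_ifs with h
    · refine r.supp_right (not_lt.1 fun h' => ht ⟨h, by linarith⟩)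
    · rfl
  · simp
  · rw [mul_apply]
    simp only
    by_cases h : t < s
    · simp [h]
    · rw [if_neg h]
      rcases eq_or_lt_of_le (not_lt.1 h) with h' | h'
      · subst h'; simp [hs]
      · simp [h']

theorem exists_middle {p q p' q' : Route M} (h : p * q = p' * q') (hl : p.len ≤ p'.len) :
    ∃ m, p' = p * m ∧ q = m * q' := by
  have hc : p' p.len = none := by
    rw [← mul_apply_left p' q' hl, ← h, mul_apply_len]
  obtain ⟨a, m, rfl, ha⟩ := p'.exists_split p.len_nonneg hl hc
  rw [mul_assoc] at h
  obtain ⟨rfl, rfl⟩ := mul_left_inj_of_len h ha.symm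
  exact ⟨m, rfl, rfl⟩

variable [∀ j, MetricSpace (M j)]

theorem _root_.TreeGraded.Letter.length_pos (l : Letter M) : 0 < l.length := dist_pos.2 l.ne

@[simp] theorem _root_.TreeGraded.Letter.length_bar (l : Letter M) : l.bar.length = l.length :=
  dist_comm _ _

open Classical in
/-- The route with the single value `l`. -/
def single (l : Letter M) : Route M where
  toFun t := if t ∈ Ioo 0 l.length then some l else none
  len := l.length
  len_nonneg := l.length_pos.le
  supp _ ht := if_neg ht

@[simp] theorem len_single (l : Letter M) : (single l).len = l.length := rfl

theorem single_apply (l : Letter M) {t : ℝ} (h : t ∈ Ioo 0 l.length) : single l t = some l :=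
  if_pos h

theorem single_eq_some {l l' : Letter M} {t : ℝ} (h : single l t = some l') : l = l' := by
  have := mem_of_eq_some _ h
  rw [single_apply l this] at h
  exact Option.some.inj h

@[simp] theorem rev_single (l : Letter M) : (single l).rev = single l.bar := by
  refine ext_len (by simp) fun t ht => ?_
  simp only [len_rev, len_single] at ht
  rw [rev_apply, single_apply l (by constructor <;> simp <;> linarith [ht.1, ht.2]),
    single_apply _ (by simpa using ht)]
  rfl

open Classical in
/-- The single letter `(x, y)`, or the empty route if `x = y`. -/
def seg {j : J} (x y : M j) : Route M := if h : x = y then 1 else single ⟨j, x, y, h⟩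

@[simp] theorem seg_self {j : J} (x : M j) : seg (M := M) x x = 1 := dif_pos rfl

theorem seg_of_ne {j : J} {x y : M j} (h : x ≠ y) : seg (M := M) x y = single ⟨j, x, y, h⟩ :=
  dif_neg h

@[simp] theorem len_seg {j : J} (x y : M j) : (seg (M := M) x y).len = dist x y := by
  by_cases h : x = y
  · subst h; simp
  · rw [seg_of_ne h]; rfl

@[simp] theorem rev_seg {j : J} (x y : M j) : (seg (M := M) x y).rev = seg y x := by
  by_cases h : x = y
  · subst h; simp
  · rw [seg_of_ne h, seg_of_ne (Ne.symm h), rev_single]; rfl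

theorem single_eq_seg (l : Letter M) : single l = seg l.src l.tgt := by
  rw [seg_of_ne l.ne]

theorem single_mul_inj {l l' : Letter M} {r r' : Route M}
    (h : single l * r = single l' * r') : l = l' ∧ r = r' := by
  have hl : l = l' := by
    obtain ⟨t, ht0, ht⟩ := exists_between (lt_min l.length_pos l'.length_pos)
    have ht1 : t ∈ Ioo 0 l.length := ⟨ht0, ht.trans_le (min_le_left _ _)⟩
    have ht2 : t ∈ Ioo 0 l'.length := ⟨ht0, ht.trans_le (min_le_right _ _)⟩
    have : (single l * r) t = (single l' * r') t := by rw [h]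
    rw [mul_apply_left _ _ (by simpa using ht1.2.le), mul_apply_left _ _ (by simpa using ht2.2.le),
      single_apply _ ht1, single_apply _ ht2] at this
    exact Option.some.inj this
  subst hl
  exact ⟨rfl, mul_left_cancel' h⟩

/-- A cut of a route that starts with a letter is either trivial or comes after this letter. -/
theorem exists_middle_seg {j : J} {x y : M j} {w p q : Route M} (h : seg x y * w = p * q)
    (hp : 0 < p.len) : ∃ m, p = seg x y * m ∧ w = m * q := by
  refine exists_middle h (not_lt.1 fun hlt => ?_)
  by_cases hxy : x = y
  · subst hxy
    simp at hlt
    exact absurd hp (not_lt.2 hlt.le)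
  · have h1 : (seg x y * w) p.len = none := by rw [h, mul_apply_len]
    rw [mul_apply_left _ _ hlt.le, seg_of_ne hxy, single_apply _ ⟨hp, by
      rw [seg_of_ne hxy] at hlt; exact hlt⟩] at h1
    cases h1

end Route

end

end TreeGraded

namespace TreeGraded

noncomputable section

open Filter Topology

variable {J : Type v} {M : J → Type u}

/-! ### Reduced routes -/

/-- Two germs at `0+` leave a vertex in different directions: unless both are empty they are not
equal, and they do not start by letters with the same first point. -/
def Transverse (e g : ℝ → Option (Letter M)) : Prop :=
  ((∀ᶠ t in 𝓝[>] (0 : ℝ), e t = g t) → ∀ᶠ t in 𝓝[>] (0 : ℝ), e t = none) ∧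
    ∀ l l', (∀ᶠ t in 𝓝[>] (0 : ℝ), e t = some l) → (∀ᶠ t in 𝓝[>] (0 : ℝ), g t = some l') →
      l.start ≠ l'.start

namespace Transverse

variable {e g e' g' : ℝ → Option (Letter M)}

theorem symm (h : Transverse e g) : Transverse g e := by
  refine ⟨fun h' => ?_, fun l l' hl hl' => (h.2 l' l hl' hl).symm⟩
  filter_upwards [h', h.1 (h'.mono fun _ => Eq.symm)] with t h1 h2
  rw [h1, h2]

theorem congr (h : Transverse e g) (he : ∀ᶠ t in 𝓝[>] (0 : ℝ), e' t = e t)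
    (hg : ∀ᶠ t in 𝓝[>] (0 : ℝ), g' t = g t) : Transverse e' g' := by
  refine ⟨fun h' => ?_, fun l l' hl hl' => h.2 l l' ?_ ?_⟩
  · have : ∀ᶠ t in 𝓝[>] (0 : ℝ), e t = g t := by
      filter_upwards [h', he, hg] with t h1 h2 h3
      rw [← h2, ← h3, h1]
    filter_upwards [h.1 this, he] with t h1 h2
    rw [h2, h1]
  · filter_upwards [he, hl] with t h1 h2
    rw [← h1, h2]
  · filter_upwards [hg, hl'] with t h1 h2
    rw [← h1, h2]

theorem of_none_left (h : ∀ᶠ t in 𝓝[>] (0 : ℝ), e t = none) : Transverse e g := by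
  refine ⟨fun _ => h, fun l _ hl => ?_⟩
  obtain ⟨t, h1, h2⟩ := (h.and hl).exists
  rw [h1] at h2
  cases h2

theorem of_none_right (h : ∀ᶠ t in 𝓝[>] (0 : ℝ), g t = none) : Transverse e g :=
  (of_none_left h).symm

end Transverse

theorem eventually_Ioo {ε : ℝ} (h : 0 < ε) : ∀ᶠ t in 𝓝[>] (0 : ℝ), t ∈ Ioo 0 ε :=
  Ioo_mem_nhdsGT h

theorem exists_Ioo_of_eventually {p : ℝ → Prop} (h : ∀ᶠ t in 𝓝[>] (0 : ℝ), p t) :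
    ∃ ε > 0, ∀ t ∈ Ioo 0 ε, p t := by
  obtain ⟨ε, h0, h1⟩ := mem_nhdsGT_iff_exists_Ioo_subset.1 h
  exact ⟨ε, h0, h1⟩

namespace Route

theorem block_bounds (r : Route M) {a b : ℝ} {l : Letter M} (hab : a < b)
    (h : ∀ s ∈ Ioo a b, r s = some l) : 0 ≤ a ∧ b ≤ r.len := by
  constructor
  · by_contra h'
    obtain ⟨t, h1, h2⟩ := exists_between (lt_min hab (not_le.1 h'))
    have := (r.mem_of_eq_some (h t ⟨h1, h2.trans_le (min_le_left _ _)⟩)).1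
    linarith [min_le_right b 0]
  · by_contra h'
    obtain ⟨t, h1, h2⟩ := exists_between (max_lt hab (not_le.1 h'))
    have := (r.mem_of_eq_some (h t ⟨(le_max_left _ _).trans_lt h1, h2⟩)).2
    linarith [le_max_right a r.len]

theorem eventually_mul (r s : Route M) (h : 0 < r.len) :
    ∀ᶠ t in 𝓝[>] (0 : ℝ), (r * s) t = r t := by
  filter_upwards [eventually_Ioo h] with t ht
  exact mul_apply_left _ _ ht.2.le

theorem eventually_eq_none_of_len {r : Route M} (h : r.len = 0) :
    ∀ᶠ t in 𝓝[>] (0 : ℝ), r t = none := by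
  rw [eq_one_of_len h]
  exact Eventually.of_forall fun _ => rfl

variable [∀ j, MetricSpace (M j)]

/-- The conditions that single out the elements of the tree product. The last one contains both
the absence of fake exits and the absence of backtracking: at every cut the germ read backwards
and the germ read forwards are transverse. -/
structure Reduced (r : Route M) : Prop where
  block : ∀ t l, r t = some l → ∃ a b, a < t ∧ t < b ∧ b - a = l.length ∧ r a = none ∧
    r b = none ∧ ∀ s ∈ Ioo a b, r s = some l
  dense : ∀ a b, 0 ≤ a → a < b → b ≤ r.len → ∃ t ∈ Ioo a b, r t ≠ none
  turn : ∀ b ∈ Ioo 0 r.len, r b = none →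
    Transverse (fun t => (r (b - t)).map Letter.bar) (fun t => r (b + t))

theorem eventually_single (l : Letter M) : ∀ᶠ t in 𝓝[>] (0 : ℝ), single l t = some l := by
  filter_upwards [eventually_Ioo l.length_pos] with t ht
  exact single_apply l ht

theorem eventually_single_mul (l : Letter M) (r : Route M) :
    ∀ᶠ t in 𝓝[>] (0 : ℝ), (single l * r) t = some l := by
  filter_upwards [eventually_single l, eventually_mul (single l) r l.length_pos] with t h1 h2
  rw [h2, h1]

theorem reduced_one : Reduced (1 : Route M) where
  block _ _ h := by cases h
  dense a b h1 h2 h3 := by rw [len_one] at h3; linarith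
  turn b hb := by
    have := hb.1.trans hb.2
    exact absurd this (lt_irrefl _)

theorem reduced_single (l : Letter M) : Reduced (single l) where
  block t l' h := by
    obtain rfl := single_eq_some h
    have ht := mem_of_eq_some _ h
    exact ⟨0, l.length, ht.1, ht.2, sub_zero _, supp_left _ le_rfl, supp_right _ le_rfl,
      fun s hs => single_apply l hs⟩
  dense a b h1 h2 h3 := by
    obtain ⟨t, ht⟩ := exists_between h2
    refine ⟨t, ht, ?_⟩
    rw [single_apply l ⟨h1.trans_lt ht.1, ht.2.trans_le h3⟩]
    simp
  turn b hb h := by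
    rw [single_apply l hb] at h
    cases h

theorem reduced_seg {j : J} (x y : M j) : Reduced (seg (M := M) x y) := by
  by_cases h : x = y
  · subst h; simpa using reduced_one
  · rw [seg_of_ne h]; exact reduced_single _

theorem Reduced.rev {r : Route M} (h : Reduced r) : Reduced r.rev where
  block t l hl := by
    rw [rev_apply] at hl
    obtain ⟨l', h1, rfl⟩ := Option.map_eq_some_iff.1 hl
    obtain ⟨a, b, ha, hb, hlen, hna, hnb, hs⟩ := h.block _ _ h1
    refine ⟨r.len - b, r.len - a, by linarith, by linarith, by simp; linarith, ?_, ?_, ?_⟩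
    · simp [rev_apply, hnb]
    · simp [rev_apply, hna]
    · intro s hs'
      rw [rev_apply, hs _ ⟨by linarith [hs'.2], by linarith [hs'.1]⟩]
      rfl
  dense a b h1 h2 h3 := by
    rw [len_rev] at h3
    obtain ⟨t, ht, hn⟩ := h.dense (r.len - b) (r.len - a) (by linarith) (by linarith) (by linarith)
    refine ⟨r.len - t, ⟨by linarith [ht.2], by linarith [ht.1]⟩, ?_⟩
    simpa [rev_apply] using hn
  turn b hb hn := by
    rw [len_rev] at hb
    have h1 : r (r.len - b) = none := by simpa [rev_apply] using hn
    refine (h.turn (r.len - b) ⟨by linarith [hb.2], by linarith [hb.1]⟩ h1).symm.congr ?_ ?_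
    · refine Eventually.of_forall fun t => ?_
      rw [rev_apply, Letter.map_bar_bar]
      congr 1; ring
    · refine Eventually.of_forall fun t => ?_
      rw [rev_apply]
      congr 2; ring

theorem Reduced.left {r s : Route M} (h : Reduced (r * s)) : Reduced r where
  block t l hl := by
    have ht := r.mem_of_eq_some hl
    rw [← mul_apply_left r s ht.2.le] at hl
    obtain ⟨a, b, ha, hb, hlen, hna, hnb, hs⟩ := h.block _ _ hl
    have hbr : b ≤ r.len := by
      by_contra h'
      have := hs r.len ⟨ha.trans ht.2, not_le.1 h'⟩
      rw [mul_apply_len] at this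
      cases this
    rw [mul_apply_left _ _ (by linarith)] at hna
    rw [mul_apply_left _ _ (by linarith)] at hnb
    refine ⟨a, b, ha, hb, hlen, hna, hnb, fun t ht => ?_⟩
    rw [← mul_apply_left r s (by linarith [ht.2]), hs t ht]
  dense a b h1 h2 h3 := by
    obtain ⟨t, ht, hn⟩ := h.dense a b h1 h2 (by rw [len_mul]; linarith [s.len_nonneg])
    rw [mul_apply_left _ _ (by linarith [ht.2])] at hn
    exact ⟨t, ht, hn⟩
  turn b hb hn := by
    rw [← mul_apply_left r s hb.2.le] at hn
    refine (h.turn b ⟨hb.1, by rw [len_mul]; linarith [s.len_nonneg, hb.2]⟩ hn).congr ?_ ?_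
    · filter_upwards [eventually_Ioo hb.1] with t ht
      rw [mul_apply_left _ _ (by linarith [ht.1, hb.2])]
    · filter_upwards [eventually_Ioo (sub_pos.2 hb.2)] with t ht
      rw [mul_apply_left _ _ (by linarith [ht.2])]

theorem Reduced.right {r s : Route M} (h : Reduced (r * s)) : Reduced s := by
  have := h.rev
  rw [rev_mul] at this
  simpa using this.left.rev

theorem Reduced.transverse {r s : Route M} (h : Reduced (r * s)) : Transverse r.rev s := by
  rcases r.len_nonneg.eq_or_lt with h0 | h0
  · exact Transverse.of_none_left (eventually_eq_none_of_len h0.symm)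
  rcases s.len_nonneg.eq_or_lt with h1 | h1
  · exact Transverse.of_none_right (eventually_eq_none_of_len h1.symm)
  refine (h.turn r.len ⟨h0, by simpa using h1⟩ (mul_apply_len _ _)).congr ?_ ?_
  · filter_upwards [eventually_Ioo h0] with t ht
    rw [mul_apply_left _ _ (by linarith [ht.1])]
    rfl
  · filter_upwards [eventually_Ioo h0] with t ht
    rw [mul_apply_add _ _ ht.1.le]

/-- Concatenation keeps routes reduced if the only new cut is a proper turn. -/
theorem Reduced.mul {r s : Route M} (hr : Reduced r) (hs : Reduced s) (h : Transverse r.rev s) :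
    Reduced (r * s) where
  block t l hl := by
    rcases le_or_gt t r.len with ht | ht
    · rw [mul_apply_left _ _ ht] at hl
      obtain ⟨a, b, ha, hb, hlen, hna, hnb, hab⟩ := hr.block _ _ hl
      have hbr := (r.block_bounds (ha.trans hb) hab).2
      refine ⟨a, b, ha, hb, hlen, ?_, ?_, fun x hx => ?_⟩
      · rwa [mul_apply_left _ _ (by linarith)]
      · rwa [mul_apply_left _ _ (by linarith)]
      · rw [mul_apply_left _ _ (by linarith [hx.2]), hab x hx]
    · rw [mul_apply_right _ _ ht.le] at hl
      obtain ⟨a, b, ha, hb, hlen, hna, hnb, hab⟩ := hs.block _ _ hl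
      have hbr := (s.block_bounds (ha.trans hb) hab).1
      refine ⟨r.len + a, r.len + b, by linarith, by linarith, by linarith, ?_, ?_, fun x hx => ?_⟩
      · rwa [mul_apply_add _ _ hbr]
      · rwa [mul_apply_add _ _ (by linarith)]
      · rw [mul_apply_right _ _ (by linarith [hx.1]),
          hab _ ⟨by linarith [hx.1], by linarith [hx.2]⟩]
  dense a b h1 h2 h3 := by
    rw [len_mul] at h3
    rcases lt_or_ge a r.len with ha | ha
    · obtain ⟨t, ht, hn⟩ := hr.dense a (min b r.len) h1 (lt_min h2 ha) (min_le_right _ _)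
      have := ht.2.trans_le (min_le_right _ _)
      refine ⟨t, ⟨ht.1, ht.2.trans_le (min_le_left _ _)⟩, ?_⟩
      rwa [mul_apply_left _ _ this.le]
    · obtain ⟨t, ht, hn⟩ := hs.dense (a - r.len) (b - r.len) (by linarith) (by linarith)
        (by linarith)
      refine ⟨r.len + t, ⟨by linarith [ht.1], by linarith [ht.2]⟩, ?_⟩
      rwa [mul_apply_add _ _ (by linarith [ht.1])]
  turn b hb hn := by
    rw [len_mul] at hb
    rcases lt_trichotomy b r.len with h' | h' | h'
    · rw [mul_apply_left _ _ h'.le] at hn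
      refine (hr.turn b ⟨hb.1, h'⟩ hn).congr ?_ ?_
      · filter_upwards [eventually_Ioo hb.1] with t ht
        rw [mul_apply_left _ _ (by linarith [ht.1])]
      · filter_upwards [eventually_Ioo (sub_pos.2 h')] with t ht
        rw [mul_apply_left _ _ (by linarith [ht.2])]
    · subst h'
      refine h.congr ?_ ?_
      · filter_upwards [eventually_Ioo hb.1] with t ht
        rw [mul_apply_left _ _ (by linarith [ht.1])]
        rfl
      · filter_upwards [eventually_Ioo hb.1] with t ht
        rw [mul_apply_add _ _ ht.1.le]
    · rw [mul_apply_right _ _ h'.le] at hn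
      refine (hs.turn (b - r.len) ⟨by linarith, by linarith [hb.2]⟩ hn).congr ?_ ?_
      · filter_upwards [eventually_Ioo (sub_pos.2 h')] with t ht
        rw [mul_apply_right _ _ (by linarith [ht.2])]
        congr 2; ring
      · filter_upwards [eventually_Ioo (sub_pos.2 h')] with t ht
        rw [mul_apply_right _ _ (by linarith [ht.1])]
        congr 1; ring

/-- Being reduced is a local condition: it can be checked on two overlapping factors. -/
theorem Reduced.glue {a b c : Route M} (h1 : Reduced (a * b)) (h2 : Reduced (b * c))
    (hb : 0 < b.len) : Reduced (a * b * c) := by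
  refine h1.mul h2.right (h2.transverse.congr ?_ (Eventually.of_forall fun _ => rfl))
  rw [rev_mul]
  exact eventually_mul _ _ hb

theorem Reduced.mid {a b c : Route M} (h : Reduced (a * b * c)) : Reduced (b * c) := by
  rw [mul_assoc] at h
  exact h.right

/-- Whether a letter may be appended depends only on its first point. -/
theorem Reduced.swap {p : Route M} {l l' : Letter M} (h : Reduced (p * single l))
    (hs : l'.start = l.start) : Reduced (p * single l') := by
  refine h.left.mul (reduced_single _) ⟨fun h' => ?_, fun k k' hk hk' => ?_⟩
  · refine absurd hs ?_
    refine h.transverse.2 l' l ?_ (eventually_single l)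
    filter_upwards [h', eventually_single l'] with t h1 h2
    rw [h1, h2]
  · obtain ⟨t, h1, h2⟩ := (hk'.and (eventually_single l')).exists
    rw [h1] at h2
    cases h2
    rw [hs]
    exact h.transverse.2 k l hk (eventually_single l)

theorem Reduced.swap_seg {p : Route M} {j : J} {x y : M j} (h : Reduced (p * seg x y))
    (hxy : x ≠ y) (z : M j) : Reduced (p * seg x z) := by
  by_cases hz : x = z
  · subst hz; simpa using h.left
  · rw [seg_of_ne hxy] at h
    rw [seg_of_ne hz]
    exact h.swap rfl

theorem Reduced.seg_swap {p : Route M} {j : J} {x y : M j} (h : Reduced (seg x y * p))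
    (hxy : x ≠ y) (z : M j) : Reduced (seg z y * p) := by
  have h1 := h.rev
  rw [rev_mul, rev_seg] at h1
  have h2 := (h1.swap_seg hxy.symm z).rev
  rwa [rev_mul, rev_rev, rev_seg] at h2

/-- A fake exit is not reduced. -/
theorem not_reduced_single_mul_single {l l' : Letter M} (h : l.finish = l'.start) :
    ¬ Reduced (single l * single l') := by
  intro h'
  refine h'.transverse.2 l.bar l' ?_ (eventually_single l') h
  rw [rev_single]
  exact eventually_single _

/-- A reduced route whose germ is a letter starts by this letter. -/
theorem Reduced.exists_single_mul {r : Route M} (h : Reduced r) {l : Letter M}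
    (hl : ∀ᶠ t in 𝓝[>] (0 : ℝ), r t = some l) : ∃ s, r = single l * s := by
  obtain ⟨ε, hε, h1⟩ := exists_Ioo_of_eventually hl
  obtain ⟨t, ht⟩ := exists_between hε
  obtain ⟨a, b, ha, hb, hlen, hna, hnb, hab⟩ := h.block t l (h1 t ht)
  obtain ⟨ha0, hbr⟩ := r.block_bounds (ha.trans hb) hab
  have ha' : a = 0 := by
    refine le_antisymm (not_lt.1 fun h' => ?_) ha0
    rw [h1 a ⟨h', ha.trans ht.2⟩] at hna
    cases hna
  subst ha'
  obtain ⟨p, q, rfl, hp⟩ := r.exists_split (ha.trans hb).le hbr hnb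
  refine ⟨q, ?_⟩
  have : p = single l := by
    refine ext_len (by rw [hp, len_single]; linarith) fun x hx => ?_
    rw [hp] at hx
    rw [single_apply l (by rwa [← hlen, sub_zero]), ← hab x hx, mul_apply_left _ _ (hp ▸ hx.2.le)]
  rw [this]

/-- A letter may be appended to a reduced route that does not end at its first point. -/
theorem Reduced.mul_single {r : Route M} (h : Reduced r) {l : Letter M}
    (hl : ∀ s l', r = s * single l' → l'.finish ≠ l.start) : Reduced (r * single l) := by
  have key : ∀ l' : Letter M, l'.start = l.start →
      ¬ ∀ᶠ t in 𝓝[>] (0 : ℝ), r.rev t = some l' := by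
    intro l' hl' hr
    obtain ⟨s, hs⟩ := h.rev.exists_single_mul hr
    refine hl s.rev l'.bar ?_ hl'
    rw [← rev_rev r, hs, rev_mul, rev_single]
  refine h.mul (reduced_single l) ⟨fun h2 => ?_, fun l' k hl' hk hs => ?_⟩
  · exfalso
    refine key l rfl ?_
    filter_upwards [h2, eventually_single l] with t h3 h4
    rw [h3, h4]
  · obtain ⟨t, h2, h3⟩ := (hk.and (eventually_single l)).exists
    rw [h2] at h3
    cases h3
    exact key l' hs hl'

theorem Reduced.eq_one_of_eventually_eq_none {r : Route M} (h : Reduced r)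
    (hn : ∀ᶠ t in 𝓝[>] (0 : ℝ), r t = none) : r = 1 := by
  refine eq_one_of_len (le_antisymm (not_lt.1 fun h0 => ?_) r.len_nonneg)
  obtain ⟨ε, hε, h1⟩ := exists_Ioo_of_eventually hn
  obtain ⟨t, ht, hn⟩ := h.dense 0 (min ε r.len) le_rfl (lt_min hε h0) (min_le_right _ _)
  exact hn (h1 t ⟨ht.1, ht.2.trans_le (min_le_left _ _)⟩)

/-- If one of two reduced routes with a common initial part has a block at a point up to which
they agree, then they agree up to the end of the block. -/
theorem Reduced.agree_block {f g : Route M} (hf : Reduced f) (hg : Reduced g) {s : ℝ}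
    (hag : ∀ t ∈ Ioo 0 s, f t = g t) {l : Letter M} (hs : f s = some l) :
    ∃ b > s, b ≤ f.len ∧ b ≤ g.len ∧ ∀ t ∈ Ioo 0 b, f t = g t := by
  obtain ⟨a, b, ha, hb, hlen, hna, hnb, hab⟩ := hf.block s l hs
  obtain ⟨ha0, hbr⟩ := f.block_bounds (ha.trans hb) hab
  obtain ⟨t, ht⟩ := exists_between ha
  have h1 : g t = some l := by
    rw [← hag t ⟨ha0.trans_lt ht.1, ht.2⟩, hab t ⟨ht.1, ht.2.trans hb⟩]
  obtain ⟨a', b', ha', hb', hlen', hna', hnb', hab'⟩ := hg.block t l h1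
  obtain ⟨ha0', hbr'⟩ := g.block_bounds (ha'.trans hb') hab'
  have e1 : a = a' := by
    rcases lt_trichotomy a a' with h' | h' | h'
    · have := hag a' ⟨by linarith, ha'.trans ht.2⟩
      rw [hna', hab a' ⟨h', by linarith [ht.2]⟩] at this
      cases this
    · exact h'
    · have := hag a ⟨by linarith, ha⟩
      rw [hna, hab' a ⟨h', by linarith [ht.1]⟩] at this
      cases this
  have e2 : b = b' := by linarith
  subst e1 e2
  refine ⟨b, hb, hbr, hbr', fun x hx => ?_⟩
  rcases lt_or_ge x s with h' | h'
  · exact hag x ⟨hx.1, h'⟩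
  · rw [hab x ⟨by linarith, hx.2⟩, hab' x ⟨by linarith, hx.2⟩]

/-- Two reduced routes split after their longest common initial part. -/
theorem exists_common {f g : Route M} (hf : Reduced f) (hg : Reduced g) :
    ∃ c u v : Route M, f = c * u ∧ g = c * v ∧
      ((∀ᶠ t in 𝓝[>] (0 : ℝ), u t = v t) → ∀ᶠ t in 𝓝[>] (0 : ℝ), u t = none) := by
  -- Both routes are cut at the supremum of the lengths of their common initial parts.
  set S : Set ℝ := {s | 0 ≤ s ∧ s ≤ f.len ∧ s ≤ g.len ∧ ∀ t ∈ Ioo 0 s, f t = g t} with hS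
  have hne : S.Nonempty := ⟨0, le_rfl, f.len_nonneg, g.len_nonneg, fun t ht =>
    absurd (ht.1.trans ht.2) (lt_irrefl _)⟩
  have hbd : BddAbove S := ⟨f.len, fun s hs => hs.2.1⟩
  set s := sSup S with hs
  have hsm : s ∈ S := by
    refine ⟨le_csSup hbd ⟨le_rfl, f.len_nonneg, g.len_nonneg, fun t ht =>
      absurd (ht.1.trans ht.2) (lt_irrefl _)⟩, csSup_le hne fun x hx => hx.2.1,
      csSup_le hne fun x hx => hx.2.2.1, fun t ht => ?_⟩
    obtain ⟨x, hx, hx'⟩ := exists_lt_of_lt_csSup hne ht.2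
    exact hx.2.2.2 t ⟨ht.1, hx'⟩
  have hmax : ∀ x ∈ S, x ≤ s := fun x hx => le_csSup hbd hx
  obtain ⟨hs0, hsf, hsg, hag⟩ := hsm
  -- By maximality, neither of the routes is inside of a block at the cut.
  have hfs : f s = none := by
    cases h : f s with
    | none => rfl
    | some l =>
      obtain ⟨b, hb, h1, h2, h3⟩ := hf.agree_block hg hag h
      exact absurd (hmax b ⟨hs0.trans hb.le, h1, h2, h3⟩) (not_le.2 hb)
  have hgs : g s = none := by
    cases h : g s with
    | none => rfl
    | some l =>
      obtain ⟨b, hb, h1, h2, h3⟩ := hg.agree_block hf (fun t ht => (hag t ht).symm) h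
      exact absurd (hmax b ⟨hs0.trans hb.le, h2, h1, fun t ht => (h3 t ht).symm⟩) (not_le.2 hb)
  obtain ⟨c, u, rfl, hc⟩ := f.exists_split hs0 hsf hfs
  obtain ⟨c', v, rfl, hc'⟩ := g.exists_split hs0 hsg hgs
  obtain rfl : c = c' := by
    refine ext_len (hc.trans hc'.symm) fun t ht => ?_
    rw [hc] at ht
    have := hag t ht
    rwa [mul_apply_left _ _ (hc ▸ ht.2.le), mul_apply_left _ _ (hc' ▸ ht.2.le)] at this
  refine ⟨c, u, v, rfl, rfl, fun h => ?_⟩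
  rcases u.len_nonneg.eq_or_lt with h0 | h0
  · exact eventually_eq_none_of_len h0.symm
  rcases v.len_nonneg.eq_or_lt with h1 | h1
  · filter_upwards [h, eventually_eq_none_of_len h1.symm] with t h2 h3
    rw [h2, h3]
  obtain ⟨ε, hε, h2⟩ := exists_Ioo_of_eventually h
  have hm : 0 < min ε (min u.len v.len) := lt_min hε (lt_min h0 h1)
  have hmu := (min_le_right ε (min u.len v.len)).trans (min_le_left _ _)
  have hmv := (min_le_right ε (min u.len v.len)).trans (min_le_right _ _)
  -- If the remainders had a common germ, the common initial part could be prolonged.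
  refine absurd (hmax (s + min ε (min u.len v.len)) ⟨by linarith, ?_, ?_, fun t ht => ?_⟩)
    (by linarith)
  · rw [len_mul, hc]; linarith
  · rw [len_mul, hc]; linarith
  · rcases le_or_gt t c.len with h' | h'
    · rw [mul_apply_left _ _ h', mul_apply_left _ _ h']
    · rw [mul_apply_right _ _ h'.le, mul_apply_right _ _ h'.le]
      exact h2 _ ⟨by linarith, by linarith [ht.2, min_le_left ε (min u.len v.len)]⟩

/-- Two reduced routes either leave their common initial part in transverse directions, or they
leave it by two different letters with the same first point. -/
theorem exists_common_cases {f g : Route M} (hf : Reduced f) (hg : Reduced g) :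
    ∃ c u v : Route M, (f = c * u ∧ g = c * v ∧ Reduced (u.rev * v)) ∨
      ∃ (j : J) (x y z : M j), x ≠ y ∧ x ≠ z ∧ y ≠ z ∧ f = c * (seg x y * u) ∧
        g = c * (seg x z * v) := by
  obtain ⟨c, u, v, rfl, rfl, h⟩ := exists_common hf hg
  by_cases hb : ∃ l l' : Letter M, l.start = l'.start ∧ (∀ᶠ t in 𝓝[>] (0 : ℝ), u t = some l) ∧
      (∀ᶠ t in 𝓝[>] (0 : ℝ), v t = some l')
  · obtain ⟨l, l', hs, hl, hl'⟩ := hb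
    obtain ⟨u', rfl⟩ := hf.right.exists_single_mul hl
    obtain ⟨v', rfl⟩ := hg.right.exists_single_mul hl'
    obtain ⟨j, x, y, hxy⟩ := l
    obtain ⟨j', x', z, hxz⟩ := l'
    obtain ⟨rfl, h2⟩ := Sigma.mk.injEq .. ▸ hs
    obtain rfl := eq_of_heq h2
    refine ⟨c, u', v', Or.inr ⟨j, x, y, z, hxy, hxz, ?_, ?_, ?_⟩⟩
    · rintro rfl
      obtain ⟨t, h1, h2⟩ := ((h (by
        filter_upwards [hl, hl'] with t h1 h2
        rw [h1, h2])).and hl).exists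
      rw [h1] at h2
      cases h2
    · rw [seg_of_ne hxy]
    · rw [seg_of_ne hxz]
  · refine ⟨c, u, v, Or.inl ⟨rfl, rfl, hf.right.rev.mul hg.right ?_⟩⟩
    rw [rev_rev]
    exact ⟨h, fun l l' hl hl' hs => hb ⟨l, l', hs, hl, hl'⟩⟩

end Route

end

end TreeGraded

namespace TreeGraded

noncomputable section

open Filter Topology

variable {J : Type v} {M : J → Type u} [∀ j, MetricSpace (M j)]

/-! ### Elements of the tree product as reduced routes -/

namespace Word

/-- The route underlying an element of the tree product. -/
def route (f : Word M) : Route M where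
  toFun := f.toFun
  len := f.len
  len_nonneg := f.len_nonneg
  supp t ht := by
    have : t ∉ pdom f.toFun := fun h => ht (f.dom_subset h)
    simpa [pdom] using this

@[simp] theorem len_route (f : Word M) : f.route.len = f.len := rfl

theorem route_injective : Function.Injective (route (M := M)) := by
  intro f g h
  have h1 : f.toFun = g.toFun := congrArg Route.toFun h
  have h2 : f.len = g.len := congrArg Route.len h
  cases f; cases g
  simp only at h1 h2
  subst h1 h2
  rfl

theorem isOpen_eq_some (f : Word M) (l : Letter M) : IsOpen {t | f.toFun t = some l} := by
  refine Metric.isOpen_iff.2 fun t ht => ?_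
  obtain ⟨ε, hε, h⟩ := f.locally_const t (by simp [pdom, show f.toFun t = some l from ht])
  refine ⟨ε, hε, fun r hr => ?_⟩
  rw [Real.ball_eq_Ioo] at hr
  exact (h r hr).trans ht

/-- The block of a letter ends at a point outside of the domain: before this point the value is
constant, and at this point it cannot be any letter, because the function is locally constant. -/
theorem exists_right_end (f : Word M) {t : ℝ} {l : Letter M} (h : f.toFun t = some l) :
    ∃ b > t, f.toFun b = none ∧ ∀ s ∈ Ico t b, f.toFun s = some l := by
  set S : Set ℝ := Ici t ∩ {s | f.toFun s = some l}ᶜ with hS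
  have hcl : IsClosed S := isClosed_Ici.inter (f.isOpen_eq_some l).isClosed_compl
  have hne : S.Nonempty := by
    have := f.route.mem_of_eq_some h
    refine ⟨f.len, this.2.le, fun h' => ?_⟩
    exact lt_irrefl _ (f.route.mem_of_eq_some h').2
  have hbd : BddBelow S := ⟨t, fun s hs => hs.1⟩
  obtain ⟨h1, h2⟩ := hcl.csInf_mem hne hbd
  set b := sInf S
  have hlt : t < b := lt_of_le_of_ne h1 fun h' => h2 (by rw [← h']; exact h)
  have hin : ∀ s ∈ Ico t b, f.toFun s = some l := fun s hs => by
    by_contra h'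
    exact absurd (csInf_le hbd ⟨hs.1, h'⟩) (not_le.2 hs.2)
  refine ⟨b, hlt, ?_, hin⟩
  cases hb : f.toFun b with
  | none => rfl
  | some l' =>
    obtain ⟨ε, hε, h3⟩ := f.locally_const b (by simp [pdom, hb])
    obtain ⟨s, hs⟩ := exists_between (max_lt hlt (sub_lt_self b hε))
    have h4 := h3 s ⟨(le_max_right _ _).trans_lt hs.1, by linarith [hs.2]⟩
    rw [hin s ⟨((le_max_left _ _).trans_lt hs.1).le, hs.2⟩] at h4
    exact absurd h4.symm h2

theorem exists_left_end (f : Word M) {t : ℝ} {l : Letter M} (h : f.toFun t = some l) :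
    ∃ a < t, f.toFun a = none ∧ ∀ s ∈ Ioc a t, f.toFun s = some l := by
  set S : Set ℝ := Iic t ∩ {s | f.toFun s = some l}ᶜ with hS
  have hcl : IsClosed S := isClosed_Iic.inter (f.isOpen_eq_some l).isClosed_compl
  have hne : S.Nonempty := by
    have := f.route.mem_of_eq_some h
    refine ⟨0, this.1.le, fun h' => ?_⟩
    exact lt_irrefl _ (f.route.mem_of_eq_some h').1
  have hbd : BddAbove S := ⟨t, fun s hs => hs.1⟩
  obtain ⟨h1, h2⟩ := hcl.csSup_mem hne hbd
  set b := sSup S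
  have hlt : b < t := lt_of_le_of_ne h1 fun h' => h2 (by rw [h']; exact h)
  have hin : ∀ s ∈ Ioc b t, f.toFun s = some l := fun s hs => by
    by_contra h'
    exact absurd (le_csSup hbd ⟨hs.2, h'⟩) (not_le.2 hs.1)
  refine ⟨b, hlt, ?_, hin⟩
  cases hb : f.toFun b with
  | none => rfl
  | some l' =>
    obtain ⟨ε, hε, h3⟩ := f.locally_const b (by simp [pdom, hb])
    obtain ⟨s, hs⟩ := exists_between (lt_min hlt (lt_add_of_pos_right b hε))
    have h4 := h3 s ⟨by linarith [hs.1], hs.2.trans_le (min_le_right _ _)⟩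
    rw [hin s ⟨hs.1, (hs.2.trans_le (min_le_left _ _)).le⟩] at h4
    exact absurd h4.symm h2

theorem isMaxInterval {f : Word M} {a b : ℝ} {l : Letter M} (hab : a < b) (ha : f.toFun a = none)
    (hb : f.toFun b = none) (h : ∀ s ∈ Ioo a b, f.toFun s = some l) :
    IsMaxInterval (pdom f.toFun) a b :=
  ⟨hab, fun s hs => by simp [pdom, h s hs], by simp [pdom, ha], by simp [pdom, hb]⟩

theorem exists_block (f : Word M) {t : ℝ} {l : Letter M} (h : f.toFun t = some l) :
    ∃ a b, a < t ∧ t < b ∧ b - a = l.length ∧ f.toFun a = none ∧ f.toFun b = none ∧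
      ∀ s ∈ Ioo a b, f.toFun s = some l := by
  obtain ⟨b, hb, hnb, hb'⟩ := f.exists_right_end h
  obtain ⟨a, ha, hna, ha'⟩ := f.exists_left_end h
  have hab : ∀ s ∈ Ioo a b, f.toFun s = some l := fun s hs => by
    rcases le_or_gt s t with h' | h'
    · exact ha' s ⟨hs.1, h'⟩
    · exact hb' s ⟨h'.le, hs.2⟩
  exact ⟨a, b, ha, hb, f.length_eq a b (isMaxInterval (ha.trans hb) hna hnb hab) t ⟨ha, hb⟩ l h,
    hna, hnb, hab⟩

/-- A cut at which the two germs coincide up to reversal is a place of backtracking, and a cut at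
which two letters meet that leave the same point is a fake exit. -/
theorem reduced (f : Word M) : f.route.Reduced where
  block _ _ h := f.exists_block h
  dense a b h1 h2 h3 := by
    obtain ⟨t, ht⟩ := exists_between h2
    obtain ⟨s, hs, hs'⟩ := mem_closure_iff.1
      (f.dom_dense ⟨h1.trans_lt ht.1, ht.2.trans_le h3⟩) _ isOpen_Ioo ht
    exact ⟨s, hs, fun h => by simp [pdom, show f.toFun s = none from h] at hs'⟩
  turn b hb hn := by
    constructor
    · intro h
      exfalso
      obtain ⟨ε, hε, h1⟩ := exists_Ioo_of_eventually h
      have hm : 0 < min ε (min b (f.len - b)) := lt_min hε (lt_min hb.1 (sub_pos.2 hb.2))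
      set q := min ε (min b (f.len - b)) with hq
      have h2 : q ≤ ε := min_le_left _ _
      have h3 : q ≤ b := (min_le_right _ _).trans (min_le_left _ _)
      have h4 : q ≤ f.len - b := (min_le_right _ _).trans (min_le_right _ _)
      obtain ⟨t, ht, hne⟩ := f.no_backtrack b q hm
        fun t ht => ⟨by linarith [ht.1], by linarith [ht.2]⟩
      refine hne ?_
      rcases lt_trichotomy t b with h' | h' | h'
      · have h5 : (f.toFun (b - (b - t))).map Letter.bar = f.toFun (b + (b - t)) :=
          h1 (b - t) ⟨by linarith, by linarith [ht.1]⟩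
        rw [show 2 * b - t = b + (b - t) by ring, ← h5, Letter.map_bar_bar, sub_sub_cancel]
      · subst h'
        have h5 : f.toFun t = none := hn
        rw [show 2 * t - t = t by ring, h5]; rfl
      · have h5 : (f.toFun (b - (t - b))).map Letter.bar = f.toFun (b + (t - b)) :=
          h1 (t - b) ⟨by linarith, by linarith [ht.2]⟩
        rw [show 2 * b - t = b - (t - b) by ring, h5, add_sub_cancel]
    · intro l l' hl hl'
      obtain ⟨ε, hε, h1⟩ := exists_Ioo_of_eventually hl
      obtain ⟨ε', hε', h1'⟩ := exists_Ioo_of_eventually hl'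
      obtain ⟨t, ht⟩ := exists_between hε
      obtain ⟨t', ht'⟩ := exists_between hε'
      have h2 : ∀ s ∈ Ioo 0 ε, f.toFun (b - s) = some l.bar := fun s hs => by
        have h3 : (f.toFun (b - s)).map Letter.bar = some l := h1 s hs
        rw [← Letter.map_bar_bar (f.toFun (b - s)), h3]; rfl
      obtain ⟨a₁, b₁, ha₁, hb₁, -, hna₁, hnb₁, hab₁⟩ := f.exists_block (h2 t ht)
      obtain ⟨a₂, b₂, ha₂, hb₂, -, hna₂, hnb₂, hab₂⟩ := f.exists_block (h1' t' ht')
      have hn' : f.toFun b = none := hn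
      obtain rfl : b₁ = b := by
        refine le_antisymm (not_lt.1 fun h' => ?_) (not_lt.1 fun h' => ?_)
        · rw [hab₁ b ⟨by linarith [ht.1], h'⟩] at hn'
          cases hn'
        · have := h2 (b - b₁) ⟨by linarith, by linarith [ht.2]⟩
          rw [sub_sub_cancel, hnb₁] at this
          cases this
      obtain rfl : a₂ = b₁ := by
        refine le_antisymm (not_lt.1 fun h' => ?_) (not_lt.1 fun h' => ?_)
        · have : f.toFun (b₁ + (a₂ - b₁)) = some l' :=
            h1' (a₂ - b₁) ⟨by linarith, by linarith [ht'.2]⟩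
          rw [add_sub_cancel, hna₂] at this
          cases this
        · rw [hab₂ b₁ ⟨h', by linarith [ht'.1]⟩] at hn'
          cases hn'
      have := f.no_fake_exit a₁ a₂ b₂ (isMaxInterval (ha₁.trans hb₁) hna₁ hnb₁ hab₁)
        (isMaxInterval (ha₂.trans hb₂) hna₂ hnb₂ hab₂) _ ⟨ha₁, hb₁⟩ _ ⟨ha₂, hb₂⟩ l.bar l'
        (hab₁ _ ⟨ha₁, hb₁⟩) (hab₂ _ ⟨ha₂, hb₂⟩)
      exact this

end Word

namespace Route

theorem Reduced.isMaxInterval_eq {r : Route M} (h : Reduced r) {a b : ℝ}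
    (hab : IsMaxInterval (pdom r.toFun) a b) {t : ℝ} (ht : t ∈ Ioo a b) {l : Letter M}
    (hl : r t = some l) : b - a = l.length ∧ ∀ s ∈ Ioo a b, r s = some l := by
  obtain ⟨hlt, hsub, hna, hnb⟩ := hab
  obtain ⟨a', b', ha', hb', hlen, hna', hnb', h'⟩ := h.block t l hl
  have e1 : a = a' := by
    rcases lt_trichotomy a a' with h1 | h1 | h1
    · have := hsub ⟨h1, ha'.trans ht.2⟩
      simp [pdom, hna'] at this
    · exact h1
    · refine absurd ?_ hna
      simp [pdom, h' a ⟨h1, ht.1.trans hb'⟩]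
  have e2 : b = b' := by
    rcases lt_trichotomy b b' with h1 | h1 | h1
    · refine absurd ?_ hnb
      simp [pdom, h' b ⟨ha'.trans ht.2, h1⟩]
    · exact h1
    · have := hsub ⟨ht.1.trans hb', h1⟩
      simp [pdom, hnb'] at this
  subst e1 e2
  exact ⟨hlen, h'⟩

/-- A reduced route, as an element of the tree product. -/
def toWord (r : Route M) (h : Reduced r) : Word M where
  toFun := r.toFun
  len := r.len
  len_nonneg := r.len_nonneg
  isOpen_dom := by
    refine isOpen_iff_mem_nhds.2 fun t ht => ?_
    obtain ⟨l, hl⟩ := Option.isSome_iff_exists.1 ht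
    obtain ⟨a, b, ha, hb, -, -, -, hab⟩ := h.block t l hl
    filter_upwards [Ioo_mem_nhds ha hb] with s hs
    simp [pdom, hab s hs]
  dom_subset t ht := by
    obtain ⟨l, hl⟩ := Option.isSome_iff_exists.1 ht
    exact r.mem_of_eq_some hl
  dom_dense t ht := by
    refine mem_closure_iff_nhds.2 fun U hU => ?_
    obtain ⟨a, b, hab, hU'⟩ := mem_nhds_iff_exists_Ioo_subset.1 hU
    obtain ⟨s, hs, hn⟩ := h.dense (max a 0) (min b r.len) (le_max_right _ _)
      (max_lt (lt_min (hab.1.trans hab.2) (hab.1.trans ht.2))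
        (lt_min (ht.1.trans hab.2) (ht.1.trans ht.2))) (min_le_right _ _)
    exact ⟨s, hU' ⟨(le_max_left _ _).trans_lt hs.1, hs.2.trans_le (min_le_left _ _)⟩,
      Option.isSome_iff_ne_none.2 hn⟩
  locally_const t ht := by
    obtain ⟨l, hl⟩ := Option.isSome_iff_exists.1 ht
    obtain ⟨a, b, ha, hb, -, -, -, hab⟩ := h.block t l hl
    refine ⟨min (t - a) (b - t), lt_min (sub_pos.2 ha) (sub_pos.2 hb), fun s hs => ?_⟩
    rw [hl, hab s ⟨by linarith [hs.1, min_le_left (t - a) (b - t)],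
      by linarith [hs.2, min_le_right (t - a) (b - t)]⟩]
  length_eq a b hab t ht l hl := (h.isMaxInterval_eq hab ht hl).1
  no_fake_exit a b c hab hbc t ht s hs l l' hl hl' := by
    have hlt := hab.1
    have hlt' := hbc.1
    have h1 := (h.isMaxInterval_eq hab ht hl).2
    have h2 := (h.isMaxInterval_eq hbc hs hl').2
    have hb0 := (r.block_bounds hlt h1).1.trans_lt hlt
    have hb1 := hlt'.trans_le (r.block_bounds hlt' h2).2
    have hbn : r b = none := by simpa [pdom] using hbc.2.2.1
    refine (h.turn b ⟨hb0, hb1⟩ hbn).2 l.bar l' ?_ ?_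
    · filter_upwards [eventually_Ioo (sub_pos.2 hlt)] with x hx
      rw [h1 (b - x) ⟨by linarith [hx.2], by linarith [hx.1]⟩]
      rfl
    · filter_upwards [eventually_Ioo (sub_pos.2 hlt')] with x hx
      rw [h2 (b + x) ⟨by linarith [hx.1], by linarith [hx.2]⟩]
  no_backtrack p q hq hpq := by
    by_contra! hall
    have hp : p ∈ Ioo 0 r.len := hpq ⟨by linarith, by linarith⟩
    have h1 := hall p ⟨by linarith, by linarith⟩
    rw [show 2 * p - p = p by ring] at h1
    have hpn : r p = none := by
      cases h2 : r p with
      | none => rfl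
      | some l =>
        rw [h2, Option.map_some, Option.some.injEq] at h1
        exact absurd (congrArg Letter.start h1) (Letter.start_ne_finish l).symm
    have h2 := (h.turn p hp hpn).1 (by
      filter_upwards [eventually_Ioo hq] with x hx
      have := hall (p + x) ⟨by linarith [hx.1], by linarith [hx.2]⟩
      rw [show 2 * p - (p + x) = p - x by ring] at this
      exact this)
    obtain ⟨ε, hε, h3⟩ := exists_Ioo_of_eventually h2
    obtain ⟨t, ht, hn⟩ := h.dense (p - min ε p) p (by linarith [min_le_right ε p])
      (by linarith [lt_min hε hp.1]) hp.2.le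
    have h4 := h3 (p - t) ⟨by linarith [ht.2], by linarith [ht.1, min_le_left ε p]⟩
    simp only [sub_sub_cancel, Option.map_eq_none_iff] at h4
    exact hn h4

@[simp] theorem route_toWord (r : Route M) (h : Reduced r) : (r.toWord h).route = r := rfl

@[simp] theorem len_toWord (r : Route M) (h : Reduced r) : (r.toWord h).len = r.len := rfl

end Route

namespace Word

open Route

/-! ### The distance in terms of routes -/

/-- Two words diverge at the end of a common initial part after which they have no common germ. -/
theorem div_eq {f g : Word M} {c u v : Route M} (hf : f.route = c * u) (hg : g.route = c * v)
    (h : (∀ᶠ t in 𝓝[>] (0 : ℝ), u t = v t) → ∀ᶠ t in 𝓝[>] (0 : ℝ), u t = none) :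
    div f g = c.len := by
  have hfl : f.len = c.len + u.len := congrArg Route.len hf
  have hgl : g.len = c.len + v.len := congrArg Route.len hg
  have hft : ∀ t, f.toFun t = (c * u) t := fun t => congrArg (fun r : Route M => r t) hf
  have hgt : ∀ t, g.toFun t = (c * v) t := fun t => congrArg (fun r : Route M => r t) hg
  refine IsGreatest.csSup_eq ⟨⟨c.len_nonneg, by linarith [u.len_nonneg],
    by linarith [v.len_nonneg], fun t ht => ?_⟩, fun s hs => ?_⟩
  · rw [hft, hgt, mul_apply_left _ _ ht.2.le, mul_apply_left _ _ ht.2.le]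
  · by_contra! hlt
    have hu := h (by
      filter_upwards [eventually_Ioo (sub_pos.2 hlt)] with t ht
      have := hs.2.2.2 (c.len + t) ⟨by linarith [ht.1, c.len_nonneg], by linarith [ht.2]⟩
      rwa [hft, hgt, mul_apply_add _ _ ht.1.le, mul_apply_add _ _ ht.1.le] at this)
    have hr := f.reduced
    rw [hf] at hr
    rw [hr.right.eq_one_of_eventually_eq_none hu] at hfl
    rw [len_one] at hfl
    linarith [hs.2.1]

theorem blockEnd_of_single {f : Word M} {c u : Route M} {l : Letter M}
    (hf : f.route = c * (single l * u)) : f.blockEnd c.len = c.len + l.length := by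
  have hft : ∀ t, f.toFun t = (c * (single l * u)) t := fun t =>
    congrArg (fun r : Route M => r t) hf
  have hl := l.length_pos
  refine IsGreatest.csSup_eq ⟨⟨by linarith, fun t ht => ?_⟩, fun a ha => ?_⟩
  · have : f.toFun t = some l := by
      rw [hft, mul_apply_right _ _ ht.1.le, mul_apply_left _ _ (by simp; linarith [ht.2]),
        single_apply _ ⟨by linarith [ht.1], by linarith [ht.2]⟩]
    simp [pdom, this]
  · by_contra! hlt
    have := ha.2 ⟨by linarith, hlt⟩
    have h2 : f.toFun (c.len + l.length) = none := by
      rw [hft, mul_apply_add _ _ hl.le, ← len_single, mul_apply_len]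
    simp [pdom, h2] at this

theorem blockLetter_of_single {f : Word M} {c u : Route M} {l : Letter M}
    (hf : f.route = c * (single l * u)) : f.blockLetter c.len = some l := by
  have hft : ∀ t, f.toFun t = (c * (single l * u)) t := fun t =>
    congrArg (fun r : Route M => r t) hf
  have hl := l.length_pos
  rw [blockLetter, blockEnd_of_single hf, if_pos (by linarith), hft,
    mul_apply_right _ _ (by linarith), mul_apply_left _ _ (by simp; linarith),
    single_apply _ ⟨by linarith, by linarith⟩]

theorem exists_single_of_blockLetter {f : Word M} {c u : Route M} {l : Letter M}
    (hf : f.route = c * u) (h : f.blockLetter c.len = some l) : ∃ u', u = single l * u' := by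
  have hft : ∀ t, f.toFun t = (c * u) t := fun t => congrArg (fun r : Route M => r t) hf
  have hr := f.reduced
  rw [hf] at hr
  have hs : c.len < f.blockEnd c.len := by
    by_contra h'
    rw [blockLetter, if_neg h'] at h
    cases h
  obtain ⟨a, ha, ha'⟩ := exists_lt_of_lt_csSup (s := {a | c.len ≤ a ∧ Ioo c.len a ⊆ pdom f.toFun})
    ⟨c.len, le_rfl, by simp⟩ hs
  obtain ⟨t, ht⟩ := exists_between ha'
  obtain ⟨l', hl'⟩ := Option.isSome_iff_exists.1 (ha.2 ht)
  have h1 := hl'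
  rw [hft, mul_apply_right _ _ ht.1.le] at h1
  obtain ⟨x, y, hx, hy, -, hnx, -, hxy⟩ := hr.right.block _ _ h1
  have hx0 := (u.block_bounds (hx.trans hy) hxy).1
  have : x = 0 := by
    refine le_antisymm (not_lt.1 fun h2 => ?_) hx0
    have h3 := ha.2 (show c.len + x ∈ Ioo c.len a from ⟨by linarith, by linarith [ht.2]⟩)
    have h4 : f.toFun (c.len + x) = none := by rw [hft, mul_apply_add _ _ h2.le, hnx]
    simp [pdom, h4] at h3
  subst this
  obtain ⟨u', rfl⟩ := hr.right.exists_single_mul (l := l') (by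
    filter_upwards [eventually_Ioo (hx.trans hy)] with z hz
    exact hxy z hz)
  rw [blockLetter_of_single hf] at h
  cases h
  exact ⟨u', rfl⟩

theorem D_of_transverse {f g : Word M} {c u v : Route M} (hf : f.route = c * u)
    (hg : g.route = c * v) (h : Transverse u v) : D f g = u.len + v.len := by
  have hfl : f.len = c.len + u.len := congrArg Route.len hf
  have hgl : g.len = c.len + v.len := congrArg Route.len hg
  rw [D, div_eq hf hg h.1]
  split
  · next l l' hl hl' =>
    obtain ⟨u', rfl⟩ := exists_single_of_blockLetter hf hl
    obtain ⟨v', rfl⟩ := exists_single_of_blockLetter hg hl'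
    rw [if_neg (h.2 l l' (eventually_single_mul l _) (eventually_single_mul l' _)), hfl, hgl]
    ring
  · rw [hfl, hgl]; ring

/-- The case in which `D` is computed inside of one of the spaces. -/
theorem D_of_seg {f g : Word M} {c u v : Route M} {j : J} {x y z : M j} (hxy : x ≠ y)
    (hxz : x ≠ z) (hyz : y ≠ z) (hf : f.route = c * (seg x y * u))
    (hg : g.route = c * (seg x z * v)) : D f g = u.len + (dist y z + v.len) := by
  have hfl : f.len = c.len + (dist x y + u.len) := by
    have := congrArg Route.len hf
    simpa using this
  have hgl : g.len = c.len + (dist x z + v.len) := by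
    have := congrArg Route.len hg
    simpa using this
  rw [seg_of_ne hxy] at hf
  rw [seg_of_ne hxz] at hg
  have hd : div f g = c.len := by
    refine div_eq hf hg fun h => ?_
    obtain ⟨t, h1, h2, h3⟩ := (h.and ((eventually_single_mul _ u).and
      (eventually_single_mul _ v))).exists
    rw [h2, h3, Option.some.injEq, Letter.mk.injEq] at h1
    exact absurd (eq_of_heq h1.2.2) hyz
  rw [D, hd, blockLetter_of_single hf, blockLetter_of_single hg]
  refine (if_pos rfl).trans ?_
  rw [blockEnd_of_single hf, blockEnd_of_single hg]
  simp only [Letter.finish, Letter.length, sigmaDist_mk]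
  linarith

/-- `k` is the reduced form of `f⁻¹ g`. The geodesics between the empty word, `f` and `g` form a
tripod whose centre is a triangle `x`, `y`, `z` in some `M j`, where any two of the three points
may coincide. -/
def Fork (f g k : Word M) : Prop :=
  ∃ (j : J) (x y z : M j) (c u v : Route M), f.route = c * (seg x y * u) ∧
    g.route = c * (seg x z * v) ∧ k.route = u.rev * (seg y z * v)

/-- The tripods whose central triangle is not a single point have three different corners. -/
theorem Fork.cases {f g k : Word M} (h : Fork f g k) : ∃ c u v : Route M,
    (f.route = c * u ∧ g.route = c * v ∧ k.route = u.rev * v) ∨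
      ∃ (j : J) (x y z : M j), x ≠ y ∧ x ≠ z ∧ y ≠ z ∧ f.route = c * (seg x y * u) ∧
        g.route = c * (seg x z * v) ∧ k.route = u.rev * (seg y z * v) := by
  obtain ⟨j, x, y, z, c, u, v, hf, hg, hk⟩ := h
  by_cases hxy : x = y
  · subst hxy
    exact ⟨c, u, seg x z * v, Or.inl ⟨by simpa using hf, hg, hk⟩⟩
  by_cases hxz : x = z
  · subst hxz
    exact ⟨c, seg x y * u, v, Or.inl ⟨hf, by simpa using hg, by simpa [mul_assoc] using hk⟩⟩
  by_cases hyz : y = z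
  · subst hyz
    refine ⟨c * seg x y, u, v, Or.inl ⟨by rw [hf, mul_assoc], by rw [hg, mul_assoc], ?_⟩⟩
    simpa using hk
  exact ⟨c, u, v, Or.inr ⟨j, x, y, z, hxy, hxz, hyz, hf, hg, hk⟩⟩

theorem transverse_of_reduced {u v : Route M} (h : Reduced (u.rev * v)) : Transverse u v := by
  simpa using h.transverse

theorem Fork.D_eq {f g k : Word M} (h : Fork f g k) : D f g = k.len := by
  obtain ⟨c, u, v, ⟨hf, hg, hk⟩ | ⟨j, x, y, z, hxy, hxz, hyz, hf, hg, hk⟩⟩ := h.cases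
  · rw [D_of_transverse hf hg (transverse_of_reduced (by rw [← hk]; exact k.reduced))]
    exact (congrArg Route.len hk).symm
  · rw [D_of_seg hxy hxz hyz hf hg]
    have := congrArg Route.len hk
    simpa using this.symm

/-- The reduced form of `f⁻¹ g` is unique. The common initial part of `f` and `g` ends at the point
of diverging, and the two cases of `Fork.cases` exclude each other, since after that point `f` and
`g` continue in transverse directions in one case and inside of one copy of a space in the other. -/
theorem Fork.unique {f g k k' : Word M} (h : Fork f g k) (h' : Fork f g k') : k = k' := by
  refine route_injective ?_
  have key : ∀ {c c' u v u' v' : Route M} {k₀ : Word M}, f.route = c * u → g.route = c * v →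
      k₀.route = u.rev * v → f.route = c' * u' → g.route = c' * v' →
      ((∀ᶠ t in 𝓝[>] (0 : ℝ), u' t = v' t) → ∀ᶠ t in 𝓝[>] (0 : ℝ), u' t = none) →
      u = u' ∧ v = v' := by
    intro c c' u v u' v' k₀ hf hg hk hf' hg' hd
    have h1 := div_eq hf hg
      (transverse_of_reduced (by rw [← hk]; exact k₀.reduced)).1
    have h2 := div_eq hf' hg' hd
    rw [hf] at hf'
    rw [hg] at hg'
    exact ⟨(mul_left_inj_of_len hf' (h1.symm.trans h2)).2,
      (mul_left_inj_of_len hg' (h1.symm.trans h2)).2⟩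
  have dseg : ∀ {j : J} {x y z : M j} {u v : Route M}, x ≠ y → x ≠ z → y ≠ z →
      ((∀ᶠ t in 𝓝[>] (0 : ℝ), (seg x y * u) t = (seg x z * v) t) →
        ∀ᶠ t in 𝓝[>] (0 : ℝ), (seg x y * u) t = none) := by
    intro j x y z u v hxy hxz hyz h
    rw [seg_of_ne hxy, seg_of_ne hxz] at h
    obtain ⟨t, h1, h2, h3⟩ := (h.and ((eventually_single_mul _ u).and
      (eventually_single_mul _ v))).exists
    rw [h2, h3, Option.some.injEq, Letter.mk.injEq] at h1
    exact absurd (eq_of_heq h1.2.2) hyz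
  have excl : ∀ {j : J} {x y z : M j} {u v : Route M} {k₀ : Word M}, x ≠ y → x ≠ z →
      k₀.route = (seg x y * u).rev * (seg x z * v) → False := by
    intro j x y z u v k₀ hxy hxz hk
    have := transverse_of_reduced (by rw [← hk]; exact k₀.reduced)
    rw [seg_of_ne hxy, seg_of_ne hxz] at this
    exact this.2 _ _ (eventually_single_mul _ _) (eventually_single_mul _ _) rfl
  obtain ⟨c, u, v, ⟨hf, hg, hk⟩ | ⟨j, x, y, z, hxy, hxz, hyz, hf, hg, hk⟩⟩ := h.cases <;>
    obtain ⟨c', u', v', ⟨hf', hg', hk'⟩ | ⟨j', x', y', z', hxy', hxz', hyz', hf', hg', hk'⟩⟩ :=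
      h'.cases
  · obtain ⟨rfl, rfl⟩ := key hf hg hk hf' hg'
      (transverse_of_reduced (by rw [← hk']; exact k'.reduced)).1
    rw [hk, hk']
  · obtain ⟨rfl, rfl⟩ := key hf hg hk hf' hg' (dseg hxy' hxz' hyz')
    exact (excl hxy' hxz' hk).elim
  · obtain ⟨rfl, rfl⟩ := key hf' hg' hk' hf hg (dseg hxy hxz hyz)
    exact (excl hxy hxz hk').elim
  · have h1 := div_eq hf hg (dseg hxy hxz hyz)
    have h2 := div_eq hf' hg' (dseg hxy' hxz' hyz')
    rw [hf] at hf'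
    rw [hg] at hg'
    obtain ⟨-, h3⟩ := mul_left_inj_of_len hf' (h1.symm.trans h2)
    obtain ⟨-, h4⟩ := mul_left_inj_of_len hg' (h1.symm.trans h2)
    rw [seg_of_ne hxy, seg_of_ne hxy'] at h3
    rw [seg_of_ne hxz, seg_of_ne hxz'] at h4
    obtain ⟨h5, rfl⟩ := single_mul_inj h3
    obtain ⟨h6, rfl⟩ := single_mul_inj h4
    rw [Letter.mk.injEq] at h5 h6
    obtain ⟨rfl, -, h5⟩ := h5
    obtain rfl := eq_of_heq h5
    obtain rfl := eq_of_heq h6.2.2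
    rw [hk, hk']

theorem Fork.symm {f g k : Word M} (h : Fork f g k) :
    Fork g f (k.route.rev.toWord k.reduced.rev) := by
  obtain ⟨j, x, y, z, c, u, v, hf, hg, hk⟩ := h
  exact ⟨j, x, z, y, c, v, u, hg, hf, by simp [hk, mul_assoc]⟩

theorem Fork.rotate {f g k : Word M} (h : Fork f g k) :
    Fork (f.route.rev.toWord f.reduced.rev) k g := by
  obtain ⟨j, x, y, z, c, u, v, hf, hg, hk⟩ := h
  exact ⟨j, y, x, z, u.rev, c.rev, v, by simp [hf, mul_assoc], hk, by simp [hg]⟩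

/-- The reduced form of `f⁻¹ g` is obtained by cancelling the common initial part and, if `f` and
`g` leave it by letters `(x, y)` and `(x, z)`, by replacing these letters with `(y, z)`. -/
theorem exists_fork [hne : Nonempty (Σ j, M j)] (f g : Word M) : ∃ k, Fork f g k := by
  obtain ⟨c, u, v, ⟨hf, hg, hk⟩ | ⟨j, x, y, z, hxy, hxz, hyz, hf, hg⟩⟩ :=
    exists_common_cases f.reduced g.reduced
  · obtain ⟨j, x⟩ := hne
    exact ⟨toWord _ hk, j, x, x, x, c, u, v, by simpa using hf, by simpa using hg, by simp⟩
  · have h1 := f.reduced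
    have h2 := g.reduced
    rw [hf] at h1
    rw [hg] at h2
    have h3 := h1.right.seg_swap hxy z
    have h4 := h2.right.seg_swap hxz y
    have h5 := h3.rev
    rw [rev_mul, rev_seg] at h5
    have h6 := h5.glue h4 (by simpa using hyz)
    rw [mul_assoc] at h6
    exact ⟨toWord _ h6, j, x, y, z, c, u, v, hf, hg, rfl⟩

end Word

end

end TreeGraded

namespace TreeGraded

noncomputable section

open Filter Topology

variable {J : Type v} {M : J → Type u} [∀ j, MetricSpace (M j)]

namespace Word

open Route

/-! ### Left translations and the metric -/

instance : One (Word M) := ⟨toWord 1 reduced_one⟩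

@[simp] theorem route_one : (1 : Word M).route = 1 := rfl

@[simp] theorem len_one : (1 : Word M).len = 0 := rfl

theorem eq_one_of_len {f : Word M} (h : f.len = 0) : f = 1 :=
  route_injective (Route.eq_one_of_len h)

/-- The word `f` run backwards. -/
def inv (f : Word M) : Word M := f.route.rev.toWord f.reduced.rev

@[simp] theorem route_inv (f : Word M) : f.inv.route = f.route.rev := rfl

@[simp] theorem inv_inv (f : Word M) : f.inv.inv = f := route_injective (by simp)

/-- The word `p` does not end at the point `x`, so that a copy of `M j` may be attached to `p`
at `x`. -/
def Avoids (p : Word M) {j : J} (x : M j) : Prop := ∀ y, Reduced (p.route * seg x y)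

/-- The point of the copy of `M j` attached to `p` at `x` that corresponds to `y : M j`. -/
def app (p : Word M) {j : J} (x : M j) (h : Avoids p x) (y : M j) : Word M := toWord _ (h y)

@[simp] theorem route_app (p : Word M) {j : J} (x : M j) (h : Avoids p x) (y : M j) :
    (p.app x h y).route = p.route * seg x y := rfl

theorem Fork.of_seg {f g : Word M} {p : Route M} {j : J} {x y z : M j}
    (hf : f.route = p * seg x y) (hg : g.route = p * seg x z) :
    Fork f g (toWord _ (reduced_seg y z)) :=
  ⟨j, x, y, z, p, 1, 1, by simpa using hf, by simpa using hg, by simp⟩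

theorem D_seg {f g : Word M} {p : Route M} {j : J} {x y z : M j}
    (hf : f.route = p * seg x y) (hg : g.route = p * seg x z) : D f g = dist y z := by
  rw [(Fork.of_seg hf hg).D_eq]
  simp

variable [hne : Nonempty (Σ j, M j)]

theorem D_prefix {f g : Word M} {v : Route M} (hg : g.route = f.route * v) : D f g = v.len := by
  obtain ⟨j, x⟩ := hne
  have hv : Reduced v := by
    have := g.reduced
    rw [hg] at this
    exact this.right
  have : Fork f g (toWord v hv) :=
    ⟨j, x, x, x, f.route, 1, v, by simp, by simpa using hg, by simp⟩
  rw [this.D_eq]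
  rfl

/-- The reduced form of `f⁻¹ g`. As a function of `g` it is the left translation that takes `f`
to the empty word. -/
def diff (f g : Word M) : Word M := (exists_fork f g).choose

theorem fork_diff (f g : Word M) : Fork f g (diff f g) := (exists_fork f g).choose_spec

theorem diff_eq {f g k : Word M} (h : Fork f g k) : diff f g = k := (fork_diff f g).unique h

theorem D_eq_len_diff (f g : Word M) : D f g = (diff f g).len := (fork_diff f g).D_eq

theorem diff_inv_diff (f g : Word M) : diff f.inv (diff f g) = g := diff_eq (fork_diff f g).rotate

theorem diff_self (f : Word M) : diff f f = 1 := by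
  obtain ⟨j, x⟩ := id hne
  exact diff_eq ⟨j, x, x, x, f.route, 1, 1, by simp, by simp, by simp⟩

theorem D_self (f : Word M) : D f f = 0 := by rw [D_eq_len_diff, diff_self, len_one]

theorem D_comm (f g : Word M) : D f g = D g f := by
  rw [(fork_diff f g).symm.D_eq, (fork_diff f g).D_eq]
  rfl

theorem eq_of_D_eq_zero {f g : Word M} (h : D f g = 0) : f = g := by
  rw [D_eq_len_diff] at h
  rw [← diff_inv_diff f g, eq_one_of_len h, ← diff_self f, diff_inv_diff]

theorem D_one_left (f : Word M) : D 1 f = f.len :=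
  D_prefix (by simp : f.route = (1 : Word M).route * f.route)

/-- The triangle inequality for triangles with a corner at the empty word. -/
theorem abs_len_sub_len_le (f g : Word M) : |f.len - g.len| ≤ D f g := by
  obtain ⟨j, x, y, z, c, u, v, hf, hg, hk⟩ := fork_diff f g
  have h1 := congrArg Route.len hf
  have h2 := congrArg Route.len hg
  have h3 := congrArg Route.len hk
  simp only [len_route, len_mul, len_seg, len_rev] at h1 h2 h3
  rw [D_eq_len_diff, h1, h2, h3, abs_le]
  have := dist_triangle x y z
  have := dist_triangle x z y
  have := dist_comm y z
  constructor <;> linarith [u.len_nonneg, v.len_nonneg]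

/-- A left translation preserves the distance between a word and its initial part. -/
theorem D_diff_prefix (e : Word M) {f g : Word M} {v : Route M} (hg : g.route = f.route * v) :
    D (diff e f) (diff e g) = v.len := by
  have hv : Reduced v := by
    have := g.reduced
    rw [hg] at this
    exact this.right
  obtain ⟨j, x, y, z, c, u, w, he, hg', hk⟩ := fork_diff e g
  have hfg : f.route * v = c * (seg x z * w) := hg ▸ hg'
  rcases le_or_gt f.route.len c.len with hl | hl
  · obtain ⟨m, rfl, rfl⟩ := exists_middle hfg hl
    have h1 := e.reduced
    rw [he, mul_assoc] at h1
    have hf : diff e f = toWord _ h1.right.rev := diff_eq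
      ⟨j, x, x, x, f.route, m * (seg x y * u), 1, by simp [he, mul_assoc], by simp, by simp⟩
    rw [hf]
    have : Fork (toWord _ h1.right.rev) (diff e g) (toWord _ hv) :=
      ⟨j, y, x, z, u.rev, m.rev, w, by simp [mul_assoc], hk, by simp⟩
    rw [this.D_eq]
    rfl
  · obtain ⟨m', hm', h2⟩ := exists_middle hfg.symm hl.le
    obtain ⟨m, rfl, rfl⟩ := exists_middle_seg h2 (by
      have := congrArg Route.len hm'
      rw [len_mul] at this
      linarith)
    have h3 := (diff e g).reduced
    rw [hk, ← mul_assoc (seg y z), ← mul_assoc] at h3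
    have hf : diff e f = toWord _ h3.left := diff_eq
      ⟨j, x, y, z, c, u, m, he, hm', by simp⟩
    rw [hf]
    exact D_prefix (by simp [hk, mul_assoc])

/-- A left translation maps every copy of `M j` onto a copy of `M j`. -/
theorem exists_diff_app (e : Word M) {p : Word M} {j : J} {x : M j} (h : Avoids p x) :
    ∃ (q : Word M) (b : M j) (h' : Avoids q b), ∀ y, diff e (p.app x h y) = q.app b h' y := by
  by_cases hp : ∃ u, e.route = p.route * u
  · -- `e` begins by `p`; the translated copy is entered where `e` leaves the copy, if it enters it
    obtain ⟨u, hu⟩ := hp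
    have hr := e.reduced
    rw [hu] at hr
    by_cases hx : ∃ (b : M j) (u' : Route M), x ≠ b ∧ u = seg x b * u'
    · obtain ⟨b, u', hxb, rfl⟩ := hx
      have h1 := hr.right.rev
      rw [rev_mul, rev_seg] at h1
      refine ⟨toWord _ h1.left, b, fun y => h1.swap_seg hxb.symm y, fun y => diff_eq ?_⟩
      exact ⟨j, x, b, y, p.route, u', 1, hu, by simp, by rw [mul_one]; rfl⟩
    · have h1 : Avoids (toWord _ hr.right.rev) x := fun y => by
        by_cases hxy : x = y
        · subst hxy
          simpa using hr.right.rev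
        rw [seg_of_ne hxy]
        refine hr.right.rev.mul_single fun s l hs hl => ?_
        obtain ⟨i, b, x', hb⟩ := l
        obtain ⟨rfl, h2⟩ := Sigma.mk.injEq .. ▸ hl
        obtain rfl := eq_of_heq h2
        refine hx ⟨b, s.rev, hb.symm, ?_⟩
        rw [← rev_rev u, hs, rev_mul, rev_single, seg_of_ne hb.symm]
        rfl
      refine ⟨_, x, h1, fun y => diff_eq ?_⟩
      exact ⟨j, x, x, y, p.route, u, 1, by simpa using hu, by simp, by simp⟩
  · -- `p` is not an initial part of `e`, so that the end of `p` survives the cancellation, or it is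
    -- replaced by another letter of the same space with the same second point
    obtain ⟨i, a, b, d, c, u, v, he, hpr, hk⟩ := fork_diff e p
    have h1 : Avoids (diff e p) x := fun y => by
      have h2 := h y
      have h3 := (diff e p).reduced
      rw [hpr] at h2
      rw [hk, ← mul_assoc] at h3
      rcases v.len_nonneg.eq_or_lt with h0 | h0
      · obtain rfl := Route.eq_one_of_len h0.symm
        rw [mul_one] at hpr hk h3 h2
        have hbd : b ≠ d := by
          rintro rfl
          exact hp ⟨u, by rw [he, hpr, mul_assoc]⟩
        have had : a ≠ d := by
          rintro rfl
          exact hp ⟨seg a b * u, by rw [he, hpr, seg_self, mul_one]⟩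
        rw [hk]
        exact h3.glue (h2.mid.seg_swap had b) (by simpa using hbd)
      · rw [hk, ← mul_assoc]
        rw [← mul_assoc] at h2
        exact h3.glue h2.mid h0
    refine ⟨_, x, h1, fun y => diff_eq ?_⟩
    exact ⟨i, a, b, d, c, u, v * seg x y, he, by simp [hpr, mul_assoc], by simp [hk, mul_assoc]⟩

theorem D_diff_app (e : Word M) {p : Word M} {j : J} {x : M j} (h : Avoids p x) (y z : M j) :
    D (diff e (p.app x h y)) (diff e (p.app x h z)) = dist y z := by
  obtain ⟨q, b, h', hq⟩ := exists_diff_app e h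
  rw [hq, hq]
  exact D_seg rfl rfl

/-- Every two words are joined by a chain of at most three moves along initial parts and inside
of one copy of some `M j`, with total length the distance. Hence a function that satisfies the
triangle inequality is bounded by the distance as soon as this holds for the moves. -/
theorem le_D_of_moves {Φ : Word M → Word M → ℝ} (htri : ∀ a b c, Φ a c ≤ Φ a b + Φ b c)
    (hpre : ∀ (f g : Word M) (v : Route M), g.route = f.route * v →
      Φ f g ≤ v.len ∧ Φ g f ≤ v.len)
    (happ : ∀ (p : Word M) {j : J} (x : M j) (h : Avoids p x) (y z : M j),
      Φ (p.app x h y) (p.app x h z) ≤ dist y z) (f g : Word M) : Φ f g ≤ D f g := by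
  have hk := (fork_diff f g).cases
  have hD := D_eq_len_diff f g
  have hfr := f.reduced
  have hgr := g.reduced
  obtain ⟨c, u, v, ⟨hf, hg, hk⟩ | ⟨j, x, y, z, hxy, hxz, hyz, hf, hg, hk⟩⟩ := hk
  · rw [hf] at hfr
    have h1 := (hpre (toWord c hfr.left) f u hf).2
    have h2 := (hpre (toWord c hfr.left) g v hg).1
    have h3 := congrArg Route.len hk
    simp only [len_route, len_mul, len_rev] at h3
    linarith [htri f (toWord c hfr.left) g]
  · rw [hf, ← mul_assoc] at hfr
    have ha : Avoids (toWord c hfr.left.left) x := hfr.left.swap_seg hxy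
    have h1 := (hpre (app _ x ha y) f u (by simp [hf, mul_assoc])).2
    have h2 := (hpre (app _ x ha z) g v (by simp [hg, mul_assoc])).1
    have h3 := congrArg Route.len hk
    simp only [len_route, len_mul, len_rev, len_seg] at h3
    linarith [htri f (app _ x ha y) g, htri (app _ x ha y) (app _ x ha z) g,
      happ _ x ha y z]

/-- A left translation turns the triangle inequality into the special case of a corner at the empty
word. That `D` does not change under left translation is known for the moves of `le_D_of_moves`
only, but these suffice. -/
theorem D_triangle (e f g : Word M) : D e g ≤ D e f + D f g := by
  have h := le_D_of_moves (M := M) (Φ := fun a b => |D e a - D e b|)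
    (fun a b c => abs_sub_le _ _ _)
    (fun a b v h => by
      rw [abs_sub_comm (D e b), and_self, ← D_diff_prefix e h, D_eq_len_diff, D_eq_len_diff]
      exact abs_len_sub_len_le _ _)
    (fun p j x h y z => by
      rw [← D_diff_app e h, D_eq_len_diff e, D_eq_len_diff e]
      exact abs_len_sub_len_le _ _) f g
  have := neg_abs_le (D e f - D e g)
  linarith

instance : MetricSpace (Word M) where
  dist := D
  dist_self := D_self
  dist_comm := D_comm
  dist_triangle := D_triangle
  eq_of_dist_eq_zero := eq_of_D_eq_zero

theorem dist_eq_D (f g : Word M) : dist f g = D f g := rfl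

theorem dist_one_left (f : Word M) : dist 1 f = f.len := D_one_left f

theorem dist_prefix {f g : Word M} {v : Route M} (hg : g.route = f.route * v) :
    dist f g = v.len := D_prefix hg

theorem dist_seg {f g : Word M} {p : Route M} {j : J} {x y z : M j}
    (hf : f.route = p * seg x y) (hg : g.route = p * seg x z) : dist f g = dist y z :=
  D_seg hf hg

theorem dist_diff_le (e f g : Word M) : dist (diff e f) (diff e g) ≤ dist f g :=
  le_D_of_moves (Φ := fun a b => dist (diff e a) (diff e b)) (fun _ _ _ => dist_triangle _ _ _)
    (fun a b v h => by
      have := (D_diff_prefix e h).le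
      exact ⟨this, by rw [dist_comm]; exact this⟩)
    (fun _ _ _ h y z => (D_diff_app e h y z).le) f g

/-- The left translation that takes `e` to the empty word. -/
def diffEquiv (e : Word M) : Word M ≃ᵢ Word M where
  toFun := diff e
  invFun := diff e.inv
  left_inv := diff_inv_diff e
  right_inv f := by simpa using diff_inv_diff e.inv f
  isometry_toFun := Isometry.of_dist_eq fun f g => by
    refine le_antisymm (dist_diff_le e f g) ?_
    simpa only [diff_inv_diff] using dist_diff_le e.inv (diff e f) (diff e g)

@[simp] theorem diffEquiv_apply (e f : Word M) : diffEquiv e f = diff e f := rfl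

theorem diffEquiv_self (e : Word M) : diffEquiv e e = 1 := diff_self e

@[simp] theorem diffEquiv_symm (e : Word M) : (diffEquiv e).symm = diffEquiv e.inv := by
  ext f; rfl

theorem isHomogeneous : IsHomogeneous (Word M) := fun f g =>
  ⟨(diffEquiv f).trans (diffEquiv g).symm, by
    rw [IsometryEquiv.trans_apply, diffEquiv_self, ← diffEquiv_self g,
      IsometryEquiv.symm_apply_apply]⟩

end Word

end

end TreeGraded

namespace TreeGraded

noncomputable section

open Filter Topology

variable {J : Type v} {M : J → Type u} [∀ j, MetricSpace (M j)]

namespace Word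

open Route

/-! ### Copies of the factors and separation -/

theorem route_apply (f : Word M) (t : ℝ) : f.route t = f.toFun t := rfl

theorem toFun_eq_of_route {f : Word M} {r : Route M} (h : f.route = r) (t : ℝ) :
    f.toFun t = r t := congrArg (fun r : Route M => r t) h

theorem len_eq_of_route {f : Word M} {r : Route M} (h : f.route = r) : f.len = r.len :=
  congrArg Route.len h

theorem isAppend_iff {f g : Word M} {l : Letter M} :
    IsAppend f l g ↔ g.route = f.route * single l := by
  constructor
  · rintro ⟨h1, h2, h3, h4⟩
    refine ext_len h1 fun t ht => ?_
    rcases lt_trichotomy t f.len with h | rfl | h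
    · rw [mul_apply_left _ _ h.le]
      exact h2 t h
    · rw [← len_route, mul_apply_len]
      exact h3
    · rw [len_route, h1] at ht
      rw [mul_apply_right _ _ h.le, single_apply _ ⟨by simpa using h, by
        rw [len_route]; linarith [ht.2]⟩]
      exact h4 t ⟨h, ht.2⟩
  · intro h
    refine ⟨len_eq_of_route h, fun t ht => ?_, ?_, fun t ht => ?_⟩
    · rw [toFun_eq_of_route h, mul_apply_left _ _ ht.le]
      rfl
    · rw [toFun_eq_of_route h, ← len_route, mul_apply_len]
    · rw [toFun_eq_of_route h, mul_apply_right _ _ ht.1.le,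
        single_apply _ ⟨by simpa using ht.1, by rw [len_route]; linarith [ht.2]⟩]

theorem endsAt_iff {f : Word M} {x : Σ j, M j} :
    EndsAt f x ↔ ∃ s l, f.route = s * single l ∧ l.finish = x := by
  constructor
  · rintro ⟨a, l, ⟨hab, -, hna, -⟩, h, hl⟩
    obtain ⟨ha0, -⟩ := f.route.block_bounds hab h
    obtain ⟨t, ht⟩ := exists_between hab
    have hlen := (f.reduced.isMaxInterval_eq (isMaxInterval hab (by simpa [pdom] using hna)
      (f.route.supp_right le_rfl) h) ht (h t ht)).1
    have hna' : f.toFun a = none := by simpa [pdom] using hna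
    obtain ⟨s, q, hs, hsl⟩ := f.route.exists_split ha0 hab.le hna'
    refine ⟨s, l, ?_, hl⟩
    have hq : q.len = l.length := by
      have := len_eq_of_route hs
      rw [len_mul] at this
      linarith
    rw [hs]
    congr 1
    refine ext_len hq fun x hx => ?_
    rw [hq] at hx
    rw [single_apply _ hx, ← mul_apply_add s q hx.1.le, ← hs, hsl]
    exact h _ ⟨by linarith [hx.1], by linarith [hx.2]⟩
  · rintro ⟨s, l, h, hl⟩
    have hlen := len_eq_of_route h
    rw [len_mul, len_single] at hlen
    have hv : ∀ t ∈ Ioo s.len f.len, f.toFun t = some l := fun t ht => by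
      rw [toFun_eq_of_route h, mul_apply_right _ _ ht.1.le,
        single_apply _ ⟨by linarith [ht.1], by linarith [ht.2]⟩]
    refine ⟨s.len, l, isMaxInterval ?_ ?_ (f.route.supp_right le_rfl) hv, hv, hl⟩
    · linarith [l.length_pos]
    · rw [toFun_eq_of_route h, mul_apply_len]

theorem not_endsAt_iff {f : Word M} {j : J} {x : M j} : ¬ EndsAt f ⟨j, x⟩ ↔ Avoids f x := by
  rw [endsAt_iff]
  constructor
  · intro h y
    by_cases hxy : x = y
    · subst hxy
      simpa using f.reduced
    · rw [seg_of_ne hxy]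
      exact f.reduced.mul_single fun s l hs hl => h ⟨s, l, hs, hl⟩
  · rintro h ⟨s, l, hs, hl⟩
    obtain ⟨i, z, x', hz⟩ := l
    obtain ⟨rfl, h2⟩ := Sigma.mk.injEq .. ▸ hl
    obtain rfl := eq_of_heq h2
    have h3 := h z
    rw [hs, seg_of_ne hz.symm] at h3
    exact not_reduced_single_mul_single (by rfl) h3.mid

theorem copyAt_eq_range {f : Word M} {j : J} {x : M j} (h : Avoids f x) :
    copyAt f j x = range (f.app x h) := by
  ext g
  constructor
  · rintro (rfl | ⟨y, hxy, hg⟩)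
    · exact ⟨x, route_injective (by simp)⟩
    · exact ⟨y, route_injective (by
        rw [route_app, isAppend_iff.1 hg, seg_of_ne hxy])⟩
  · rintro ⟨y, rfl⟩
    by_cases hxy : x = y
    · subst hxy
      exact Or.inl (route_injective (by simp))
    · exact Or.inr ⟨y, hxy, isAppend_iff.2 (by rw [route_app, seg_of_ne hxy])⟩

theorem app_self {f : Word M} {j : J} {x : M j} (h : Avoids f x) : f.app x h x = f :=
  route_injective (by simp)

theorem avoids_one {j : J} (x : M j) : Avoids (1 : Word M) x := fun y => by
  rw [route_one, one_mul]
  exact reduced_seg x y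

variable [hne : Nonempty (Σ j, M j)]

theorem isometry_app {f : Word M} {j : J} {x : M j} (h : Avoids f x) : Isometry (f.app x h) :=
  Isometry.of_dist_eq fun _ _ => dist_seg rfl rfl

/-- The words with initial part `p` are separated by `p` from all other words. -/
theorem dist_of_not_prefix {p g g' : Word M} {q : Route M} (hg : g.route = p.route * q)
    (hg' : ∀ m, g'.route ≠ p.route * m) : dist g g' = q.len + dist p g' := by
  obtain ⟨j, x, y, z, c, u, v, h1, h2, hk⟩ := fork_diff g g'
  rw [hg] at h1
  have hl : c.len < p.route.len := by
    by_contra! hl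
    obtain ⟨m, rfl, -⟩ := exists_middle h1 hl
    exact hg' _ (by rw [h2, mul_assoc])
  obtain ⟨m', hm', h3⟩ := exists_middle h1.symm hl.le
  obtain ⟨m, rfl, rfl⟩ := exists_middle_seg h3 (by
    have := congrArg Route.len hm'
    rw [len_mul] at this
    linarith)
  have h4 := (diff g g').reduced
  rw [hk, rev_mul, mul_assoc] at h4
  have h5 : Fork p g' (toWord _ h4.right) := ⟨j, x, y, z, c, m, v, hm', h2, rfl⟩
  rw [dist_eq_D, dist_eq_D, h5.D_eq, D_eq_len_diff, len_eq_of_route hk]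
  simp
  ring

theorem exists_prefix_of_dist_lt {p g g' : Word M} {q : Route M} (hg : g.route = p.route * q)
    (h : dist g g' < q.len) : ∃ m, g'.route = p.route * m := by
  by_contra! h'
  have := dist_of_not_prefix hg h'
  linarith [dist_nonneg (x := p) (y := g')]

/-- The words that leave `p` through a given copy of `M j` are separated by `p` from all other
words. -/
theorem dist_of_not_seg {p g g' : Word M} {q : Route M} {j : J} {x y : M j} (hxy : x ≠ y)
    (hg : g.route = p.route * (seg x y * q))
    (hg' : ∀ z m, x ≠ z → g'.route ≠ p.route * (seg x z * m)) :
    dist g g' = (dist x y + q.len) + dist p g' := by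
  by_cases hp : ∃ v, g'.route = p.route * v
  · -- by assumption, the germs of `g` and `g'` after `p` are transverse
    obtain ⟨v, hv⟩ := hp
    have h1 := g.reduced
    have h2 := g'.reduced
    rw [hg] at h1
    rw [hv] at h2
    have h3 : Reduced (v.rev * seg x y) := by
      rw [seg_of_ne hxy]
      refine h2.right.rev.mul_single fun s l hs hl => ?_
      obtain ⟨i, z, x', hz⟩ := l
      obtain ⟨rfl, h4⟩ := Sigma.mk.injEq .. ▸ hl
      obtain rfl := eq_of_heq h4
      refine hg' z s.rev hz.symm ?_
      rw [hv, ← rev_rev v, hs, rev_mul, rev_single, seg_of_ne hz.symm]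
      rfl
    have h4 := (h3.glue h1.right (by simpa using hxy)).rev
    have h5 : Fork g g' (toWord _ h4) :=
      ⟨j, x, x, x, p.route, seg x y * q, v, by simpa using hg, by simpa using hv,
        by simp [mul_assoc]⟩
    rw [dist_eq_D, h5.D_eq, dist_prefix hv]
    simp [dist_comm y x]
    ring
  · push Not at hp
    rw [dist_of_not_prefix hg hp]
    simp

theorem exists_seg_of_dist_lt {p g g' : Word M} {q : Route M} {j : J} {x y : M j} (hxy : x ≠ y)
    (hg : g.route = p.route * (seg x y * q)) (h : dist g g' < dist x y + q.len) :
    ∃ z m, x ≠ z ∧ g'.route = p.route * (seg x z * m) := by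
  by_contra! h'
  have := dist_of_not_seg hxy hg h'
  linarith [dist_nonneg (x := p) (y := g')]

end Word

end

end TreeGraded

namespace TreeGraded

noncomputable section

open Filter Topology

variable {J : Type v} {M : J → Type u} [∀ j, MetricSpace (M j)]

namespace Word

open Route

/-! ### Geodesics from the empty word -/

/-- A choice of a geodesic between any two points of any of the spaces. -/
def geo (hM : ∀ j, IsGeodesicSpace (M j)) {j : J} (x y : M j) : ℝ → M j := (hM j x y).choose

theorem isGeodesic_geo (hM : ∀ j, IsGeodesicSpace (M j)) {j : J} (x y : M j) :
    IsGeodesic (geo hM x y) x y := (hM j x y).choose_spec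

/-- The word `h` lies at distance `t` from the empty word on the geodesic to `g`: either it is an
initial part of `g`, or its last letter is obtained by cutting the letter of `g` around `t` at a
point of the chosen geodesic. -/
def OnGeodesic (hM : ∀ j, IsGeodesicSpace (M j)) (g : Word M) (t : ℝ) (h : Word M) : Prop :=
  (∃ q, g.route = h.route * q ∧ h.len = t) ∨
    ∃ (p q : Route M) (j : J) (x y : M j), x ≠ y ∧ g.route = p * (seg x y * q) ∧ p.len < t ∧
      t < p.len + dist x y ∧ h.route = p * seg x (geo hM x y (t - p.len))

/-- A reduced route can be split around any point of its domain. -/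
theorem exists_split_letter (g : Word M) {t : ℝ} {l : Letter M} (hl : g.toFun t = some l) :
    ∃ p q : Route M, g.route = p * (single l * q) ∧ p.len < t ∧ t < p.len + l.length := by
  obtain ⟨a, b, ha, hb, hlen, hna, hnb, hab⟩ := g.exists_block hl
  obtain ⟨ha0, hbl⟩ := g.route.block_bounds (ha.trans hb) hab
  obtain ⟨p, r, hp, hpl⟩ := g.route.exists_split ha0 (by linarith) hna
  have hr := g.reduced
  rw [hp] at hr
  obtain ⟨q, rfl⟩ := hr.right.exists_single_mul (l := l) (by
    filter_upwards [eventually_Ioo (sub_pos.2 (ha.trans hb))] with s hs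
    rw [← mul_apply_add p r hs.1.le, ← hp, hpl]
    exact hab _ ⟨by linarith [hs.1], by linarith [hs.2]⟩)
  exact ⟨p, q, hp, by linarith, by linarith⟩

theorem exists_onGeodesic (hM : ∀ j, IsGeodesicSpace (M j)) (g : Word M) {t : ℝ}
    (ht : t ∈ Icc 0 g.len) : ∃ h, OnGeodesic hM g t h := by
  have hr := g.reduced
  cases hg : g.toFun t with
  | none =>
    obtain ⟨p, q, hp, hpl⟩ := g.route.exists_split ht.1 ht.2 hg
    rw [hp] at hr
    exact ⟨toWord p hr.left, Or.inl ⟨q, hp, hpl⟩⟩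
  | some l =>
    obtain ⟨p, q, hp, h1, h2⟩ := g.exists_split_letter hg
    rw [single_eq_seg] at hp
    rw [hp, ← mul_assoc] at hr
    exact ⟨toWord _ (hr.left.swap_seg l.ne (geo hM l.src l.tgt (t - p.len))),
      Or.inr ⟨p, q, _, _, _, l.ne, hp, h1, h2, rfl⟩⟩

variable [hne : Nonempty (Σ j, M j)]

theorem dist_seg_mul {h h' : Word M} {p w : Route M} {j : J} {x y z : M j} (hxy : x ≠ y)
    (hh : h.route = p * seg x z) (hh' : h'.route = p * (seg x y * w)) :
    dist h h' = dist z y + w.len := by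
  have hr := h'.reduced
  rw [hh'] at hr
  have h1 : Fork h h' (toWord _ (hr.right.seg_swap hxy z)) :=
    ⟨j, x, z, y, p, 1, w, by simpa using hh, hh', by simp⟩
  rw [dist_eq_D, h1.D_eq]
  simp

/-- The points selected on the geodesic to `g` have the right distances. In each case the two cuts
of `g` are compared: they are in the same letter, or one lies behind the letter of the other. -/
theorem OnGeodesic.dist_eq {hM : ∀ j, IsGeodesicSpace (M j)} {g h h' : Word M} {s t : ℝ}
    (hst : s ≤ t) (hs : OnGeodesic hM g s h) (ht : OnGeodesic hM g t h') : dist h h' = t - s := by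
  have hgeo : ∀ {j : J} {x y : M j} {a b : ℝ}, 0 ≤ a → a ≤ b → b ≤ dist x y →
      dist (geo hM x y a) (geo hM x y b) = b - a := by
    intro j x y a b h1 h2 h3
    rw [(isGeodesic_geo hM x y).2.2 a ⟨h1, h2.trans h3⟩ b ⟨h1.trans h2, h3⟩, abs_sub_comm,
      abs_of_nonneg (by linarith)]
  have hgeo0 : ∀ {j : J} {x y : M j} {b : ℝ}, 0 ≤ b → b ≤ dist x y →
      dist x (geo hM x y b) = b := by
    intro j x y b h1 h2
    have := hgeo (x := x) (y := y) le_rfl h1 h2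
    rwa [(isGeodesic_geo hM x y).1, sub_zero] at this
  have hgeo1 : ∀ {j : J} {x y : M j} {a : ℝ}, 0 ≤ a → a ≤ dist x y →
      dist (geo hM x y a) y = dist x y - a := by
    intro j x y a h1 h2
    have := hgeo (x := x) (y := y) h1 h2 le_rfl
    rwa [(isGeodesic_geo hM x y).2.1] at this
  rcases hs with ⟨q, hg, hl⟩ | ⟨p, q, j, x, y, hxy, hg, hp1, hp2, hh⟩ <;>
    rcases ht with ⟨q', hg', hl'⟩ | ⟨p', q', j', x', y', hxy', hg', hp1', hp2', hh'⟩
  · obtain ⟨m, hm, -⟩ := exists_middle (hg.symm.trans hg') (by simp only [len_route]; linarith)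
    rw [dist_prefix hm]
    have := len_eq_of_route hm
    rw [len_mul, len_route] at this
    linarith
  · rcases le_or_gt h.route.len p'.len with h1 | h1
    · obtain ⟨m, rfl, -⟩ := exists_middle (hg.symm.trans hg') h1
      rw [mul_assoc] at hh'
      rw [dist_prefix hh', len_mul, len_seg, hgeo0 (by linarith) (by linarith), len_mul, len_route]
      linarith
    · obtain ⟨m, hm, h2⟩ := exists_middle (hg'.symm.trans hg) h1.le
      have h3 := len_eq_of_route hm
      rw [len_mul] at h3
      obtain ⟨m', rfl, -⟩ := exists_middle_seg h2 (by simp only [len_route] at h1; linarith)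
      rw [len_mul, len_seg] at h3
      linarith [m'.len_nonneg]
  · obtain ⟨m, hm, h2⟩ := exists_middle (hg.symm.trans hg') (by simp only [len_route]; linarith)
    have h3 := len_eq_of_route hm
    rw [len_mul] at h3
    obtain ⟨m', rfl, -⟩ := exists_middle_seg h2 (by linarith)
    rw [len_mul, len_seg] at h3
    rw [dist_seg_mul hxy hh hm, hgeo1 (by linarith) (by linarith)]
    linarith
  · rcases le_or_gt p.len p'.len with h1 | h1
    · obtain ⟨m, rfl, h2⟩ := exists_middle (hg.symm.trans hg') h1
      rcases m.len_nonneg.eq_or_lt with h0 | h0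
      · obtain rfl := Route.eq_one_of_len h0.symm
        rw [one_mul, seg_of_ne hxy, seg_of_ne hxy'] at h2
        obtain ⟨h3, -⟩ := single_mul_inj h2
        rw [Letter.mk.injEq] at h3
        obtain ⟨rfl, h3, h4⟩ := h3
        obtain rfl := eq_of_heq h3
        obtain rfl := eq_of_heq h4
        simp only [mul_one] at hp1' hp2' hh'
        rw [dist_seg hh hh', hgeo (by linarith) (by linarith) (by linarith)]
        ring
      · obtain ⟨m', rfl, -⟩ := exists_middle_seg h2 h0
        rw [mul_assoc, mul_assoc] at hh'
        simp only [len_mul, len_seg] at hp1' hp2'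
        rw [dist_seg_mul hxy hh hh', hgeo1 (by linarith) (by linarith), len_mul, len_seg,
          hgeo0 (by simp only [len_mul, len_seg]; linarith)
            (by simp only [len_mul, len_seg]; linarith)]
        simp only [len_mul, len_seg]
        ring
    · obtain ⟨m, rfl, h2⟩ := exists_middle (hg'.symm.trans hg) h1.le
      rw [len_mul] at h1
      obtain ⟨m', rfl, -⟩ := exists_middle_seg h2 (by linarith)
      simp only [len_mul, len_seg] at hp1
      linarith [m'.len_nonneg]

theorem exists_geodesic_one (hM : ∀ j, IsGeodesicSpace (M j)) (g : Word M) :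
    ∃ γ : ℝ → Word M, IsGeodesic γ 1 g ∧ ∀ t ∈ Icc 0 g.len, OnGeodesic hM g t (γ t) := by
  choose! γ hγ using fun t (ht : t ∈ Icc 0 g.len) => exists_onGeodesic hM g ht
  have h0 : OnGeodesic hM g 0 1 := Or.inl ⟨g.route, by simp, rfl⟩
  have h1 : OnGeodesic hM g g.len g := Or.inl ⟨1, by simp, rfl⟩
  have m0 : (0 : ℝ) ∈ Icc 0 g.len := ⟨le_rfl, g.len_nonneg⟩
  have m1 : g.len ∈ Icc 0 g.len := ⟨g.len_nonneg, le_rfl⟩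
  refine ⟨γ, ⟨?_, ?_, fun s hs t ht => ?_⟩, hγ⟩
  · exact dist_eq_zero.1 (((hγ 0 m0).dist_eq le_rfl h0).trans (sub_self _))
  · rw [dist_one_left]
    exact dist_eq_zero.1 (((hγ _ m1).dist_eq le_rfl h1).trans (sub_self _))
  · rw [dist_one_left] at hs ht
    rcases le_total s t with h | h
    · rw [(hγ s hs).dist_eq h (hγ t ht), abs_sub_comm, abs_of_nonneg (by linarith)]
    · rw [dist_comm, (hγ t ht).dist_eq h (hγ s hs), abs_of_nonneg (by linarith)]

end Word

theorem IsGeodesic.map {X : Type*} {Y : Type*} [MetricSpace X] [MetricSpace Y] {γ : ℝ → X}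
    {x y : X} (h : IsGeodesic γ x y) {φ : X → Y} (hφ : Isometry φ) :
    IsGeodesic (fun t => φ (γ t)) (φ x) (φ y) := by
  obtain ⟨h0, h1, h2⟩ := h
  refine ⟨congrArg φ h0, by rw [hφ.dist_eq]; exact congrArg φ h1, fun s hs t ht => ?_⟩
  rw [hφ.dist_eq] at hs ht ⊢
  exact h2 s hs t ht

namespace Word

open Route

variable [hne : Nonempty (Σ j, M j)]

theorem isGeodesicSpace (hM : ∀ j, IsGeodesicSpace (M j)) : IsGeodesicSpace (Word M) := by
  intro f g
  obtain ⟨γ, hγ, -⟩ := exists_geodesic_one hM (diff f g)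
  have := hγ.map (diffEquiv f).symm.isometry
  rw [← diffEquiv_apply, IsometryEquiv.symm_apply_apply, ← diffEquiv_self f,
    IsometryEquiv.symm_apply_apply] at this
  exact ⟨_, this⟩

/-! ### Completeness -/

/-- A Cauchy sequence converges if it has long common initial parts. -/
theorem exists_limit_of_prefix {f : ℕ → Word M}
    (h : ∀ ε > 0, ∃ (p : Route M) (N : ℕ), ∀ n ≥ N, ∃ q, (f n).route = p * q ∧ q.len ≤ ε) :
    ∃ w, Tendsto f atTop (𝓝 w) := by
  choose! p N hp using h
  -- The limit is the union of initial parts `P k` that are common to almost all words, with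
  -- remainders of length at most `1 / (k + 1)`.
  let ε : ℕ → ℝ := fun k => 1 / ((k : ℝ) + 1)
  have hε : ∀ k, 0 < ε k := fun k => by positivity
  let P : ℕ → Route M := fun k => p (ε k)
  have hP : ∀ k, ∀ n ≥ N (ε k), ∃ q, (f n).route = P k * q ∧ q.len ≤ ε k := fun k => hp _ (hε k)
  have hred : ∀ k, Reduced (P k) := fun k => by
    obtain ⟨q, hq, -⟩ := hP k _ le_rfl
    have := (f (N (ε k))).reduced
    rw [hq] at this
    exact this.left
  have hcomp : ∀ k l t, t < (P k).len → t < (P l).len → P k t = P l t := by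
    intro k l t hk hl
    obtain ⟨q, hq, -⟩ := hP k _ (le_max_left (N (ε k)) (N (ε l)))
    obtain ⟨q', hq', -⟩ := hP l _ (le_max_right (N (ε k)) (N (ε l)))
    rw [← mul_apply_left _ q hk.le, ← hq, hq', mul_apply_left _ _ hl.le]
  have hlen : ∀ k l, (P l).len ≤ (P k).len + ε k := by
    intro k l
    obtain ⟨q, hq, hqe⟩ := hP k _ (le_max_left (N (ε k)) (N (ε l)))
    obtain ⟨q', hq', -⟩ := hP l _ (le_max_right (N (ε k)) (N (ε l)))
    have h1 := congrArg Route.len (hq.symm.trans hq')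
    simp only [len_mul] at h1
    linarith [q'.len_nonneg]
  have hbdd : BddAbove (range fun k => (P k).len) :=
    ⟨(P 0).len + ε 0, by rintro _ ⟨l, rfl⟩; exact hlen 0 l⟩
  set L : ℝ := ⨆ k, (P k).len with hL
  have hleL : ∀ k, (P k).len ≤ L := fun k => le_ciSup hbdd k
  have hLle : ∀ k, L ≤ (P k).len + ε k := fun k => ciSup_le (hlen k)
  have hex : ∀ t < L, ∃ k, t < (P k).len := fun t ht => exists_lt_of_lt_ciSup ht
  classical
  let w : Route M :=
    { toFun := fun t => if h : ∃ k, t < (P k).len then P h.choose t else none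
      len := L
      len_nonneg := (P 0).len_nonneg.trans (hleL 0)
      supp := fun t ht => by
        split_ifs with h
        · refine (P h.choose).supp_left (not_lt.1 fun h0 => ht ⟨h0, ?_⟩)
          exact h.choose_spec.trans_le (hleL _)
        · rfl }
  have hwlt : ∀ k t, t < (P k).len → w t = P k t := fun k t ht => by
    have h : ∃ k, t < (P k).len := ⟨k, ht⟩
    change (if h : ∃ k, t < (P k).len then P h.choose t else none) = _
    rw [dif_pos h]
    exact hcomp _ _ _ h.choose_spec ht
  have hcut : ∀ k l, (P k).len < (P l).len → P l (P k).len = none := by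
    intro k l hkl
    obtain ⟨q, hq, -⟩ := hP k _ (le_max_left (N (ε k)) (N (ε l)))
    obtain ⟨q', hq', -⟩ := hP l _ (le_max_right (N (ε k)) (N (ε l)))
    rw [← mul_apply_left _ q' hkl.le, ← hq', hq, mul_apply_len]
  have hwle : ∀ k t, t ≤ (P k).len → w t = P k t := fun k t ht => by
    rcases ht.eq_or_lt with rfl | ht
    · rw [supp_right (P k) le_rfl]
      rcases (hleL k).eq_or_lt with h | h
      · exact w.supp_right h.ge
      · obtain ⟨l, hl⟩ := hex _ h
        rw [hwlt l _ hl, hcut k l hl]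
    · exact hwlt k t ht
  have hwred : Reduced w := by
    refine ⟨fun t l hl => ?_, fun a b ha hab hb => ?_, fun b hb hn => ?_⟩
    · obtain ⟨k, hk⟩ := hex t (w.mem_of_eq_some hl).2
      rw [hwlt k t hk] at hl
      obtain ⟨a, b, h1, h2, h3, h4, h5, h6⟩ := (hred k).block t l hl
      have hbk := ((P k).block_bounds (h1.trans h2) h6).2
      refine ⟨a, b, h1, h2, h3, ?_, ?_, fun s hs => ?_⟩
      · rw [hwle k a (by linarith), h4]
      · rw [hwle k b hbk, h5]
      · rw [hwle k s (by linarith [hs.2]), h6 s hs]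
    · obtain ⟨k, hk⟩ := hex a (hab.trans_le hb)
      obtain ⟨t, ht, hn⟩ := (hred k).dense a (min b (P k).len) ha (lt_min hab hk)
        (min_le_right _ _)
      refine ⟨t, ⟨ht.1, ht.2.trans_le (min_le_left _ _)⟩, ?_⟩
      rwa [hwlt k t (ht.2.trans_le (min_le_right _ _))]
    · obtain ⟨k, hk⟩ := hex b hb.2
      rw [hwlt k b hk] at hn
      refine ((hred k).turn b ⟨hb.1, hk⟩ hn).congr ?_ ?_
      · filter_upwards [eventually_Ioo hb.1] with t ht
        rw [hwlt k _ (by linarith [ht.1])]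
      · filter_upwards [eventually_Ioo (sub_pos.2 hk)] with t ht
        rw [hwlt k _ (by linarith [ht.2])]
  have hwP : ∀ k, ∃ q, w = P k * q := fun k => by
    obtain ⟨p', q, hpq, hl⟩ := w.exists_split (P k).len_nonneg (hleL k)
      (by rw [hwle k _ le_rfl, supp_right _ le_rfl])
    refine ⟨q, ?_⟩
    rw [hpq]
    congr 1
    refine ext_len hl fun t ht => ?_
    rw [hl] at ht
    rw [← hwle k t ht.2.le, hpq, mul_apply_left _ _ (hl ▸ ht.2.le)]
  refine ⟨toWord w hwred, Metric.tendsto_atTop.2 fun e he => ?_⟩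
  obtain ⟨k, hk⟩ := exists_nat_one_div_lt (half_pos he)
  refine ⟨N (ε k), fun n hn => ?_⟩
  obtain ⟨q, hq, hqe⟩ := hP k n hn
  obtain ⟨q', hq'⟩ := hwP k
  have h1 : dist (toWord _ (hred k)) (f n) = q.len := dist_prefix hq
  have h2 : dist (toWord _ (hred k)) (toWord w hwred) = q'.len := dist_prefix hq'
  have h3 : q'.len ≤ ε k := by
    have := congrArg Route.len hq'
    rw [len_mul] at this
    have h4 := hLle k
    have h5 : w.len = L := rfl
    linarith
  have h6 : ε k < e / 2 := hk
  linarith [dist_triangle_left (f n) (toWord w hwred) (toWord _ (hred k))]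

/-- A Cauchy sequence without long common initial parts eventually runs inside of one copy of
some `M j`, up to a short remainder. -/
theorem exists_common_copy {f : ℕ → Word M} (hf : CauchySeq f) {ε : ℝ} (hε : 0 < ε)
    (hQ : ¬ ∃ (p : Route M) (N : ℕ), ∀ n ≥ N, ∃ q, (f n).route = p * q ∧ q.len ≤ 2 * ε) :
    ∃ (p : Word M) (j : J) (x : M j) (N : ℕ), ∀ n ≥ N, ∃ z v, x ≠ z ∧
      (f n).route = p.route * (seg x z * v) ∧ v.len ≤ 2 * ε := by
  obtain ⟨N, hN⟩ := Metric.cauchySeq_iff'.1 hf ε hε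
  have hN' : ∀ n ≥ N, dist (f N) (f n) < ε := fun n hn => by rw [dist_comm]; exact hN n hn
  have hlen : ∀ n ≥ N, (f n).len ≤ (f N).len + ε := fun n hn => by
    have := (abs_len_sub_len_le (f n) (f N)).trans_lt (hN n hn)
    linarith [(abs_lt.1 this).2]
  have hl : ε < (f N).len := by
    by_contra! hl
    exact hQ ⟨1, N, fun n hn => ⟨(f n).route, by simp, by
      rw [len_route]; linarith [hlen n hn]⟩⟩
  have hr := (f N).reduced
  cases hv : (f N).toFun ((f N).len - ε) with
  | none =>
    obtain ⟨p, q, hpq, hp⟩ := (f N).route.exists_split (by linarith)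
      (by rw [len_route]; linarith) hv
    rw [hpq] at hr
    have hq : q.len = ε := by
      have := len_eq_of_route hpq
      rw [len_mul] at this
      linarith
    -- A cut at distance `ε` from the end of `f N` is passed by all later words.
    refine absurd ⟨p, N, fun n hn => ?_⟩ hQ
    obtain ⟨m, hm⟩ := exists_prefix_of_dist_lt (p := toWord p hr.left) hpq (by
      rw [hq]; exact hN' n hn)
    refine ⟨m, hm, ?_⟩
    have := len_eq_of_route hm
    simp only [len_mul, route_toWord] at this
    linarith [hlen n hn]
  | some l =>
    obtain ⟨p, q, hpq, hp1, hp2⟩ := (f N).exists_split_letter hv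
    rw [single_eq_seg] at hpq
    rw [hpq] at hr
    have hlN := len_eq_of_route hpq
    simp only [len_mul, len_seg] at hlN
    have hll : l.length = dist l.src l.tgt := rfl
    refine ⟨toWord p hr.left, l.idx, l.src, N, fun n hn => ?_⟩
    obtain ⟨z, m, hz, hm⟩ := exists_seg_of_dist_lt (p := toWord p hr.left) l.ne hpq
      ((hN' n hn).trans (by linarith))
    refine ⟨z, m, hz, hm, ?_⟩
    have hd := hN' n hn
    by_cases hlz : l.tgt = z
    · have h1 := len_eq_of_route hm
      have h2 := hlen n hn
      simp only [len_mul, len_seg, route_toWord, ← hlz] at h1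
      linarith
    · rw [dist_eq_D, D_of_seg l.ne hz hlz hpq hm] at hd
      linarith [q.len_nonneg, dist_nonneg (x := l.tgt) (y := z)]

/-- A Cauchy sequence either has long common initial parts, or it runs inside of one copy of some
`M j` and converges there because `M j` is complete. -/
instance completeSpace [∀ j, CompleteSpace (M j)] : CompleteSpace (Word M) := by
  refine Metric.complete_of_cauchySeq_tendsto fun f hf => ?_
  by_cases hQ : ∀ ε > 0, ∃ (p : Route M) (N : ℕ), ∀ n ≥ N, ∃ q, (f n).route = p * q ∧ q.len ≤ ε
  · exact exists_limit_of_prefix hQ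
  push Not at hQ
  obtain ⟨ε₀, hε₀, hQ⟩ := hQ
  have hQ' : ¬ ∃ (p : Route M) (N : ℕ), ∀ n ≥ N, ∃ q, (f n).route = p * q ∧
      q.len ≤ 2 * (ε₀ / 2) := by
    rintro ⟨p, N, h⟩
    obtain ⟨n, hn, h'⟩ := hQ p N
    obtain ⟨q, hq, hqe⟩ := h n hn
    linarith [h' q hq]
  obtain ⟨p, j, x, N, h⟩ := exists_common_copy hf (half_pos hε₀) hQ'
  have : Nonempty (M j) := ⟨x⟩
  choose! z v hxz hfn hv using h
  have hav : Avoids p x := by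
    have := (f N).reduced
    rw [hfn N le_rfl, ← mul_assoc] at this
    exact this.left.swap_seg (hxz N le_rfl)
  have hdz : ∀ m ≥ N, ∀ n ≥ N, dist (z m) (z n) ≤ dist (f m) (f n) := by
    intro m hm n hn
    by_cases hmn : z m = z n
    · rw [hmn, dist_self]; exact dist_nonneg
    · rw [dist_eq_D, D_of_seg (hxz m hm) (hxz n hn) hmn (hfn m hm) (hfn n hn)]
      linarith [(v m).len_nonneg, (v n).len_nonneg]
  -- If the remainders were not short, the last letters would be eventually constant, and the
  -- sequence would have long common initial parts.
  have hvs : ∀ ε > 0, ∃ K ≥ N, ∀ m ≥ K, (v m).len < ε := by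
    intro ε hε
    obtain ⟨K, hK⟩ := Metric.cauchySeq_iff.1 hf ε hε
    refine ⟨max K N, le_max_right _ _, fun m hm => ?_⟩
    have hmK := (le_max_left _ _).trans hm
    have hmN := (le_max_right _ _).trans hm
    have : ∃ n ≥ max K N, z m ≠ z n := by
      by_contra! hall
      refine hQ' ⟨p.route * seg x (z m), max K N, fun n hn => ⟨v n, ?_, ?_⟩⟩
      · rw [hfn n ((le_max_right _ _).trans hn), hall n hn, mul_assoc]
      · exact hv n ((le_max_right _ _).trans hn)
    obtain ⟨n, hn, hmn⟩ := this
    have hnN := (le_max_right _ _).trans hn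
    have hd := hK m hmK n ((le_max_left _ _).trans hn)
    rw [dist_eq_D, D_of_seg (hxz m hmN) (hxz n hnN) hmn (hfn m hmN) (hfn n hnN)] at hd
    linarith [(v n).len_nonneg, dist_nonneg (x := z m) (y := z n)]
  have hz : CauchySeq z := by
    refine Metric.cauchySeq_iff.2 fun ε hε => ?_
    obtain ⟨K, hK⟩ := Metric.cauchySeq_iff.1 hf ε hε
    refine ⟨max K N, fun m hm n hn => ?_⟩
    exact (hdz m ((le_max_right _ _).trans hm) n ((le_max_right _ _).trans hn)).trans_lt
      (hK m ((le_max_left _ _).trans hm) n ((le_max_left _ _).trans hn))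
  obtain ⟨y, hy⟩ := cauchySeq_tendsto_of_complete hz
  refine ⟨p.app x hav y, Metric.tendsto_atTop.2 fun ε hε => ?_⟩
  obtain ⟨K, hKN, hK⟩ := hvs (ε / 2) (half_pos hε)
  obtain ⟨K', hK'⟩ := Metric.tendsto_atTop.1 hy (ε / 2) (half_pos hε)
  refine ⟨max K K', fun n hn => ?_⟩
  have hnK := (le_max_left _ _).trans hn
  have h1 : dist (p.app x hav (z n)) (f n) = (v n).len :=
    dist_prefix (by rw [hfn n (hKN.trans hnK), route_app, mul_assoc])
  have h2 : dist (p.app x hav (z n)) (p.app x hav y) = dist (z n) y := dist_seg rfl rfl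
  linarith [dist_triangle_left (f n) (p.app x hav y) (p.app x hav (z n)), hK n hnK,
    hK' n ((le_max_right _ _).trans hn)]

end Word

end

end TreeGraded

namespace TreeGraded

noncomputable section

open Filter Topology

/-! ### Simple loops -/

section Loops

variable {X : Type*} [MetricSpace X]

open Classical in
/-- The distance to `p`, counted negatively outside of `U`. -/
def signedDist (p : X) (U : Set X) (x : X) : ℝ := if x ∈ U then dist x p else -dist x p

/-- If `p` separates `U` from its complement, then the signed distance to `p` is continuous. -/
theorem continuous_signedDist {p : X} {U : Set X}
    (hU : ∀ g ∈ U, ∀ g' ∉ U, dist g p + dist p g' ≤ dist g g') :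
    Continuous (signedDist p U) := by
  refine LipschitzWith.continuous (K := 1) (LipschitzWith.of_dist_le_mul fun x y => ?_)
  rw [NNReal.coe_one, one_mul, Real.dist_eq]
  by_cases hx : x ∈ U <;> by_cases hy : y ∈ U <;> simp only [signedDist, hx, hy, if_true, if_false]
  · exact abs_dist_sub_le _ _ _
  · have := hU x hx y hy
    rw [dist_comm p y] at this
    rwa [sub_neg_eq_add, abs_of_nonneg (by positivity)]
  · have := hU y hy x hx
    rw [dist_comm p x, dist_comm y x] at this
    rw [← neg_add', abs_neg, abs_of_nonneg (by positivity)]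
    linarith
  · rw [← neg_add', abs_neg, ← sub_eq_add_neg]
    exact abs_dist_sub_le _ _ _

theorem signedDist_eq_zero {p : X} {U : Set X} {x : X} (h : signedDist p U x = 0) : x = p := by
  unfold signedDist at h
  split_ifs at h with hx
  · exact dist_eq_zero.1 h
  · exact dist_eq_zero.1 (neg_eq_zero.1 h)

theorem exists_zero_of_mul_neg {ψ : ℝ → ℝ} {a b : ℝ} (hab : a ≤ b)
    (hψ : ContinuousOn ψ (Icc a b)) (h : ψ a * ψ b < 0) : ∃ r ∈ Ioo a b, ψ r = 0 := by
  have h1 : (0 : ℝ) ∈ ψ '' Icc a b := by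
    rcases mul_neg_iff.1 h with h | h
    · exact intermediate_value_Icc' hab hψ ⟨h.2.le, h.1.le⟩
    · exact intermediate_value_Icc hab hψ ⟨h.1.le, h.2.le⟩
  obtain ⟨r, hr, h0⟩ := h1
  refine ⟨r, ⟨lt_of_le_of_ne hr.1 ?_, lt_of_le_of_ne hr.2 ?_⟩, h0⟩
  · rintro rfl
    simp [h0] at h
  · rintro rfl
    simp [h0] at h

/-- A simple loop cannot cross a separating point: it would have to pass through it twice. -/
theorem not_separated_of_simple_loop {c : ℝ → X} {L : ℝ} (hc : ContinuousOn c (Icc 0 L))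
    (h0 : c 0 = c L) (hinj : InjOn c (Ico 0 L)) {p : X} {U : Set X}
    (hU : ∀ g ∈ U, ∀ g' ∉ U, dist g p + dist p g' ≤ dist g g') {s t : ℝ} (hs : s ∈ Icc 0 L)
    (ht : t ∈ Icc 0 L) (hsU : c s ∈ U) (hsp : c s ≠ p) (htU : c t ∉ U) (htp : c t ≠ p) : False := by
  set ψ : ℝ → ℝ := fun r => signedDist p U (c r) with hψdef
  have hψ : ContinuousOn ψ (Icc 0 L) := (continuous_signedDist hU).comp_continuousOn hc
  have hψs : 0 < ψ s := by simp [hψdef, signedDist, hsU, hsp]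
  have hψt : ψ t < 0 := by simp [hψdef, signedDist, htU, htp]
  -- The signed distance has a zero between `a` and `b`, where it has opposite signs, and another
  -- one on the remaining arc from `b` through `c 0 = c L` to `a`.
  have key : ∀ a ∈ Icc 0 L, ∀ b ∈ Icc 0 L, a ≤ b → ψ a * ψ b < 0 → False := by
    intro a ha b hb hab hneg
    have hz : ∀ r, ψ r = 0 → c r = p := fun r hr => signedDist_eq_zero hr
    obtain ⟨r, hr, hr0⟩ := exists_zero_of_mul_neg hab
      (hψ.mono (Icc_subset_Icc ha.1 hb.2)) hneg
    have hrI : r ∈ Ico 0 L := ⟨ha.1.trans hr.1.le, hr.2.trans_le hb.2⟩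
    have hw : ψ 0 = ψ L := by simp only [hψdef, h0]
    have huniq : ∀ r' ∈ Ico 0 L, ψ r' = 0 → r' = r := fun r' hr' h' =>
      hinj hr' hrI ((hz r' h').trans (hz r hr0).symm)
    have hL : 0 < L := hrI.1.trans_lt hrI.2
    rcases lt_trichotomy (ψ 0 * ψ a) 0 with h | h | h
    · obtain ⟨r', hr', h'⟩ := exists_zero_of_mul_neg ha.1
        (hψ.mono (Icc_subset_Icc le_rfl ha.2)) h
      have := huniq r' ⟨hr'.1.le, hr'.2.trans_le ha.2⟩ h'
      linarith [hr'.2, hr.1]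
    · have ha0 : ψ a ≠ 0 := fun h' => by simp [h'] at hneg
      have := huniq 0 ⟨le_rfl, hL⟩ ((mul_eq_zero.1 h).resolve_right ha0)
      linarith [hr.1, ha.1]
    · have h2 : ψ b * ψ L < 0 := by
        rw [← hw]
        rcases mul_neg_iff.1 hneg with h3 | h3
        · exact mul_neg_of_neg_of_pos h3.2 (pos_of_mul_pos_left h h3.1.le)
        · exact mul_neg_of_pos_of_neg h3.2 (neg_of_mul_pos_left h h3.1.le)
      obtain ⟨r', hr', h'⟩ := exists_zero_of_mul_neg hb.2
        (hψ.mono (Icc_subset_Icc hb.1 le_rfl)) h2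
      have := huniq r' ⟨hb.1.trans hr'.1.le, hr'.2⟩ h'
      linarith [hr'.1, hr.2]
  rcases le_total s t with h | h
  · exact key s hs t ht h (mul_neg_of_pos_of_neg hψs hψt)
  · exact key t ht s hs h (mul_neg_of_neg_of_pos hψt hψs)

theorem IsSimpleGeodesicTriangle.continuousOn {c : ℝ → X} {L : ℝ}
    (h : IsSimpleGeodesicTriangle c L) : ContinuousOn c (Icc 0 L) := by
  obtain ⟨-, -, -, p, q, h0, hpq, hq, h1, h2, h3⟩ := h
  have key : ∀ {a b : ℝ}, (∀ s ∈ Icc a b, ∀ t ∈ Icc a b, dist (c s) (c t) = |s - t|) →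
      ContinuousOn c (Icc a b) := fun h =>
    (LipschitzOnWith.of_dist_le_mul (K := 1) fun s hs t ht => by
      rw [h s hs t ht, NNReal.coe_one, one_mul, Real.dist_eq]).continuousOn
  rw [← Icc_union_Icc_eq_Icc (h0.trans hpq) hq, ← Icc_union_Icc_eq_Icc h0 hpq]
  exact ((key h1).union_of_isClosed (key h2) isClosed_Icc isClosed_Icc).union_of_isClosed (key h3)
    (isClosed_Icc.union isClosed_Icc) isClosed_Icc

/-- In an `ℝ`-tree, a point `m` separates the points that lie behind `m`, as seen from `q`, from
the other points. -/
theorem IsRTree.separation (hX : IsRTree X) (m q : X) :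
    ∀ g ∈ {z | dist z q < dist z m + dist m q}, ∀ g' ∉ {z | dist z q < dist z m + dist m q},
      dist g m + dist m g' ≤ dist g g' := by
  intro g hg g' hg'
  simp only [mem_ofPred_eq, not_lt] at hg hg'
  have := hX.2 q g' m g
  rw [dist_comm q g', dist_comm m g, dist_comm g' g, dist_comm g' m, dist_comm q m,
    dist_comm q g] at this
  rw [dist_comm g' m] at hg'
  rcases le_max_iff.1 this with h | h
  · rw [dist_comm m g']; rw [dist_comm m g'] at hg'; linarith
  · rw [dist_comm m g'] at h hg'; linarith

/-- The midpoint of the geodesic from `c 0` to `c (L / 2)` separates these two points of the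
loop. -/
theorem IsRTree.not_simple_loop (hX : IsRTree X) {c : ℝ → X} {L : ℝ} (hL : 0 < L)
    (hc : ContinuousOn c (Icc 0 L)) (h0 : c 0 = c L) (hinj : InjOn c (Ico 0 L)) : False := by
  have hne : c 0 ≠ c (L / 2) := fun h => by
    have := hinj ⟨le_rfl, hL⟩ ⟨by linarith, by linarith⟩ h
    linarith
  obtain ⟨γ, hγ0, hγ1, hγ⟩ := hX.1 (c 0) (c (L / 2))
  have hd := dist_pos.2 hne
  set d := dist (c 0) (c (L / 2))
  have h1 : dist (c 0) (γ (d / 2)) = d / 2 := by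
    rw [← hγ0, hγ 0 ⟨le_rfl, hd.le⟩ (d / 2) ⟨by linarith, by linarith⟩, zero_sub, abs_neg,
      abs_of_pos (by linarith)]
  have h2 : dist (γ (d / 2)) (c (L / 2)) = d / 2 := by
    rw [← hγ1, hγ (d / 2) ⟨by linarith, by linarith⟩ d ⟨by linarith, le_rfl⟩,
      show d / 2 - d = -(d / 2) by ring, abs_neg, abs_of_pos (by linarith)]
  refine not_separated_of_simple_loop hc h0 hinj (hX.separation (γ (d / 2)) (c (L / 2)))
    (s := L / 2) (t := 0) ⟨by linarith, by linarith⟩ ⟨le_rfl, hL.le⟩ ?_ ?_ ?_ ?_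
  · simp only [mem_ofPred_eq, dist_self]
    rw [dist_comm (c (L / 2)), h2]
    linarith
  · intro h
    rw [← h, dist_self] at h2
    linarith
  · simp only [mem_ofPred_eq, not_lt]
    rw [h1, h2]
    exact (add_halves d).le
  · intro h
    rw [← h, dist_self] at h1
    linarith

end Loops

variable {J : Type v} {M : J → Type u} [∀ j, MetricSpace (M j)]

namespace Word

open Route

/-- A word other than the empty word that has no cut is a single letter. -/
theorem exists_eq_seg_of_no_cut {g : Word M} (hg : g ≠ 1)
    (h : ∀ p m : Route M, g.route = p * m → 0 < p.len → 0 < m.len → False) :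
    ∃ l : Letter M, g.route = single l := by
  have hl : 0 < g.len := g.len_nonneg.lt_of_ne fun h' => hg (eq_one_of_len h'.symm)
  obtain ⟨t, ht, hn⟩ := g.reduced.dense 0 g.len le_rfl hl le_rfl
  obtain ⟨l, hl⟩ := Option.ne_none_iff_exists'.1 hn
  obtain ⟨p, q, hpq, h1, h2⟩ := g.exists_split_letter hl
  have hp : p = 1 := Route.eq_one_of_len (by
    by_contra h'
    exact h p _ hpq (p.len_nonneg.lt_of_ne (Ne.symm h')) (by
      rw [len_mul, len_single]; linarith [l.length_pos, q.len_nonneg]))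
  subst hp
  rw [one_mul] at hpq
  have hq : q = 1 := Route.eq_one_of_len (by
    by_contra h'
    exact h _ _ hpq l.length_pos (q.len_nonneg.lt_of_ne (Ne.symm h')))
  subst hq
  exact ⟨l, by rw [hpq, mul_one]⟩

variable [hne : Nonempty (Σ j, M j)]

theorem range_diff_app (e : Word M) {p : Word M} {j : J} {x : M j} (h : Avoids p x) :
    ∃ (q : Word M) (b : M j) (h' : Avoids q b), diff e '' range (p.app x h) =
      range (q.app b h') := by
  obtain ⟨q, b, h', hq⟩ := exists_diff_app e h
  refine ⟨q, b, h', ?_⟩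
  rw [← range_comp]
  exact congrArg range (funext hq)

/-- Every simple loop lies in one copy of some `M j`, because it cannot cross a separating
point. -/
theorem exists_copy_of_simple_loop {c : ℝ → Word M} {L : ℝ} (hL : 0 < L)
    (hc : ContinuousOn c (Icc 0 L)) (h0 : c 0 = c L) (hinj : InjOn c (Ico 0 L)) :
    ∃ (p : Word M) (j : J) (x : M j) (h : Avoids p x), c '' Icc 0 L ⊆ range (p.app x h) := by
  set c' : ℝ → Word M := fun t => diff (c 0) (c t) with hc'def
  have hc' : ContinuousOn c' (Icc 0 L) := (diffEquiv (c 0)).continuous.comp_continuousOn hc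
  have h0' : c' 0 = c' L := by simp only [hc'def, ← h0]
  have hinj' : InjOn c' (Ico 0 L) := fun s hs t ht h =>
    hinj hs ht ((diffEquiv (c 0)).injective h)
  have h1 : c' 0 = 1 := diff_self _
  have m0 : (0 : ℝ) ∈ Icc 0 L := ⟨le_rfl, hL.le⟩
  -- After a translation the loop starts at the empty word. A proper initial part of a word on
  -- the loop would separate this word from the empty word.
  have hcut : ∀ t ∈ Icc 0 L, ∀ p m : Route M, (c' t).route = p * m → 0 < p.len → 0 < m.len →
      False := by
    intro t ht p m hpm hp hm
    have hr := (c' t).reduced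
    rw [hpm] at hr
    set P : Word M := toWord p hr.left with hP
    refine not_separated_of_simple_loop (p := P) (U := {g | ∃ m, g.route = P.route * m}) hc' h0'
      hinj' ?_ ht m0 ⟨m, hpm⟩ ?_ ?_ ?_
    · rintro g ⟨q, hq⟩ g' hg'
      rw [dist_of_not_prefix hq fun m hm => hg' ⟨m, hm⟩, dist_comm g, dist_prefix hq]
    · intro h
      have := dist_prefix (f := P) (g := c' t) hpm
      rw [h, dist_self] at this
      exact hm.ne this
    · rintro ⟨q, hq⟩
      rw [h1] at hq
      have := congrArg Route.len hq
      simp [hP] at this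
      linarith [q.len_nonneg]
    · rw [h1]
      intro h
      have := len_eq_of_route (congrArg route h)
      simp [hP] at this
      exact hp.ne this
  have hhalf : c' (L / 2) ≠ 1 := by
    rw [← h1]
    intro h
    have := hinj' ⟨by linarith, by linarith⟩ ⟨le_rfl, hL⟩ h
    linarith
  have mh : L / 2 ∈ Icc 0 L := ⟨by linarith, by linarith⟩
  obtain ⟨l, hl⟩ := exists_eq_seg_of_no_cut hhalf (hcut _ mh)
  rw [single_eq_seg] at hl
  -- All words on the loop are single letters, and they begin at the same point as the letter `l`,
  -- since otherwise the empty word would separate them from `l`.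
  have hall : c' '' Icc 0 L ⊆ range ((1 : Word M).app l.src (avoids_one _)) := by
    rintro _ ⟨t, ht, rfl⟩
    by_cases ht1 : c' t = 1
    · exact ⟨l.src, by rw [app_self, ht1]⟩
    by_cases hV : ∃ z m, l.src ≠ z ∧ (c' t).route = (1 : Word M).route * (seg l.src z * m)
    · obtain ⟨z, m, hz, hm⟩ := hV
      rw [route_one, one_mul] at hm
      have : m = 1 := Route.eq_one_of_len (by
        by_contra h'
        exact hcut t ht _ _ hm (by simpa using hz) (m.len_nonneg.lt_of_ne (Ne.symm h')))
      subst this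
      exact ⟨z, route_injective (by rw [hm]; simp)⟩
    · exfalso
      refine not_separated_of_simple_loop (p := 1)
        (U := {g | ∃ z m, l.src ≠ z ∧ g.route = (1 : Word M).route * (seg l.src z * m)}) hc' h0'
        hinj' ?_ mh ht ⟨l.tgt, 1, l.ne, by simpa using hl⟩ hhalf hV ht1
      rintro g ⟨z, q, hz, hq⟩ g' hg'
      rw [dist_of_not_seg hz hq fun z m hz hm => hg' ⟨z, m, hz, hm⟩, dist_comm g, dist_prefix hq]
      simp
  obtain ⟨q, b, h', hq⟩ := range_diff_app (c 0).inv (avoids_one (M := M) l.src)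
  refine ⟨q, _, b, h', ?_⟩
  rw [← hq]
  rintro _ ⟨t, ht, rfl⟩
  exact ⟨c' t, hall ⟨t, ht, rfl⟩, diff_inv_diff _ _⟩

end Word

end

end TreeGraded

namespace TreeGraded

noncomputable section

open Filter Topology

/-! ### Directions in `ℝ`-trees -/

section Directions

variable {X : Type*} [MetricSpace X]

/-- The points `y` and `z` lie in the same direction from `x`: `x` is not between them. This is
false if one of the points is `x`. -/
def SameDir (x y z : X) : Prop := dist y z < dist y x + dist x z

/-- The point `m` lies between `x` and `y`. -/
def Between (x m y : X) : Prop := dist x m + dist m y = dist x y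

theorem IsGeodesic.between {γ : ℝ → X} {x y : X} (h : IsGeodesic γ x y) {t : ℝ}
    (ht : t ∈ Icc 0 (dist x y)) : dist x (γ t) = t ∧ Between x (γ t) y := by
  obtain ⟨h0, h1, h⟩ := h
  have e1 := h 0 ⟨le_rfl, dist_nonneg⟩ t ht
  have e2 := h t ht _ ⟨dist_nonneg, le_rfl⟩
  rw [h0, zero_sub, abs_neg, abs_of_nonneg ht.1] at e1
  rw [h1, abs_sub_comm, abs_of_nonneg (sub_nonneg.2 ht.2)] at e2
  exact ⟨e1, by rw [Between, e1, e2]; ring⟩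

theorem SameDir.symm {x y z : X} (h : SameDir x y z) : SameDir x z y := by
  unfold SameDir at *
  rw [dist_comm z y, dist_comm z x, dist_comm x y]
  linarith

theorem SameDir.ne_left {x y z : X} (h : SameDir x y z) : y ≠ x := by
  rintro rfl
  simp [SameDir] at h

theorem SameDir.ne_right {x y z : X} (h : SameDir x y z) : z ≠ x := h.symm.ne_left

theorem sameDir_refl {x y : X} (h : y ≠ x) : SameDir x y y := by
  have := dist_pos.2 h
  simp [SameDir, dist_comm x y, this]

theorem not_sameDir_iff {x y z : X} : ¬ SameDir x y z ↔ Between y x z := by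
  unfold SameDir Between
  have := dist_triangle y x z
  constructor
  · intro h; linarith
  · intro h; linarith

theorem Between.symm {x m y : X} (h : Between x m y) : Between y m x := by
  unfold Between at *
  rw [dist_comm y m, dist_comm m x, dist_comm y x]
  linarith

theorem Between.sameDir {x m y : X} (h : Between x m y) (hm : m ≠ x) : SameDir x m y := by
  unfold Between at h
  unfold SameDir
  have := dist_pos.2 hm
  rw [dist_comm x m] at h
  linarith

theorem between_right (x y : X) : Between x y y := by simp [Between]

/-- A point closer to `z` than `x` is lies in the direction of `z`. -/
theorem sameDir_of_dist_lt {x y z : X} (h : dist y z < dist x z) : SameDir x y z :=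
  h.trans_le (le_add_of_nonneg_left dist_nonneg)

theorem Between.trans {x p m a : X} (hp : Between x p a) (hm : Between x m p) :
    Between x m a := by
  unfold Between at *
  linarith [dist_triangle m p a, dist_triangle x m a]

namespace IsRTree

theorem sameDir_trans (hX : IsRTree X) {x y z w : X} (h1 : SameDir x y z) (h2 : SameDir x z w) :
    SameDir x y w := by
  by_contra h
  have := hX.separation x w z (by exact h2) y (by exact h)
  have h3 := h1.symm
  unfold SameDir at h3
  linarith

theorem exists_between (hX : IsRTree X) {x y : X} {t : ℝ} (ht : t ∈ Icc 0 (dist x y)) :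
    ∃ m, Between x m y ∧ dist x m = t := by
  obtain ⟨γ, hγ⟩ := hX.1 x y
  exact ⟨γ t, (hγ.between ht).2, (hγ.between ht).1⟩

theorem dist_eq_of_between (hX : IsRTree X) {x a m n : X} (hm : Between x m a)
    (hn : Between x n a) : dist m n = |dist x m - dist x n| := by
  unfold Between at *
  refine le_antisymm ?_ ?_
  · have := hX.2 m n x a
    rw [dist_comm m x, dist_comm n x] at this
    rcases le_max_iff.1 this with h | h
    · exact le_trans (by linarith) (le_abs_self _)
    · rw [abs_sub_comm]
      exact le_trans (by linarith) (le_abs_self _)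
  · have h := abs_dist_sub_le m n x
    rwa [dist_comm m x, dist_comm n x] at h

theorem eq_of_between (hX : IsRTree X) {x a m n : X} (hm : Between x m a) (hn : Between x n a)
    (h : dist x m = dist x n) : m = n := by
  rw [← dist_eq_zero, hX.dist_eq_of_between hm hn, h, sub_self, abs_zero]

/-- Geodesics in the same direction have a common initial part. -/
theorem exists_common_between (hX : IsRTree X) {x y z : X} (h : SameDir x y z) :
    ∃ m, m ≠ x ∧ Between x m y ∧ Between x m z := by
  unfold SameDir at h
  rw [dist_comm y x] at h
  have t1 := dist_triangle x y z
  have t2 := dist_triangle x z y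
  rw [dist_comm z y] at t2
  set δ := (dist x y + dist x z - dist y z) / 2 with hδ
  obtain ⟨m, hm, hd⟩ := hX.exists_between (x := x) (y := y) (t := δ)
    ⟨by linarith, by linarith⟩
  refine ⟨m, ?_, hm, ?_⟩
  · rintro rfl
    rw [dist_self] at hd
    linarith
  · unfold Between at *
    refine le_antisymm ?_ (dist_triangle _ _ _)
    have := hX.2 m z x y
    rw [dist_comm m x, dist_comm z x, dist_comm z y] at this
    rcases le_max_iff.1 this with h' | h' <;> linarith

theorem between_or (hX : IsRTree X) {p x q m : X} (hx : Between p x q) (hm : Between p m q) :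
    Between x m p ∨ Between x m q := by
  have h := hX.dist_eq_of_between hx hm
  unfold Between at *
  rw [dist_comm m p]
  rcases le_total (dist p x) (dist p m) with h' | h'
  · right
    rw [abs_sub_comm, abs_of_nonneg (by linarith)] at h
    linarith
  · left
    rw [abs_of_nonneg (by linarith)] at h
    rw [dist_comm x p]
    linarith

theorem not_sameDir_of_between (hX : IsRTree X) {x a p q : X} (h : ¬ SameDir x a q)
    (hp : Between x p a) : ¬ SameDir x p q := fun h' =>
  h (hX.sameDir_trans (hp.sameDir h'.ne_left).symm h')

theorem between_of_between (hX : IsRTree X) {x a p q m : X} (hp : Between x p a)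
    (hq : Between x q a) (hm : Between p m q) : Between x m a := by
  have h := hX.dist_eq_of_between hp hq
  unfold Between at *
  refine le_antisymm ?_ (dist_triangle _ _ _)
  rcases le_total (dist x p) (dist x q) with h' | h'
  · rw [abs_sub_comm, abs_of_nonneg (by linarith)] at h
    linarith [dist_triangle x p m, dist_triangle m q a]
  · rw [abs_of_nonneg (by linarith)] at h
    have h1 := dist_triangle x q m
    have h2 := dist_triangle m p a
    rw [dist_comm q m] at h1
    rw [dist_comm m p] at h2
    linarith

/-- Being in the same direction from `x`, as an equivalence relation on the other points. -/
def dirSetoid (hX : IsRTree X) (x : X) : Setoid {z : X // z ≠ x} where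
  r a b := SameDir x a b
  iseqv := ⟨fun a => sameDir_refl a.2, fun h => h.symm, fun h h' => hX.sameDir_trans h h'⟩

/-- The set of directions at `x`. -/
def Dir (hX : IsRTree X) (x : X) : Type _ := Quotient (hX.dirSetoid x)

end IsRTree

end Directions

/-! ### Uniqueness of the universal `ℝ`-tree -/

section Uniqueness

variable {X : Type*} {Y : Type*} [MetricSpace X]

/-- At most two directions at `p` contain points of the relation `R`. -/
def Thin (R : Set (X × Y)) (p : X × Y) : Prop :=
  ∀ a ∈ R, ∀ b ∈ R, ∀ c ∈ R, a.1 ≠ p.1 → b.1 ≠ p.1 → c.1 ≠ p.1 →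
    SameDir p.1 a.1 b.1 ∨ SameDir p.1 a.1 c.1 ∨ SameDir p.1 b.1 c.1

/-- A point remains thin if no new directions are added. -/
theorem Thin.of_replace (hX : IsRTree X) {R S : Set (X × Y)} {p : X × Y} (hp : Thin R p)
    (h : ∀ a ∈ S, a.1 ≠ p.1 → ∃ a' ∈ R, SameDir p.1 a.1 a'.1) : Thin S p := by
  intro a ha b hb c hc hap hbp hcp
  obtain ⟨a', ha', h1⟩ := h a ha hap
  obtain ⟨b', hb', h2⟩ := h b hb hbp
  obtain ⟨c', hc', h3⟩ := h c hc hcp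
  rcases hp a' ha' b' hb' c' hc' h1.ne_right h2.ne_right h3.ne_right with h' | h' | h'
  · exact Or.inl (hX.sameDir_trans h1 (hX.sameDir_trans h' h2.symm))
  · exact Or.inr (Or.inl (hX.sameDir_trans h1 (hX.sameDir_trans h' h3.symm)))
  · exact Or.inr (Or.inr (hX.sameDir_trans h2 (hX.sameDir_trans h' h3.symm)))

variable [MetricSpace Y]

/-- Every direction at `p`, in both spaces, contains points of the relation `R`. -/
def Saturated (R : Set (X × Y)) (p : X × Y) : Prop :=
  (∀ z ≠ p.1, ∃ q ∈ R, SameDir p.1 z q.1) ∧ ∀ w ≠ p.2, ∃ q ∈ R, SameDir p.2 w q.2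

/-- The graph of an isometry between convex subsets of `X` and `Y` such that at every point
either all or at most two directions are used up. This makes sure that the numbers of the unused
directions at corresponding points are the same. -/
structure PartialIso (R : Set (X × Y)) : Prop where
  iso : ∀ p ∈ R, ∀ q ∈ R, dist p.1 q.1 = dist p.2 q.2
  conv : ∀ p ∈ R, ∀ q ∈ R, ∀ m, Between p.1 m q.1 → ∃ n, (m, n) ∈ R
  sat : ∀ p ∈ R, Saturated R p ∨ Thin R p

theorem Saturated.mono {R S : Set (X × Y)} (h : R ⊆ S) {p : X × Y} (hp : Saturated R p) :
    Saturated S p :=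
  ⟨fun z hz => (hp.1 z hz).imp fun _ hq => ⟨h hq.1, hq.2⟩,
    fun z hz => (hp.2 z hz).imp fun _ hq => ⟨h hq.1, hq.2⟩⟩

namespace PartialIso

variable {R : Set (X × Y)}

theorem eq_of_fst_eq (hR : PartialIso R) {p q : X × Y} (hp : p ∈ R) (hq : q ∈ R)
    (h : p.1 = q.1) : p = q := by
  refine Prod.ext h (dist_eq_zero.1 ?_)
  rw [← hR.iso p hp q hq, h, dist_self]

theorem sameDir_iff (hR : PartialIso R) {p a b : X × Y} (hp : p ∈ R) (ha : a ∈ R) (hb : b ∈ R) :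
    SameDir p.1 a.1 b.1 ↔ SameDir p.2 a.2 b.2 := by
  unfold SameDir
  rw [hR.iso a ha b hb, hR.iso a ha p hp, hR.iso p hp b hb]

theorem conv_snd (hR : PartialIso R) (hX : IsRTree X) (hY : IsRTree Y) {p q : X × Y} (hp : p ∈ R)
    (hq : q ∈ R) {n : Y} (hn : Between p.2 n q.2) : ∃ m, (m, n) ∈ R := by
  obtain ⟨m, hm, hd⟩ := hX.exists_between (x := p.1) (y := q.1) (t := dist p.2 n) ⟨dist_nonneg, by
    rw [hR.iso p hp q hq]
    unfold Between at hn
    linarith [dist_nonneg (x := n) (y := q.2)]⟩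
  obtain ⟨n', hn'⟩ := hR.conv p hp q hq m hm
  have h1 := hR.iso p hp _ hn'
  have h2 := hR.iso _ hn' q hq
  have h3 := hR.iso p hp q hq
  simp only at h1 h2
  have : n' = n := by
    refine hY.eq_of_between (x := p.2) (a := q.2) ?_ hn (by rw [← h1, hd])
    unfold Between at *
    rw [← h1, ← h2, ← h3, hm]
  exact ⟨m, this ▸ hn'⟩

theorem thin_snd (hR : PartialIso R) {p : X × Y} (hp : p ∈ R) (h : Thin R p) :
    ∀ a ∈ R, ∀ b ∈ R, ∀ c ∈ R, a.2 ≠ p.2 → b.2 ≠ p.2 → c.2 ≠ p.2 →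
      SameDir p.2 a.2 b.2 ∨ SameDir p.2 a.2 c.2 ∨ SameDir p.2 b.2 c.2 := by
  have key : ∀ a ∈ R, a.2 ≠ p.2 → a.1 ≠ p.1 := fun a ha h h' =>
    h (congrArg Prod.snd (hR.eq_of_fst_eq ha hp h'))
  intro a ha b hb c hc h1 h2 h3
  rw [← hR.sameDir_iff hp ha hb, ← hR.sameDir_iff hp ha hc, ← hR.sameDir_iff hp hb hc]
  exact h a ha b hb c hc (key a ha h1) (key b hb h2) (key c hc h3)

theorem swap (hR : PartialIso R) (hX : IsRTree X) (hY : IsRTree Y) :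
    PartialIso (Prod.swap ⁻¹' R : Set (Y × X)) where
  iso p hp q hq := (hR.iso _ hp _ hq).symm
  conv p hp q hq m hm := hR.conv_snd hX hY hp hq hm
  sat p hp := by
    rcases hR.sat _ hp with h | h
    · left
      exact ⟨fun z hz => by
          obtain ⟨q, hq, h'⟩ := h.2 z hz
          exact ⟨q.swap, by simpa using hq, h'⟩, fun z hz => by
          obtain ⟨q, hq, h'⟩ := h.1 z hz
          exact ⟨q.swap, by simpa using hq, h'⟩⟩
    · right
      intro a ha b hb c hc
      exact hR.thin_snd hp h _ ha _ hb _ hc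

/-- Zorn's hypothesis: unions of chains of partial isometries are partial isometries. A point that
is never saturated is thin all the time, and thinness is a condition on three points at a time. -/
theorem sUnion {C : Set (Set (X × Y))} (hC : ∀ R ∈ C, PartialIso R)
    (hch : IsChain (· ⊆ ·) C) : PartialIso (⋃₀ C) := by
  have key : ∀ p ∈ ⋃₀ C, ∀ q ∈ ⋃₀ C, ∃ R ∈ C, p ∈ R ∧ q ∈ R := by
    rintro p ⟨R, hR, hp⟩ q ⟨S, hS, hq⟩
    rcases hch.total hR hS with h | h
    · exact ⟨S, hS, h hp, hq⟩
    · exact ⟨R, hR, hp, h hq⟩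
  refine ⟨fun p hp q hq => ?_, fun p hp q hq m hm => ?_, fun p hp => ?_⟩
  · obtain ⟨R, hR, hpR, hqR⟩ := key p hp q hq
    exact (hC R hR).iso p hpR q hqR
  · obtain ⟨R, hR, hpR, hqR⟩ := key p hp q hq
    obtain ⟨n, hn⟩ := (hC R hR).conv p hpR q hqR m hm
    exact ⟨n, R, hR, hn⟩
  · by_cases h : ∃ R ∈ C, p ∈ R ∧ Saturated R p
    · obtain ⟨R, hR, -, hs⟩ := h
      exact Or.inl (hs.mono (subset_sUnion_of_mem hR))
    · right
      rintro a ⟨Ra, hRa, ha⟩ b ⟨Rb, hRb, hb⟩ c ⟨Rc, hRc, hc⟩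
      obtain ⟨R₁, hR₁, hp₁, ha₁⟩ := key p hp a ⟨Ra, hRa, ha⟩
      have : ∃ R ∈ C, p ∈ R ∧ a ∈ R ∧ b ∈ R ∧ c ∈ R := by
        obtain ⟨S, hS, h1, h2⟩ : ∃ S ∈ C, R₁ ⊆ S ∧ Rb ⊆ S := by
          rcases hch.total hR₁ hRb with h | h
          · exact ⟨Rb, hRb, h, subset_rfl⟩
          · exact ⟨R₁, hR₁, subset_rfl, h⟩
        rcases hch.total hS hRc with h' | h'
        · exact ⟨Rc, hRc, h' (h1 hp₁), h' (h1 ha₁), h' (h2 hb), hc⟩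
        · exact ⟨S, hS, h1 hp₁, h1 ha₁, h2 hb, h' hc⟩
      obtain ⟨R, hR, hpR, haR, hbR, hcR⟩ := this
      rcases (hC R hR).sat p hpR with h' | h'
      · exact absurd ⟨R, hR, hpR, h'⟩ h
      · exact h' a haR b hbR c hcR

/-- A limit point may be added to a partial isometry. -/
theorem insert_limit (hX : IsRTree X) (hR : PartialIso R) {s : ℕ → X × Y} (hs : ∀ n, s n ∈ R)
    {x : X} {y : Y} (hx : Tendsto (fun n => (s n).1) atTop (𝓝 x))
    (hy : Tendsto (fun n => (s n).2) atTop (𝓝 y)) (hxR : ∀ n, (x, n) ∉ R) :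
    PartialIso (insert (x, y) R) := by
  have hd : ∀ p ∈ R, dist x p.1 = dist y p.2 := fun p hp => by
    have h1 : Tendsto (fun n => dist (s n).1 p.1) atTop (𝓝 (dist x p.1)) :=
      hx.dist tendsto_const_nhds
    have h2 : Tendsto (fun n => dist (s n).2 p.2) atTop (𝓝 (dist y p.2)) :=
      hy.dist tendsto_const_nhds
    simp only [hR.iso _ (hs _) p hp] at h1
    exact tendsto_nhds_unique h1 h2
  -- Seen from any other point, the new point lies in the direction of points of the sequence.
  have happ : ∀ m ≠ x, ∃ n, SameDir m x (s n).1 := fun m hm => by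
    obtain ⟨n, hn⟩ := (Metric.tendsto_atTop.1 hx _ (dist_pos.2 hm))
    refine ⟨n, SameDir.symm ?_⟩
    exact sameDir_of_dist_lt (hn n le_rfl)
  have hconv : ∀ q ∈ R, ∀ m, Between x m q.1 → m ≠ x → ∃ n, (m, n) ∈ R := by
    intro q hq m hm hmx
    obtain ⟨n, hn⟩ := happ m hmx
    refine hR.conv _ (hs n) q hq m (not_sameDir_iff.1 fun h => ?_)
    exact not_sameDir_iff.2 hm (hX.sameDir_trans hn h)
  refine ⟨?_, ?_, ?_⟩
  · rintro p (rfl | hp) q (rfl | hq)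
    · simp
    · exact hd q hq
    · rw [dist_comm p.1, dist_comm p.2]; exact hd p hp
    · exact hR.iso p hp q hq
  · intro p hp q hq m hm
    by_cases hmx : m = x
    · exact ⟨y, Or.inl (by rw [hmx])⟩
    rcases hp with rfl | hp <;> rcases hq with rfl | hq
    · exfalso
      unfold Between at hm
      simp only [dist_self] at hm
      exact hmx (dist_eq_zero.1 (by
        linarith [dist_nonneg (x := x) (y := m), dist_nonneg (x := m) (y := x)]))
    · obtain ⟨n, hn⟩ := hconv q hq m hm hmx
      exact ⟨n, Or.inr hn⟩
    · obtain ⟨n, hn⟩ := hconv p hp m hm.symm hmx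
      exact ⟨n, Or.inr hn⟩
    · obtain ⟨n, hn⟩ := hR.conv p hp q hq m hm
      exact ⟨n, Or.inr hn⟩
  · rintro p (rfl | hp)
    · right
      intro a ha b hb c hc hap hbp hcp
      left
      have ha' := ha.resolve_left fun h => hap (by rw [h])
      have hb' := hb.resolve_left fun h => hbp (by rw [h])
      by_contra h
      obtain ⟨n, hn⟩ := hR.conv a ha' b hb' x (not_sameDir_iff.1 h)
      exact hxR n hn
    · rcases hR.sat p hp with h | h
      · exact Or.inl (h.mono (subset_insert _ _))
      · refine Or.inr (h.of_replace hX ?_)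
        rintro a (rfl | ha) hap
        · obtain ⟨n, hn⟩ := happ p.1 hap.symm
          exact ⟨s n, hs n, hn⟩
        · exact ⟨a, ha, sameDir_refl hap⟩

/-- The union of a relation with the graphs of isometries between the segments `[x, a i]` and
`[y, b i]`. -/
def addSegments (R : Set (X × Y)) (x : X) (y : Y) {ι : Type*} (a : ι → X) (b : ι → Y) :
    Set (X × Y) :=
  R ∪ {p | ∃ i, Between x p.1 (a i) ∧ Between y p.2 (b i) ∧ dist x p.1 = dist y p.2}

/-- At a point where only some directions are used up, segments can be added in all the other
directions, if these directions are matched bijectively. -/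
theorem addSegments_partialIso (hX : IsRTree X) (hY : IsRTree Y) (hR : PartialIso R) {x : X}
    {y : Y} (hxy : (x, y) ∈ R) {ι : Type*} {a : ι → X} {b : ι → Y}
    (hab : ∀ i, dist x (a i) = dist y (b i)) (ha : ∀ i k, i ≠ k → ¬ SameDir x (a i) (a k))
    (hb : ∀ i k, i ≠ k → ¬ SameDir y (b i) (b k)) (haR : ∀ i, ∀ q ∈ R, ¬ SameDir x (a i) q.1)
    (hbR : ∀ i, ∀ q ∈ R, ¬ SameDir y (b i) q.2)
    (hac : ∀ z ≠ x, (∃ q ∈ R, SameDir x z q.1) ∨ ∃ i, SameDir x z (a i))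
    (hbc : ∀ w ≠ y, (∃ q ∈ R, SameDir y w q.2) ∨ ∃ i, SameDir y w (b i)) :
    PartialIso (addSegments R x y a b) ∧ Saturated (addSegments R x y a b) (x, y) := by
  set S := addSegments R x y a b with hS
  -- the possible relative positions of two points of the extended relation
  have hpos : ∀ p ∈ S, ∀ q ∈ S, (¬ SameDir x p.1 q.1 ∧ ¬ SameDir y p.2 q.2) ∨
      (p ∈ R ∧ q ∈ R) ∨ ∃ i, Between x p.1 (a i) ∧ Between x q.1 (a i) ∧
        Between y p.2 (b i) ∧ Between y q.2 (b i) := by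
    rintro p (hp | ⟨i, hi1, hi2, -⟩) q (hq | ⟨k, hk1, hk2, -⟩)
    · exact Or.inr (Or.inl ⟨hp, hq⟩)
    · exact Or.inl ⟨fun h => hX.not_sameDir_of_between (haR k p hp) hk1 h.symm,
        fun h => hY.not_sameDir_of_between (hbR k p hp) hk2 h.symm⟩
    · exact Or.inl ⟨hX.not_sameDir_of_between (haR i q hq) hi1,
        hY.not_sameDir_of_between (hbR i q hq) hi2⟩
    · by_cases hik : i = k
      · subst hik
        exact Or.inr (Or.inr ⟨i, hi1, hk1, hi2, hk2⟩)
      · left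
        constructor
        · refine hX.not_sameDir_of_between (fun h => ?_) hi1
          exact hX.not_sameDir_of_between (ha k i (Ne.symm hik)) hk1 h.symm
        · refine hY.not_sameDir_of_between (fun h => ?_) hi2
          exact hY.not_sameDir_of_between (hb k i (Ne.symm hik)) hk2 h.symm
  have hdx : ∀ p ∈ S, dist x p.1 = dist y p.2 := by
    rintro p (hp | ⟨i, -, -, h⟩)
    · exact hR.iso _ hxy p hp
    · exact h
  have hstar : ∀ p ∈ S, ∀ m, Between x m p.1 → ∃ n, (m, n) ∈ S := by
    rintro p (hp | ⟨i, hi1, hi2, h⟩) m hm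
    · obtain ⟨n, hn⟩ := hR.conv _ hxy p hp m hm
      exact ⟨n, Or.inl hn⟩
    · have h1 := hi1.trans hm
      obtain ⟨n, hn, hd⟩ := hY.exists_between (x := y) (y := b i) (t := dist x m) ⟨dist_nonneg, by
        rw [← hab]
        unfold Between at h1
        linarith [dist_nonneg (x := m) (y := a i)]⟩
      exact ⟨n, Or.inr ⟨i, h1, hn, hd.symm⟩⟩
  have hsat : Saturated S (x, y) := by
    have hmem : ∀ i, (a i, b i) ∈ S := fun i =>
      Or.inr ⟨i, between_right _ _, between_right _ _, hab i⟩
    constructor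
    · intro z hz
      rcases hac z hz with ⟨q, hq, h⟩ | ⟨i, h⟩
      · exact ⟨q, Or.inl hq, h⟩
      · exact ⟨_, hmem i, h⟩
    · intro w hw
      rcases hbc w hw with ⟨q, hq, h⟩ | ⟨i, h⟩
      · exact ⟨q, Or.inl hq, h⟩
      · exact ⟨_, hmem i, h⟩
  refine ⟨⟨fun p hp q hq => ?_, fun p hp q hq m hm => ?_, fun p hp => ?_⟩, hsat⟩
  · rcases hpos p hp q hq with ⟨h1, h2⟩ | ⟨h1, h2⟩ | ⟨i, h1, h2, h3, h4⟩
    · have e1 := not_sameDir_iff.1 h1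
      have e2 := not_sameDir_iff.1 h2
      unfold Between at e1 e2
      rw [← e1, ← e2, hdx q hq, dist_comm p.1, dist_comm p.2, hdx p hp]
    · exact hR.iso p h1 q h2
    · rw [hX.dist_eq_of_between h1 h2, hY.dist_eq_of_between h3 h4, hdx p hp, hdx q hq]
  · rcases hpos p hp q hq with ⟨h1, -⟩ | ⟨h1, h2⟩ | ⟨i, h1, h2, -, -⟩
    · rcases hX.between_or (not_sameDir_iff.1 h1) hm with h | h
      · exact hstar p hp m h
      · exact hstar q hq m h
    · obtain ⟨n, hn⟩ := hR.conv p h1 q h2 m hm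
      exact ⟨n, Or.inl hn⟩
    · refine hstar (a i, b i) (Or.inr ⟨i, between_right _ _, between_right _ _, hab i⟩) m ?_
      exact hX.between_of_between h1 h2 hm
  · by_cases hpx : p.1 = x
    · left
      have : p = (x, y) := Prod.ext hpx (dist_eq_zero.1 (by
        rw [dist_comm, ← hdx p hp, hpx, dist_self]))
      rw [this]
      exact hsat
    -- A point that is not in the direction of `p` from `x` is in the direction of `x` from `p`.
    have hback : ∀ q : X × Y, ¬ SameDir x q.1 p.1 → SameDir p.1 q.1 x := by
      intro q h
      have h1 := not_sameDir_iff.1 h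
      have h2 := dist_pos.2 hpx
      unfold Between at h1
      unfold SameDir
      rw [← h1, dist_comm x p.1]
      linarith
    rcases id hp with hp' | ⟨i, hi1, hi2, hi⟩
    · rcases hR.sat p hp' with h | h
      · exact Or.inl (h.mono subset_union_left)
      · refine Or.inr (h.of_replace hX fun q hq hqp => ?_)
        rcases hq with hq | ⟨k, hk1, hk2, hk⟩
        · exact ⟨q, hq, sameDir_refl hqp⟩
        · exact ⟨_, hxy, hback q (hX.not_sameDir_of_between (haR k p hp') hk1)⟩
    · right
      -- At an inner point of a new segment only the directions of its two ends are used.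
      have htwo : ∀ q ∈ S, q.1 ≠ p.1 → SameDir p.1 q.1 x ∨ SameDir p.1 q.1 (a i) := by
        intro q hq hqp
        by_cases hdir : SameDir x q.1 p.1
        · have hseg : Between x q.1 (a i) := by
            rcases hq with hq | ⟨k, hk1, -, -⟩
            · exact absurd hdir.symm (hX.not_sameDir_of_between (haR i q hq) hi1)
            · by_cases hik : i = k
              · subst hik; exact hk1
              · exact absurd hdir (hX.not_sameDir_of_between (fun h =>
                  hX.not_sameDir_of_between (ha i k hik) hi1 h.symm) hk1)
          have hd := hX.dist_eq_of_between hseg hi1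
          have h0 := dist_pos.2 hqp
          unfold Between at hseg hi1
          rcases le_total (dist x q.1) (dist x p.1) with h | h
          · left
            rw [abs_sub_comm, abs_of_nonneg (by linarith)] at hd
            unfold SameDir
            rw [dist_comm q.1 x, dist_comm p.1 x]
            linarith
          · right
            rw [abs_of_nonneg (by linarith)] at hd
            unfold SameDir
            linarith
        · exact Or.inl (hback q hdir)
      intro q₁ h₁ q₂ h₂ q₃ h₃ n₁ n₂ n₃
      rcases htwo q₁ h₁ n₁ with e₁ | e₁ <;> rcases htwo q₂ h₂ n₂ with e₂ | e₂
      · exact Or.inl (hX.sameDir_trans e₁ e₂.symm)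
      · rcases htwo q₃ h₃ n₃ with e₃ | e₃
        · exact Or.inr (Or.inl (hX.sameDir_trans e₁ e₃.symm))
        · exact Or.inr (Or.inr (hX.sameDir_trans e₂ e₃.symm))
      · rcases htwo q₃ h₃ n₃ with e₃ | e₃
        · exact Or.inr (Or.inr (hX.sameDir_trans e₂ e₃.symm))
        · exact Or.inr (Or.inl (hX.sameDir_trans e₁ e₃.symm))
      · exact Or.inl (hX.sameDir_trans e₁ e₂.symm)

/-- The domain of a maximal partial isometry is closed, since limit points may be added. -/
theorem isClosed_fst (hX : IsRTree X) [CompleteSpace Y] (hR : Maximal PartialIso R) :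
    IsClosed (Prod.fst '' R) := by
  refine isClosed_of_closure_subset fun x hx => ?_
  by_contra hxR
  obtain ⟨s, hs, hlim⟩ := mem_closure_iff_seq_limit.1 hx
  choose p hp hps using hs
  have hc : CauchySeq fun n => (p n).2 := by
    have h1 := hlim.cauchySeq
    rw [Metric.cauchySeq_iff] at h1 ⊢
    intro ε hε
    obtain ⟨N, hN⟩ := h1 ε hε
    refine ⟨N, fun m hm n hn => ?_⟩
    rw [← hR.prop.iso _ (hp m) _ (hp n), hps, hps]
    exact hN m hm n hn
  obtain ⟨y, hy⟩ := cauchySeq_tendsto_of_complete hc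
  have h2 := hR.prop.insert_limit hX hp (x := x) (by simpa only [hps] using hlim) hy
    fun n hn => hxR ⟨_, hn, rfl⟩
  exact hxR ⟨(x, y), hR.le_of_ge h2 (subset_insert _ _) (mem_insert _ _), rfl⟩

/-- A closed convex set that contains points in every direction at each of its points is the whole
tree. -/
theorem fst_surjective (hX : IsRTree X) [CompleteSpace Y] (hR : Maximal PartialIso R)
    (hne : R.Nonempty) (hsat : ∀ p ∈ R, Saturated R p) (z : X) : ∃ y, (z, y) ∈ R := by
  by_contra! hz
  obtain ⟨p₀, hp₀⟩ := hne
  obtain ⟨γ, h0, h1, h⟩ := hX.1 p₀.1 z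
  set d := dist p₀.1 z
  have hd : 0 ≤ d := dist_nonneg
  have hcont : ContinuousOn γ (Icc 0 d) :=
    (LipschitzOnWith.of_dist_le_mul (K := 1) fun s hs t ht => by
      rw [h s hs t ht, NNReal.coe_one, one_mul, Real.dist_eq]).continuousOn
  set T : Set ℝ := Icc 0 d ∩ γ ⁻¹' (Prod.fst '' R) with hT
  have hTc : IsClosed T := hcont.preimage_isClosed_of_isClosed isClosed_Icc (isClosed_fst hX hR)
  have hTne : T.Nonempty := ⟨0, ⟨le_rfl, hd⟩, p₀, hp₀, h0.symm⟩
  have hTb : BddAbove T := ⟨d, fun t ht => ht.1.2⟩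
  obtain ⟨⟨ht0, htd⟩, q, hq, hqt⟩ := hTc.csSup_mem hTne hTb
  set t := sSup T
  have hqz : z ≠ q.1 := fun h' => hz q.2 (by rw [h']; exact hq)
  have htd' : t < d := lt_of_le_of_ne htd fun h' => hqz (by rw [hqt, h', h1])
  obtain ⟨q', hq', hdir⟩ := (hsat q hq).1 z hqz
  -- Beyond the last point of `R` on the geodesic to `z`, this geodesic and the one to `q'` have a
  -- common initial part, which belongs to `R` by convexity.
  obtain ⟨m, hm, hmz, hmq⟩ := hX.exists_common_between hdir
  obtain ⟨n, hn⟩ := hR.prop.conv q hq q' hq' m hmq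
  have hqm : 0 < dist q.1 m := dist_pos.2 hm.symm
  have hqzd : dist q.1 z = d - t := by
    rw [hqt, ← h1, h t ⟨ht0, htd⟩ d ⟨hd, le_rfl⟩, abs_sub_comm, abs_of_nonneg (by linarith)]
  have hmzd := hmz
  unfold Between at hmzd
  have hr : t + dist q.1 m ∈ Icc 0 d :=
    ⟨by linarith, by linarith [dist_nonneg (x := m) (y := z)]⟩
  have e1 : dist q.1 (γ (t + dist q.1 m)) = dist q.1 m := by
    have e0 := h t ⟨ht0, htd⟩ _ hr
    rw [← hqt, abs_sub_comm, abs_of_nonneg (by linarith)] at e0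
    rw [e0]
    ring
  have e2 : dist (γ (t + dist q.1 m)) z = d - (t + dist q.1 m) := by
    rw [← h1, h _ hr d ⟨hd, le_rfl⟩, abs_sub_comm, abs_of_nonneg (by linarith [hr.2])]
  have e3 : γ (t + dist q.1 m) = m := by
    refine hX.eq_of_between (x := q.1) (a := z) ?_ hmz e1
    unfold Between
    linarith
  have := le_csSup hTb (show t + dist q.1 m ∈ T from ⟨hr, (m, n), hn, e3.symm⟩)
  linarith

end PartialIso

/-- If at most two directions at a point are used up, then almost all directions are unused. -/
theorem mk_unused_directions {Z : Type*} [MetricSpace Z] (hZ : IsRTree Z) {z : Z}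
    (hc : Cardinal.mk (hZ.Dir z) = Cardinal.continuum) (O : Set Z)
    (hO : ∀ a ∈ O, ∀ b ∈ O, ∀ c ∈ O, a ≠ z → b ≠ z → c ≠ z →
      SameDir z a b ∨ SameDir z a c ∨ SameDir z b c) :
    Cardinal.mk {d : hZ.Dir z | ∀ (a : Z) (h : a ≠ z), a ∈ O → Quotient.mk _ ⟨a, h⟩ ≠ d} =
      Cardinal.continuum := by
  classical
  have hinf : Infinite (hZ.Dir z) := by
    rw [Cardinal.infinite_iff, hc]
    exact Cardinal.aleph0_le_continuum
  set U : Set (hZ.Dir z) := {d | ∃ (a : Z) (h : a ≠ z), a ∈ O ∧ Quotient.mk _ ⟨a, h⟩ = d}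
  have hU : U.Finite := by
    by_contra hU
    obtain ⟨t, htU, ht⟩ := Set.Infinite.exists_subset_card_eq hU 3
    obtain ⟨d₁, d₂, d₃, h12, h13, h23, rfl⟩ := Finset.card_eq_three.1 ht
    obtain ⟨a, ha, haO, had⟩ := htU (show d₁ ∈ _ by simp)
    obtain ⟨b, hb, hbO, hbd⟩ := htU (show d₂ ∈ _ by simp)
    obtain ⟨c, hc, hcO, hcd⟩ := htU (show d₃ ∈ _ by simp)
    rcases hO a haO b hbO c hcO ha hb hc with h | h | h
    · exact h12 (by rw [← had, ← hbd]; exact Quotient.sound h)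
    · exact h13 (by rw [← had, ← hcd]; exact Quotient.sound h)
    · exact h23 (by rw [← hbd, ← hcd]; exact Quotient.sound h)
  have : {d : hZ.Dir z | ∀ (a : Z) (h : a ≠ z), a ∈ O → Quotient.mk _ ⟨a, h⟩ ≠ d} = Uᶜ := by
    ext d
    exact ⟨fun h ⟨a, ha, haO, e⟩ => h a ha haO e, fun h a ha haO e => h ⟨a, ha, haO, e⟩⟩
  rw [this, ← hc]
  refine Cardinal.mk_compl_of_infinite U (lt_of_lt_of_le ?_ (Cardinal.aleph0_le_mk _))
  exact Cardinal.lt_aleph0_iff_finite.2 hU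

/-- A maximal partial isometry is saturated, since otherwise the unused directions at some point
could be matched. -/
theorem PartialIso.saturated_of_maximal (hX : IsRTree X) (hY : IsRTree Y)
    (cX : ∀ x, Cardinal.mk (hX.Dir x) = Cardinal.continuum)
    (cY : ∀ y, Cardinal.mk (hY.Dir y) = Cardinal.continuum) {R : Set (X × Y)}
    (hR : Maximal PartialIso R) {p : X × Y} (hp : p ∈ R) : Saturated R p := by
  rcases hR.prop.sat p hp with h | h
  · exact h
  obtain ⟨x, y⟩ := p
  have c1 := mk_unused_directions hX (cX x) (Prod.fst '' R) (by
    rintro _ ⟨a, ha, rfl⟩ _ ⟨b, hb, rfl⟩ _ ⟨c, hc, rfl⟩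
    exact h a ha b hb c hc)
  have c2 := mk_unused_directions hY (cY y) (Prod.snd '' R) (by
    rintro _ ⟨a, ha, rfl⟩ _ ⟨b, hb, rfl⟩ _ ⟨c, hc, rfl⟩
    exact hR.prop.thin_snd hp h a ha b hb c hc)
  have hlift : Cardinal.lift.{u_2} (Cardinal.mk {d : hX.Dir x | ∀ (a : X) (h : a ≠ x),
      a ∈ Prod.fst '' R → Quotient.mk _ ⟨a, h⟩ ≠ d}) =
      Cardinal.lift.{u_1} (Cardinal.mk {d : hY.Dir y | ∀ (a : Y) (h : a ≠ y),
      a ∈ Prod.snd '' R → Quotient.mk _ ⟨a, h⟩ ≠ d}) := by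
    rw [c1, c2, Cardinal.lift_continuum, Cardinal.lift_continuum]
  obtain ⟨σ⟩ := Cardinal.lift_mk_eq'.1 hlift
  -- Representatives of matched directions are chosen at the same distance from `x` and `y`.
  have hrep : ∀ d : {d : hX.Dir x | ∀ (a : X) (h : a ≠ x),
      a ∈ Prod.fst '' R → Quotient.mk _ ⟨a, h⟩ ≠ d}, ∃ (a : {a : X // a ≠ x})
      (b : {b : Y // b ≠ y}), dist x a = dist y b ∧ Quotient.mk (hX.dirSetoid x) a = d.1 ∧
        Quotient.mk (hY.dirSetoid y) b = (σ d).1 := by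
    intro d
    obtain ⟨a, ha⟩ := Quotient.exists_rep d.1
    obtain ⟨b, hb⟩ := Quotient.exists_rep (σ d).1
    set r := min (dist x a) (dist y b)
    have hr : 0 < r := lt_min (dist_pos.2 a.2.symm) (dist_pos.2 b.2.symm)
    obtain ⟨a', ha', had⟩ := hX.exists_between (x := x) (y := a) (t := r)
      ⟨hr.le, min_le_left _ _⟩
    obtain ⟨b', hb', hbd⟩ := hY.exists_between (x := y) (y := b) (t := r)
      ⟨hr.le, min_le_right _ _⟩
    have ha0 : a' ≠ x := fun h => by rw [h, dist_self] at had; exact hr.ne had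
    have hb0 : b' ≠ y := fun h => by rw [h, dist_self] at hbd; exact hr.ne hbd
    refine ⟨⟨a', ha0⟩, ⟨b', hb0⟩, had.trans hbd.symm, ?_, ?_⟩
    · rw [← ha]; exact Quotient.sound (ha'.sameDir ha0)
    · rw [← hb]; exact Quotient.sound (hb'.sameDir hb0)
  choose a b hab ha hb using hrep
  obtain ⟨h1, h2⟩ := hR.prop.addSegments_partialIso hX hY hp (a := fun i => (a i : X))
    (b := fun i => (b i : Y)) hab
    (fun i k hik hs => hik (Subtype.ext (by
      rw [← ha i, ← ha k]; exact Quotient.sound (show SameDir x _ _ from hs))))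
    (fun i k hik hs => hik (σ.injective (Subtype.ext (by
      rw [← hb i, ← hb k]; exact Quotient.sound (show SameDir y _ _ from hs)))))
    (fun i q hq hs => i.2 q.1 hs.ne_right ⟨q, hq, rfl⟩ (by
      rw [← ha i]; exact (Quotient.sound (show SameDir x _ _ from hs)).symm))
    (fun i q hq hs => (σ i).2 q.2 hs.ne_right ⟨q, hq, rfl⟩ (by
      rw [← hb i]; exact (Quotient.sound (show SameDir y _ _ from hs)).symm))
    (fun z hz => by
      by_cases hd : ∃ q ∈ R, SameDir x z q.1
      · exact Or.inl hd
      right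
      have hmem : ∀ (a : X) (h : a ≠ x), a ∈ Prod.fst '' R →
          Quotient.mk (hX.dirSetoid x) ⟨a, h⟩ ≠ Quotient.mk _ ⟨z, hz⟩ := by
        rintro _ h' ⟨q, hq, rfl⟩ h''
        exact hd ⟨q, hq, (show SameDir x _ _ from Quotient.exact h'').symm⟩
      exact ⟨⟨_, hmem⟩, (show SameDir x _ _ from Quotient.exact (ha ⟨_, hmem⟩)).symm⟩)
    (fun w hw => by
      by_cases hd : ∃ q ∈ R, SameDir y w q.2
      · exact Or.inl hd
      right
      have hmem : ∀ (a : Y) (h : a ≠ y), a ∈ Prod.snd '' R →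
          Quotient.mk (hY.dirSetoid y) ⟨a, h⟩ ≠ Quotient.mk _ ⟨w, hw⟩ := by
        rintro _ h' ⟨q, hq, rfl⟩ h''
        exact hd ⟨q, hq, (show SameDir y _ _ from Quotient.exact h'').symm⟩
      refine ⟨σ.symm ⟨_, hmem⟩, ?_⟩
      have := hb (σ.symm ⟨_, hmem⟩)
      rw [Equiv.apply_symm_apply] at this
      exact (show SameDir y _ _ from Quotient.exact this).symm)
  exact h2.mono (hR.le_of_ge h1 subset_union_left)

/-- Any two non-empty complete `ℝ`-trees with continuum many directions at every point are
isometric. -/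
theorem IsRTree.nonempty_isometryEquiv [CompleteSpace X] [CompleteSpace Y] [Nonempty X]
    [Nonempty Y] (hX : IsRTree X) (hY : IsRTree Y)
    (cX : ∀ x, Cardinal.mk (hX.Dir x) = Cardinal.continuum)
    (cY : ∀ y, Cardinal.mk (hY.Dir y) = Cardinal.continuum) : Nonempty (X ≃ᵢ Y) := by
  obtain ⟨x₀⟩ := ‹Nonempty X›
  obtain ⟨y₀⟩ := ‹Nonempty Y›
  have h₀ : PartialIso {(x₀, y₀)} := by
    refine ⟨?_, ?_, ?_⟩
    · rintro _ rfl _ rfl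
      simp
    · rintro _ rfl _ rfl m hm
      refine ⟨y₀, ?_⟩
      unfold Between at hm
      simp only [dist_self] at hm
      have : x₀ = m := dist_eq_zero.1 (by
        linarith [dist_nonneg (x := x₀) (y := m), dist_nonneg (x := m) (y := x₀)])
      rw [this]
      rfl
    · rintro _ rfl
      right
      rintro _ rfl b hb c hc h
      exact absurd rfl h
  obtain ⟨R, hR₀, hR⟩ := zorn_subset_nonempty {R : Set (X × Y) | PartialIso R}
    (fun C hC hch _ => ⟨⋃₀ C, PartialIso.sUnion hC hch, fun s hs => subset_sUnion_of_mem hs⟩)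
    _ h₀
  have hR' : Maximal PartialIso R := hR
  have hne : R.Nonempty := ⟨_, hR₀ rfl⟩
  have hsat : ∀ p ∈ R, Saturated R p := fun p hp =>
    PartialIso.saturated_of_maximal hX hY cX cY hR' hp
  -- The conditions are symmetric in `X` and `Y`, so that `R` also projects onto `Y`.
  have hswap : Maximal PartialIso (Prod.swap ⁻¹' R : Set (Y × X)) := by
    refine ⟨hR'.prop.swap hX hY, fun S hS hle => ?_⟩
    have h1 : R ⊆ Prod.swap ⁻¹' S := fun p hp => hle (by simpa using hp)
    have h2 := hR'.le_of_ge (hS.swap hY hX) h1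
    intro p hp
    exact h2 (show p.swap ∈ Prod.swap ⁻¹' S by simpa using hp)
  have hl := PartialIso.fst_surjective hX hR' hne hsat
  have hr := PartialIso.fst_surjective hY hswap (by
    obtain ⟨p, hp⟩ := hne
    exact ⟨p.swap, by simpa using hp⟩) fun p hp =>
      PartialIso.saturated_of_maximal hY hX cY cX hswap hp
  choose φ hφ using hl
  choose ψ hψ using hr
  have hψ' : ∀ y, (ψ y, y) ∈ R := hψ
  have hinj : ∀ {x x' : X} {y : Y}, (x, y) ∈ R → (x', y) ∈ R → x = x' := by
    intro x x' y h h'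
    have := hR'.prop.iso _ h _ h'
    simpa using this
  have hinj' : ∀ {x : X} {y y' : Y}, (x, y) ∈ R → (x, y') ∈ R → y = y' := by
    intro x y y' h h'
    have := hR'.prop.iso _ h _ h'
    simpa using this.symm
  exact ⟨{ toFun := φ
           invFun := ψ
           left_inv := fun x => hinj (hψ' (φ x)) (hφ x)
           right_inv := fun y => hinj' (hφ (ψ y)) (hψ' y)
           isometry_toFun := Isometry.of_dist_eq fun x x' =>
             (hR'.prop.iso _ (hφ x) _ (hφ x')).symm }⟩

end Uniqueness

end

end TreeGraded

namespace TreeGraded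

noncomputable section

open Filter Topology

/-! ### The explicit universal `ℝ`-tree -/

/-- If the distance comes from a height function and an ultrametric separation height, then the
four-point condition holds. -/
theorem four_point_of_ultrametric {X : Type*} [MetricSpace X] {ρ : X → ℝ} {s : X → X → ℝ}
    (hd : ∀ x y, dist x y = ρ x + ρ y - 2 * s x y) (hs : ∀ x y, s x y = s y x)
    (hu : ∀ x y z, min (s x y) (s y z) ≤ s x z) (x y z w : X) :
    dist x y + dist z w ≤ max (dist x z + dist y w) (dist x w + dist y z) := by
  have h1 := hu x z y
  have h2 := hu x w y
  have h3 := hu z x w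
  have h4 := hu z y w
  rw [hs z y] at h1 h4
  rw [hs w y] at h2
  rw [hs z x] at h3
  simp only [hd]
  by_contra! h
  obtain ⟨h5, h6⟩ := max_lt_iff.1 h
  rcases min_le_iff.1 h1 with h1 | h1 <;> rcases min_le_iff.1 h2 with h2 | h2 <;>
    rcases min_le_iff.1 h3 with h3 | h3 <;> rcases min_le_iff.1 h4 with h4 | h4 <;> linarith

/-- Points in different directions from `x` lie in different components of the complement. -/
theorem IsRTree.connectedComponents_ne {X : Type*} [MetricSpace X] (hX : IsRTree X) {x : X}
    {a b : ({x}ᶜ : Set X)} (h : ¬ SameDir x (a : X) b) :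
    (a : ConnectedComponents ({x}ᶜ : Set X)) ≠ b := by
  intro hab
  set φ : ({x}ᶜ : Set X) → ℝ := fun z =>
    signedDist x {z | dist z a < dist z x + dist x a} (z : X)
  have hφ : Continuous φ :=
    (continuous_signedDist (hX.separation x a)).comp continuous_subtype_val
  have h0 : ∀ z, φ z ≠ 0 := fun z hz => z.2 (signedDist_eq_zero hz)
  have hcl : IsClopen {z | 0 < φ z} := by
    refine ⟨?_, isOpen_lt continuous_const hφ⟩
    have : {z | 0 < φ z} = {z | 0 ≤ φ z} := by
      ext z
      exact ⟨fun h : 0 < φ z => h.le, fun h : 0 ≤ φ z => lt_of_le_of_ne h (h0 z).symm⟩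
    rw [this]
    exact isClosed_le continuous_const hφ
  have ha : 0 < φ a := by
    have hax : 0 < dist (a : X) x := dist_pos.2 a.2
    have : (a : X) ∈ {z | dist z (a : X) < dist z x + dist x a} := by
      simp only [mem_ofPred_eq, dist_self]
      positivity
    simp only [φ, signedDist, if_pos this]
    exact hax
  have hb : ¬ 0 < φ b := by
    have : (b : X) ∉ {z | dist z (a : X) < dist z x + dist x a} := fun h' =>
      h (SameDir.symm h')
    simp only [φ, signedDist, if_neg this, not_lt]
    exact neg_nonpos.2 dist_nonneg
  have hmem : b ∈ connectedComponent a := by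
    rw [ConnectedComponents.coe_eq_coe.1 hab]
    exact mem_connectedComponent
  exact hb (hcl.connectedComponent_subset ha hmem)

namespace UTree

theorem dist_eq (f g : UTree) : dist f g = f.ρ + g.ρ - 2 * sep f g := by
  change (f.ρ - sep f g) + (g.ρ - sep f g) = _
  ring

instance : Nonempty UTree :=
  ⟨⟨0, fun _ => 0, fun _ _ => rfl, ⟨0, fun _ _ => rfl⟩, fun _ _ => ⟨1, one_pos, fun _ _ _ => rfl⟩⟩⟩

/-- The restriction of `f` to `]-∞, min t ρ[`. -/
def trunc (f : UTree) (t : ℝ) : UTree where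
  ρ := min t f.ρ
  toFun r := if r < t then f.toFun r else 0
  off r hr := by
    split_ifs with h
    · exact f.off r (by
        rcases min_le_iff.1 hr with h' | h'
        · linarith
        · exact h')
    · rfl
  zero_near_bot := by
    obtain ⟨τ, hτ⟩ := f.zero_near_bot
    refine ⟨τ, fun r hr => ?_⟩
    split_ifs
    · exact hτ r hr
    · rfl
  right_const r hr := by
    obtain ⟨h1, h2⟩ := lt_min_iff.1 hr
    obtain ⟨ε, hε, h⟩ := f.right_const r h2
    refine ⟨ε, hε, fun q hq hq' => ?_⟩
    rw [if_pos h1, if_pos (hq'.trans_le (min_le_left _ _))]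
    exact h q hq (hq'.trans_le (min_le_right _ _))

theorem sep_trunc (f g : UTree) {a b : ℝ} (ha : a ≤ f.ρ) (hb : b ≤ g.ρ) :
    sep (f.trunc a) (g.trunc b) = min (min a b) (sep f g) := by
  obtain ⟨h1, h2, h3⟩ := sep_mem f g
  obtain ⟨k1, k2, k3⟩ := sep_mem (f.trunc a) (g.trunc b)
  have k1' : sep (f.trunc a) (g.trunc b) ≤ a := k1.trans (min_le_left _ _)
  have k2' : sep (f.trunc a) (g.trunc b) ≤ b := k2.trans (min_le_left _ _)
  refine le_antisymm (le_min (le_min k1' k2') (le_sep ⟨k1'.trans ha, k2'.trans hb, ?_⟩))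
    (le_sep ⟨?_, ?_, ?_⟩)
  · intro r hr
    have := k3 r hr
    simpa [trunc, hr.trans_le k1', hr.trans_le k2'] using this
  · exact le_min ((min_le_left _ _).trans (min_le_left _ _)) ((min_le_right _ _).trans h1)
  · exact le_min ((min_le_left _ _).trans (min_le_right _ _)) ((min_le_right _ _).trans h2)
  · intro r hr
    obtain ⟨hab, hs⟩ := lt_min_iff.1 hr
    obtain ⟨hra, hrb⟩ := lt_min_iff.1 hab
    simp [trunc, hra, hrb, h3 r hs]

theorem trunc_self (f : UTree) : f.trunc f.ρ = f := by
  refine UTree.ext (min_self _) (funext fun r => ?_)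
  simp only [trunc]
  split_ifs with h
  · rfl
  · rw [f.off r (not_lt.1 h)]

theorem dist_trunc (f g : UTree) {a b : ℝ} (ha : a ≤ f.ρ) (hb : b ≤ g.ρ) :
    dist (f.trunc a) (g.trunc b) = a + b - 2 * min (min a b) (sep f g) := by
  rw [dist_eq, sep_trunc f g ha hb]
  simp [trunc, ha, hb]

theorem isGeodesicSpace : IsGeodesicSpace UTree := by
  intro f g
  obtain ⟨h1, h2, -⟩ := sep_mem f g
  set s := sep f g with hs
  -- down from `f` to the separation point, then up to `g`
  let γ : ℝ → UTree := fun t =>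
    if t ≤ f.ρ - s then f.trunc (f.ρ - t) else g.trunc (s + (t - (f.ρ - s)))
  have hd : dist f g = (f.ρ - s) + (g.ρ - s) := rfl
  have key : ∀ a ∈ Icc 0 (dist f g), ∀ b ∈ Icc 0 (dist f g), a ≤ b →
      dist (γ a) (γ b) = b - a := by
    intro a ha b hb hab
    rw [hd] at ha hb
    by_cases h3 : b ≤ f.ρ - s
    · simp only [γ, if_pos h3, if_pos (hab.trans h3)]
      rw [dist_trunc f f (by linarith [ha.1]) (by linarith [hb.1]), sep_self,
        min_eq_right (a := f.ρ - a) (by linarith), min_eq_left (by linarith [hb.1])]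
      ring
    · by_cases h4 : a ≤ f.ρ - s
      · simp only [γ, if_neg h3, if_pos h4]
        rw [dist_trunc f g (by linarith [ha.1]) (by linarith [hb.2]), ← hs,
          min_eq_right (le_min (by linarith) (by linarith [not_le.1 h3]))]
        ring
      · simp only [γ, if_neg h3, if_neg h4]
        rw [dist_trunc g g (by linarith [ha.2]) (by linarith [hb.2]), sep_self,
          min_eq_left (a := s + (a - (f.ρ - s))) (by linarith), min_eq_left (by linarith [ha.2])]
        ring
  have h0 : γ 0 = f := by
    simp only [γ, if_pos (sub_nonneg.2 h1), sub_zero, trunc_self]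
  refine ⟨γ, h0, ?_, fun a ha b hb => ?_⟩
  · by_cases h3 : dist f g ≤ f.ρ - s
    · have h4 : g.ρ = s := by linarith
      have h5 := key 0 ⟨le_rfl, dist_nonneg⟩ (dist f g) ⟨dist_nonneg, le_rfl⟩ dist_nonneg
      simp only [γ, if_pos h3]
      refine dist_eq_zero.1 ?_
      nth_rw 2 [← trunc_self g]
      rw [dist_trunc f g (by linarith [dist_nonneg (x := f) (y := g)]) le_rfl, ← hs, hd,
        min_eq_right (le_min (by linarith) h2)]
      linarith
    · simp only [γ, if_neg h3]
      rw [hd, show s + (f.ρ - s + (g.ρ - s) - (f.ρ - s)) = g.ρ by ring, trunc_self]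
  · rcases le_total a b with h | h
    · rw [key a ha b hb h, abs_sub_comm, abs_of_nonneg (by linarith)]
    · rw [dist_comm, key b hb a ha h, abs_of_nonneg (by linarith)]

theorem isRTree : IsRTree UTree :=
  ⟨isGeodesicSpace, four_point_of_ultrametric dist_eq sep_comm min_le_sep⟩

instance completeSpace : CompleteSpace UTree := by
  refine Metric.complete_of_cauchySeq_tendsto fun f hf => ?_
  have hle : ∀ g h : UTree, g.ρ - sep g h ≤ dist g h ∧ h.ρ - sep g h ≤ dist g h := by
    intro g h
    obtain ⟨h1, h2, -⟩ := sep_mem g h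
    have : dist g h = (g.ρ - sep g h) + (h.ρ - sep g h) := rfl
    constructor <;> linarith
  have hρc : CauchySeq fun n => (f n).ρ := by
    rw [Metric.cauchySeq_iff] at hf ⊢
    intro ε hε
    obtain ⟨N, hN⟩ := hf ε hε
    refine ⟨N, fun m hm n hn => lt_of_le_of_lt ?_ (hN m hm n hn)⟩
    obtain ⟨h1, h2, -⟩ := sep_mem (f m) (f n)
    obtain ⟨h3, h4⟩ := hle (f m) (f n)
    rw [Real.dist_eq, abs_le]
    constructor <;> linarith
  obtain ⟨ρ, hρ⟩ := cauchySeq_tendsto_of_complete hρc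
  have hsep : ∀ t, ∃ N, t < ρ → ∀ n ≥ N, ∀ m ≥ N, t < sep (f n) (f m) := by
    intro t
    by_cases ht : t < ρ
    · obtain ⟨N, hN⟩ := Metric.tendsto_atTop.1 hρ ((ρ - t) / 2) (by linarith)
      obtain ⟨K, hK⟩ := Metric.cauchySeq_iff.1 hf ((ρ - t) / 2) (by linarith)
      refine ⟨max N K, fun _ n hn m hm => ?_⟩
      have h1 := hN n ((le_max_left _ _).trans hn)
      have h2 := hK n ((le_max_right _ _).trans hn) m ((le_max_right _ _).trans hm)
      rw [Real.dist_eq, abs_lt] at h1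
      linarith [(hle (f n) (f m)).1]
    · exact ⟨0, fun h => absurd h ht⟩
  -- Any half-line `]-∞, t[` with `t < ρ` is contained in the part where almost all `f n` agree.
  choose N hN using hsep
  let F : ℝ → ℝ := fun t => if t < ρ then (f (N t)).toFun t else 0
  have hF : ∀ t < ρ, ∀ n ≥ N t, ∀ r ≤ t, F r = (f n).toFun r := by
    intro t ht n hn r hr
    have hrρ := hr.trans_lt ht
    simp only [F, if_pos hrρ]
    set k := max (N t) (N r)
    rw [(sep_mem (f (N r)) (f k)).2.2 r (hN r hrρ _ le_rfl _ (le_max_right _ _)),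
      (sep_mem (f n) (f k)).2.2 r (hr.trans_lt (hN t ht _ hn _ (le_max_left _ _)))]
  let g : UTree :=
    { ρ := ρ
      toFun := F
      off := fun t ht => if_neg (not_lt.2 ht)
      zero_near_bot := by
        obtain ⟨τ, hτ⟩ := (f (N (ρ - 1))).zero_near_bot
        refine ⟨min τ (ρ - 1), fun t ht => ?_⟩
        rw [hF (ρ - 1) (by linarith) _ le_rfl t (ht.trans_le (min_le_right _ _)).le]
        exact hτ t (ht.trans_le (min_le_left _ _))
      right_const := by
        intro t ht
        obtain ⟨t', h1, h2⟩ := exists_between ht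
        have h3 : t' < (f (N t')).ρ :=
          (hN t' h2 _ le_rfl _ le_rfl).trans_le (sep_mem _ _).1
        obtain ⟨ε, hε, h⟩ := (f (N t')).right_const t (h1.trans h3)
        refine ⟨min ε (t' - t), lt_min hε (by linarith), fun r hr _ => ?_⟩
        have h4 : r < t' := by linarith [hr.2, min_le_right ε (t' - t)]
        rw [hF t' h2 _ le_rfl r h4.le, hF t' h2 _ le_rfl t h1.le]
        exact h r ⟨hr.1, by linarith [hr.2, min_le_left ε (t' - t)]⟩ (h4.trans h3) }
  refine ⟨g, Metric.tendsto_atTop.2 fun e he => ?_⟩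
  obtain ⟨K, hK⟩ := Metric.tendsto_atTop.1 hρ (e / 4) (by linarith)
  have ht : ρ - e / 4 < ρ := by linarith
  refine ⟨max K (N (ρ - e / 4)), fun n hn => ?_⟩
  have h1 := hK n ((le_max_left _ _).trans hn)
  have hn' := (le_max_right _ _).trans hn
  rw [Real.dist_eq, abs_lt] at h1
  have h2 : ρ - e / 4 ≤ sep (f n) g := le_sep
    ⟨((hN _ ht n hn' n hn').trans_le (sep_mem _ _).1).le, ht.le,
      fun r hr => (hF _ ht n hn' r hr.le).symm⟩
  have h3 : dist (f n) g = ((f n).ρ - sep (f n) g) + (ρ - sep (f n) g) := rfl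
  linarith

theorem mk_le_continuum : Cardinal.mk UTree ≤ Cardinal.continuum := by
  have hinj : Function.Injective
      fun f : UTree => ((f.ρ, fun q : ℚ => f.toFun q) : ℝ × (ℚ → ℝ)) := by
    intro f g h
    obtain ⟨h1, h2⟩ := Prod.ext_iff.1 h
    simp only at h1 h2
    refine UTree.ext h1 (funext fun t => ?_)
    by_cases ht : t < f.ρ
    · obtain ⟨ε, hε, hf⟩ := f.right_const t ht
      obtain ⟨ε', hε', hg⟩ := g.right_const t (h1 ▸ ht)
      obtain ⟨q, hq1, hq2⟩ := exists_rat_btwn (lt_min (lt_min (lt_add_of_pos_right t hε)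
        (lt_add_of_pos_right t hε')) ht)
      obtain ⟨h3, h5⟩ := lt_min_iff.1 hq2
      obtain ⟨h3, h4⟩ := lt_min_iff.1 h3
      rw [← hf q ⟨hq1.le, h3⟩ h5, ← hg q ⟨hq1.le, h4⟩ (h1 ▸ h5)]
      exact congrFun h2 q
    · rw [f.off t (not_lt.1 ht), g.off t (h1 ▸ not_lt.1 ht)]
  refine (Cardinal.mk_le_of_injective hinj).trans ?_
  simp [Cardinal.mk_real]

/-- The function `f`, prolonged by the constant value `c` on an interval of length one. -/
def extend (f : UTree) (c : ℝ) : UTree where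
  ρ := f.ρ + 1
  toFun r := if r < f.ρ then f.toFun r else if r < f.ρ + 1 then c else 0
  off r hr := by rw [if_neg (by linarith), if_neg (by linarith)]
  zero_near_bot := by
    obtain ⟨τ, hτ⟩ := f.zero_near_bot
    refine ⟨min τ f.ρ, fun r hr => ?_⟩
    rw [if_pos (hr.trans_le (min_le_right _ _)), hτ r (hr.trans_le (min_le_left _ _))]
  right_const r hr := by
    by_cases h : r < f.ρ
    · obtain ⟨ε, hε, h'⟩ := f.right_const r h
      refine ⟨min ε (f.ρ - r), lt_min hε (by linarith), fun q hq _ => ?_⟩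
      have h1 : q < f.ρ := by linarith [hq.2, min_le_right ε (f.ρ - r)]
      rw [if_pos h, if_pos h1]
      exact h' q ⟨hq.1, by linarith [hq.2, min_le_left ε (f.ρ - r)]⟩ h1
    · refine ⟨1, one_pos, fun q hq hq' => ?_⟩
      rw [if_neg h, if_neg (by linarith [hq.1]), if_pos hr, if_pos hq']

theorem dist_extend (f : UTree) (c : ℝ) : dist f (f.extend c) = 1 := by
  have : sep f (f.extend c) = f.ρ := le_antisymm (sep_mem _ _).1
    (le_sep ⟨le_rfl, by simp [extend], fun r hr => by simp [extend, hr]⟩)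
  rw [dist_eq, this]
  simp only [extend]
  ring

theorem extend_ne (f : UTree) (c : ℝ) : f.extend c ≠ f := fun h => by
  have := dist_extend f c
  rw [h, dist_self] at this
  exact zero_ne_one this

theorem not_sameDir_extend (f : UTree) {c c' : ℝ} (h : c ≠ c') :
    ¬ SameDir f (f.extend c) (f.extend c') := by
  have hs : sep (f.extend c) (f.extend c') ≤ f.ρ := by
    by_contra! hlt
    have := (sep_mem (f.extend c) (f.extend c')).2.2 f.ρ hlt
    simp only [extend, lt_irrefl, if_false, lt_add_one, if_true] at this
    exact h this
  unfold SameDir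
  rw [dist_comm _ f, dist_extend, dist_extend, dist_eq]
  simp only [extend, not_lt] at hs ⊢
  linarith

/-- At every point of a type with at most continuum many points, a family of pairwise different
directions indexed by the reals shows that there are continuum many directions. -/
theorem _root_.TreeGraded.IsRTree.mk_dir_eq {X : Type u} [MetricSpace X] (hX : IsRTree X) {x : X}
    (hc : Cardinal.mk X ≤ Cardinal.continuum) (e : ℝ → X) (he : ∀ c, e c ≠ x)
    (hs : ∀ c c', c ≠ c' → ¬ SameDir x (e c) (e c')) :
    Cardinal.mk (hX.Dir x) = Cardinal.continuum := by
  refine le_antisymm (Cardinal.mk_quotient_le.trans ((Cardinal.mk_subtype_le _).trans hc)) ?_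
  have hinj : Function.Injective
      fun c : ULift.{u} ℝ => (Quotient.mk (hX.dirSetoid x) ⟨e c.down, he _⟩ : hX.Dir x) := by
    intro c c' h
    by_contra hne
    exact hs c.down c'.down (fun h' => hne (ULift.ext _ _ h')) (Quotient.exact h)
  have h := Cardinal.mk_le_of_injective hinj
  rwa [Cardinal.mk_uLift, Cardinal.mk_real, Cardinal.lift_continuum] at h

theorem mk_dir (f : UTree) : Cardinal.mk (isRTree.Dir f) = Cardinal.continuum :=
  isRTree.mk_dir_eq mk_le_continuum f.extend f.extend_ne fun _ _ h => f.not_sameDir_extend h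

theorem isUniversalRTree : IsUniversalRTree UTree := by
  refine ⟨inferInstance, inferInstance, isRTree, fun f => le_antisymm ?_ ?_⟩
  · exact Cardinal.mk_quotient_le.trans ((Cardinal.mk_subtype_le _).trans mk_le_continuum)
  · have hinj : Function.Injective fun c : ℝ =>
        ((⟨f.extend c, f.extend_ne c⟩ : ({f}ᶜ : Set UTree)) :
          ConnectedComponents ({f}ᶜ : Set UTree)) := by
      intro c c' h
      by_contra hne
      exact isRTree.connectedComponents_ne (f.not_sameDir_extend hne) h
    simpa [Cardinal.mk_real] using Cardinal.mk_le_of_injective hinj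

end UTree

end

end TreeGraded

namespace TreeGraded

noncomputable section

open Filter Topology

variable {J : Type v} {M : J → Type u}

/-! ### The subtree of words over one factor -/

namespace Route

/-- All letters of the route belong to the factor `M j₀`. -/
def Only (j₀ : J) (r : Route M) : Prop := ∀ t l, r t = some l → l.idx = j₀

theorem only_mul {j₀ : J} {r s : Route M} : Only j₀ (r * s) ↔ Only j₀ r ∧ Only j₀ s := by
  constructor
  · intro h
    refine ⟨fun t l hl => h t l ?_, fun t l hl => h (r.len + t) l ?_⟩
    · rw [mul_apply_left _ _ (r.mem_of_eq_some hl).2.le, hl]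
    · rw [mul_apply_add _ _ (s.mem_of_eq_some hl).1.le, hl]
  · rintro ⟨h1, h2⟩ t l hl
    rw [mul_apply] at hl
    split_ifs at hl
    · exact h1 _ _ hl
    · exact h2 _ _ hl

theorem Only.rev {j₀ : J} {r : Route M} (h : Only j₀ r) : Only j₀ r.rev := by
  intro t l hl
  obtain ⟨l', h1, rfl⟩ := Option.map_eq_some_iff.1 hl
  exact h _ l' h1

theorem only_one {j₀ : J} : Only j₀ (1 : Route M) := fun _ _ h => by cases h

variable [∀ j, MetricSpace (M j)]

theorem only_seg {j₀ : J} {x y : M j₀} : Only j₀ (seg (M := M) x y) := by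
  by_cases h : x = y
  · rw [h, seg_self]; exact only_one
  · rw [seg_of_ne h]
    intro t l hl
    rw [← single_eq_some hl]

theorem Only.eq_of_seg {j₀ j : J} {x y : M j} (h : Only j₀ (seg (M := M) x y)) (hxy : x ≠ y) :
    j = j₀ := by
  rw [seg_of_ne hxy] at h
  obtain ⟨t, ht⟩ := exists_between (Letter.length_pos (⟨j, x, y, hxy⟩ : Letter M))
  exact h t _ (single_apply _ ht)

end Route

variable [∀ j, MetricSpace (M j)]

namespace Word

open Route

variable (M) in
/-- The words all of whose letters belong to the factor `M j₀`. -/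
def wordsOver (j₀ : J) : Set (Word M) := {g | Only j₀ g.route}

theorem one_mem_wordsOver (j₀ : J) : 1 ∈ wordsOver M j₀ := only_one

theorem inv_mem_wordsOver {j₀ : J} {g : Word M} (h : g ∈ wordsOver M j₀) :
    g.inv ∈ wordsOver M j₀ := Only.rev h

theorem mk_wordsOver_le {j₀ : J} (hc : Cardinal.mk (M j₀) ≤ Cardinal.continuum) :
    Cardinal.mk (wordsOver M j₀) ≤ Cardinal.continuum := by
  let B : Type (max u v) := {o : Option (Letter M) // ∀ l, o = some l → l.idx = j₀}
  have hB : Cardinal.mk B ≤ Cardinal.continuum := by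
    let π : Option {p : M j₀ × M j₀ // p.1 ≠ p.2} → B := fun o =>
      ⟨o.map fun p => ⟨j₀, p.1.1, p.1.2, p.2⟩, fun l hl => by
        obtain ⟨p, -, rfl⟩ := Option.map_eq_some_iff.1 hl
        rfl⟩
    have hπ : Function.Surjective π := by
      rintro ⟨o, ho⟩
      cases o with
      | none => exact ⟨none, rfl⟩
      | some l =>
        obtain ⟨j, x, y, h⟩ := l
        obtain rfl : j = j₀ := ho _ rfl
        exact ⟨some ⟨(x, y), h⟩, rfl⟩
    have h1 := Cardinal.lift_mk_le_lift_mk_of_surjective hπ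
    rw [← Cardinal.lift_le.{u}, Cardinal.lift_continuum]
    refine h1.trans ?_
    rw [← Cardinal.lift_continuum.{max u v, u}, Cardinal.lift_le, Cardinal.mk_option]
    refine Cardinal.add_le_of_le Cardinal.aleph0_le_continuum
      ((Cardinal.mk_subtype_le _).trans ?_)
      (Cardinal.one_le_aleph0.trans Cardinal.aleph0_le_continuum)
    rw [Cardinal.mk_prod, Cardinal.lift_id, ← Cardinal.continuum_mul_self]
    exact mul_le_mul' hc hc
  -- A word is determined by its values at the rationals and by the rational intervals that are
  -- contained in its domain.
  let Ψ : wordsOver M j₀ → (ℚ → B) × (ℚ × ℚ → Prop) := fun g =>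
    (fun q => ⟨g.1.toFun q, g.2 q⟩,
      fun q => ∀ r ∈ Icc (q.1 : ℝ) q.2, g.1.toFun r ≠ none)
  have hΨ : Function.Injective Ψ := by
    have key : ∀ f g : wordsOver M j₀, Ψ f = Ψ g → ∀ t l, f.1.toFun t = some l →
        g.1.toFun t = some l := by
      intro f g hfg t l hl
      obtain ⟨h1, h2⟩ := Prod.ext_iff.1 hfg
      have h1' : ∀ q : ℚ, f.1.toFun q = g.1.toFun q := fun q =>
        congrArg Subtype.val (congrFun h1 q)
      obtain ⟨a, b, ha, hb, -, -, -, hab⟩ := f.1.exists_block hl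
      obtain ⟨q₁, hq1, hq1'⟩ := exists_rat_btwn ha
      obtain ⟨q₂, hq2, hq2'⟩ := exists_rat_btwn hb
      have h3 : ∀ r ∈ Icc (q₁ : ℝ) q₂, g.1.toFun r ≠ none := by
        have := congrFun h2 (q₁, q₂)
        refine this.mp fun r hr => ?_
        rw [hab r ⟨hq1.trans_le hr.1, hr.2.trans_lt hq2'⟩]
        simp
      have h4 : g.1.toFun q₁ = some l := by
        rw [← h1', hab q₁ ⟨hq1, hq1'.trans hb⟩]
      obtain ⟨b', hb', hnb', hval⟩ := g.1.exists_right_end h4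
      have h5 : (q₂ : ℝ) < b' := by
        by_contra! h5
        exact h3 b' ⟨hb'.le, h5⟩ hnb'
      exact hval t ⟨hq1'.le, hq2.trans h5⟩
    intro f g hfg
    have hfun : f.1.toFun = g.1.toFun := by
      funext t
      cases hf : f.1.toFun t with
      | some l => exact (key f g hfg t l hf).symm
      | none =>
        cases hg : g.1.toFun t with
        | none => rfl
        | some l =>
          rw [key g f hfg.symm t l hg] at hf
          cases hf
    -- the length is determined by the domain
    have hlen : ∀ f g : Word M, f.toFun = g.toFun → g.len ≤ f.len := by
      intro f g h
      by_contra! hlt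
      obtain ⟨t, ht, hn⟩ := g.reduced.dense f.len g.len f.len_nonneg hlt le_rfl
      refine hn ?_
      rw [route_apply, ← h]
      exact f.route.supp_right ht.1.le
    exact Subtype.ext (route_injective (ext_len (le_antisymm (hlen _ _ hfun.symm) (hlen _ _ hfun))
      fun t _ => congrFun hfun t))
  refine (Cardinal.mk_le_of_injective hΨ).trans ?_
  simp only [Cardinal.mk_prod, Cardinal.mk_pi, Cardinal.prod_const, Cardinal.mk_Prop]
  simp only [Cardinal.lift_id, Cardinal.lift_power, Cardinal.mk_eq_aleph0, Cardinal.lift_aleph0,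
    Cardinal.lift_uzero, Cardinal.lift_two]
  refine (mul_le_mul' (Cardinal.power_le_power_right hB) le_rfl).trans ?_
  simp

variable [Nonempty (Σ j, M j)]

theorem diff_mem_wordsOver {j₀ : J} {e g : Word M} (he : e ∈ wordsOver M j₀)
    (hg : g ∈ wordsOver M j₀) : diff e g ∈ wordsOver M j₀ := by
  unfold wordsOver at *
  simp only [mem_ofPred_eq] at *
  obtain ⟨c, u, v, ⟨h1, h2, h3⟩ | ⟨j, x, y, z, hxy, hxz, hyz, h1, h2, h3⟩⟩ := (fork_diff e g).cases
  · rw [h1, only_mul] at he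
    rw [h2, only_mul] at hg
    rw [h3, only_mul]
    exact ⟨he.2.rev, hg.2⟩
  · rw [h1, only_mul, only_mul] at he
    rw [h2, only_mul, only_mul] at hg
    obtain rfl := he.2.1.eq_of_seg hxy
    rw [h3, only_mul, only_mul]
    exact ⟨he.2.2.rev, only_seg, hg.2.2⟩

/-- A word between the empty word and `g` has no letters from factors that do not occur in `g`. -/
theorem mem_wordsOver_of_between {j₀ : J} {g h : Word M} (hg : g ∈ wordsOver M j₀)
    (hb : Between 1 h g) : h ∈ wordsOver M j₀ := by
  unfold Between at hb
  rw [dist_one_left, dist_one_left, dist_eq_D, D_eq_len_diff] at hb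
  unfold wordsOver at *
  simp only [mem_ofPred_eq] at *
  obtain ⟨j, x, y, z, c, u, v, h1, h2, h3⟩ := fork_diff h g
  have e1 := len_eq_of_route h1
  have e2 := len_eq_of_route h2
  have e3 := len_eq_of_route h3
  simp only [len_mul, len_seg, len_rev] at e1 e2 e3
  have htri := dist_triangle x y z
  have hu : u = 1 := Route.eq_one_of_len (by linarith [u.len_nonneg])
  rw [h2, only_mul, only_mul] at hg
  rw [h1, hu, only_mul, only_mul]
  refine ⟨hg.1, ?_, only_one⟩
  by_cases hxy : x = y
  · rw [hxy, seg_self]; exact only_one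
  have hxz : x ≠ z := by
    rintro rfl
    rw [dist_self] at e2
    rw [hu, Route.len_one] at e1 e3
    linarith [dist_pos.2 hxy, dist_nonneg (x := y) (y := x)]
  obtain rfl := hg.2.1.eq_of_seg hxz
  exact only_seg

/-- Words close to a word with a letter from another factor have a letter from that factor too. -/
theorem isClosed_wordsOver (j₀ : J) : IsClosed (wordsOver M j₀) := by
  refine ⟨Metric.isOpen_iff.2 fun g hg => ?_⟩
  have hg' : ¬ ∀ t l, g.route t = some l → l.idx = j₀ := hg
  push Not at hg'
  obtain ⟨t, l, hl, hj⟩ := hg'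
  obtain ⟨p, q, hpq, -, -⟩ := g.exists_split_letter hl
  have hr := g.reduced
  rw [hpq] at hr
  rw [single_eq_seg] at hpq
  refine ⟨dist l.src l.tgt + q.len, by linarith [dist_pos.2 l.ne, q.len_nonneg],
    fun g' hg' h => hj ?_⟩
  obtain ⟨z, m, hz, hm⟩ := exists_seg_of_dist_lt (p := toWord p hr.left) l.ne hpq
    (by rw [dist_comm]; exact hg')
  have h' : Only j₀ g'.route := h
  rw [hm, only_mul, only_mul] at h'
  exact h'.2.1.eq_of_seg hz

/-- An upper bound for the distance, in terms of any common initial part and not only of the longest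
one. -/
theorem dist_le_of_common {f h : Word M} {c u v : Route M} {j : J} {x y z : M j}
    (hf : f.route = c * (seg x y * u)) (hh : h.route = c * (seg x z * v)) :
    dist f h ≤ u.len + dist y z + v.len := by
  have h1 := f.reduced
  have h2 := h.reduced
  rw [hf, ← mul_assoc] at h1
  rw [hh, ← mul_assoc] at h2
  have e1 : dist (toWord _ h1.left) f = u.len := dist_prefix (by simp [hf, mul_assoc])
  have e2 : dist (toWord _ h2.left) h = v.len := dist_prefix (by simp [hh, mul_assoc])
  have e3 : dist (toWord _ h1.left) (toWord _ h2.left) = dist y z := dist_seg rfl rfl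
  have t1 := dist_triangle_left f h (toWord _ h1.left)
  have t2 := dist_triangle (toWord _ h1.left) (toWord _ h2.left) h
  linarith

/-- The Gromov product with respect to the empty word. -/
def gromovProduct (f g : Word M) : ℝ := (f.len + g.len - dist f g) / 2

/-- The set of words over an `ℝ`-tree is `0`-hyperbolic with respect to the empty word. If `f` and
`h` leave `g` at different letters, then they have in common what the one that leaves first has in
common with `g`; if they leave `g` at the same letter, then the claim reduces to the four-point
condition in `M j₀`. -/
theorem min_gromovProduct_le {j₀ : J} (hT : IsRTree (M j₀)) {f g h : Word M}
    (hg : g ∈ wordsOver M j₀) :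
    min (gromovProduct f g) (gromovProduct g h) ≤ gromovProduct f h := by
  obtain ⟨j, x, y, z, c, u, v, h1, h2, h3⟩ := fork_diff f g
  obtain ⟨j', x', y', z', c', u', v', k1, k2, k3⟩ := fork_diff g h
  have e1 := len_eq_of_route h1
  have e2 := len_eq_of_route h2
  have e3 := len_eq_of_route h3
  have e4 := len_eq_of_route k1
  have e5 := len_eq_of_route k2
  have e6 := len_eq_of_route k3
  rw [← D_eq_len_diff, ← dist_eq_D] at e3 e6
  simp only [len_mul, len_seg, len_rev] at e1 e2 e3 e4 e5 e6
  simp only [gromovProduct]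
  rcases lt_trichotomy c.len c'.len with hl | hl | hl
  · refine (min_le_left _ _).trans ?_
    obtain ⟨m', rfl, hm⟩ := exists_middle (h2.symm.trans k1) hl.le
    obtain ⟨m, rfl, -⟩ := exists_middle_seg hm (by rw [len_mul] at hl; linarith)
    rw [mul_assoc, mul_assoc] at k2
    have := dist_le_of_common h1 k2
    simp only [len_mul, len_seg] at *
    linarith
  · obtain ⟨rfl, hseg⟩ := mul_left_inj_of_len (h2.symm.trans k1) hl
    have hc : dist f h ≤ (dist x y + u.len) + dist x x + (dist x' z' + v'.len) := by
      have := dist_le_of_common (x := x) (y := x) (z := x) (f := f) (h := h) (c := c)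
        (u := seg x y * u) (v := seg x' z' * v') (by simpa using h1) (by simpa using k2)
      simpa using this
    rw [dist_self] at hc
    by_cases hxz : x = z
    · refine (min_le_left _ _).trans ?_
      subst hxz
      rw [dist_self] at e2
      rw [dist_comm y x] at e3
      linarith
    by_cases hxy' : x' = y'
    · refine (min_le_right _ _).trans ?_
      subst hxy'
      rw [dist_self] at e4
      linarith
    have hg' : Only j₀ g.route := hg
    rw [h2, only_mul, only_mul] at hg'
    obtain rfl := hg'.2.1.eq_of_seg hxz
    rw [seg_of_ne hxz, seg_of_ne hxy'] at hseg
    obtain ⟨hlet, rfl⟩ := single_mul_inj hseg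
    rw [Letter.mk.injEq] at hlet
    obtain ⟨rfl, hx, hz⟩ := hlet
    obtain rfl := eq_of_heq hx
    obtain rfl := eq_of_heq hz
    have hd := dist_le_of_common h1 k2
    have h4 := hT.2 y z' x z
    rw [dist_comm y x, dist_comm z' x, dist_comm z' z] at h4
    rw [min_le_iff]
    rcases le_max_iff.1 h4 with h4 | h4
    · right; linarith
    · left; linarith
  · refine (min_le_right _ _).trans ?_
    obtain ⟨m', rfl, hm⟩ := exists_middle (k1.symm.trans h2) hl.le
    obtain ⟨m, rfl, -⟩ := exists_middle_seg hm (by rw [len_mul] at hl; linarith)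
    rw [mul_assoc, mul_assoc] at h1
    have := dist_le_of_common h1 k2
    simp only [len_mul, len_seg] at *
    linarith

/-- A geodesic between two words over one factor can be chosen inside of the set of such words. -/
theorem exists_geodesic_wordsOver (hM : ∀ j, IsGeodesicSpace (M j)) {j₀ : J} {e g : Word M}
    (he : e ∈ wordsOver M j₀) (hg : g ∈ wordsOver M j₀) :
    ∃ γ : ℝ → Word M, IsGeodesic γ e g ∧ ∀ t ∈ Icc 0 (dist e g), γ t ∈ wordsOver M j₀ := by
  obtain ⟨γ, hγ, -⟩ := exists_geodesic_one hM (diff e g)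
  have hd : dist 1 (diff e g) = dist e g := by rw [dist_one_left, dist_eq_D, D_eq_len_diff]
  have h := hγ.map (diffEquiv e.inv).isometry
  have h1 : diffEquiv e.inv 1 = e := by
    rw [← diffEquiv_symm, ← diffEquiv_self e, IsometryEquiv.symm_apply_apply]
  have h2 : diffEquiv e.inv (diff e g) = g := diff_inv_diff e g
  rw [h1, h2] at h
  refine ⟨_, h, fun t ht => diff_mem_wordsOver (inv_mem_wordsOver he)
    (mem_wordsOver_of_between (diff_mem_wordsOver he hg) (hγ.between (by rwa [hd])).2)⟩

theorem isRTree_wordsOver (hM : ∀ j, IsGeodesicSpace (M j)) {j₀ : J} (hT : IsRTree (M j₀)) :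
    IsRTree (wordsOver M j₀) := by
  constructor
  · rintro ⟨e, he⟩ ⟨g, hg⟩
    obtain ⟨γ, ⟨h0, h1, h2⟩, hγ⟩ := exists_geodesic_wordsOver hM he hg
    classical
    let γ' : ℝ → wordsOver M j₀ := fun t => if h : γ t ∈ wordsOver M j₀ then ⟨γ t, h⟩ else ⟨e, he⟩
    have hval : ∀ t ∈ Icc 0 (dist e g), (γ' t : Word M) = γ t := fun t ht =>
      congrArg Subtype.val (dif_pos (hγ t ht))
    refine ⟨γ', Subtype.ext ?_, Subtype.ext ?_, fun s hs t ht => ?_⟩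
    · exact (hval 0 ⟨le_rfl, dist_nonneg⟩).trans h0
    · exact (hval _ ⟨dist_nonneg, le_rfl⟩).trans h1
    · rw [Subtype.dist_eq, hval s hs, hval t ht]
      exact h2 s hs t ht
  · refine four_point_of_ultrametric (ρ := fun g => g.1.len)
      (s := fun f g => gromovProduct f.1 g.1) (fun f g => ?_) (fun f g => ?_) fun f g h => ?_
    · simp only [gromovProduct, Subtype.dist_eq]
      ring
    · simp only [gromovProduct, dist_comm f.1, add_comm f.1.len]
    · exact min_gromovProduct_le hT g.2

/-- There are continuum many directions at every word over an `ℝ`-tree. By homogeneity it suffices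
to look at the empty word, where letters with different first points have different directions. -/
theorem mk_dir_wordsOver {j₀ : J} (hT : IsRTree (wordsOver M j₀))
    (hc : Cardinal.mk (M j₀) ≤ Cardinal.continuum) {ι : ℝ → M j₀} (hι : Function.Injective ι)
    (e : wordsOver M j₀) : Cardinal.mk (hT.Dir e) = Cardinal.continuum := by
  have hιne : ∀ c, ι c ≠ ι (c + 1) := fun c h => by
    have := hι h
    linarith
  let w : ℝ → Word M := fun c => toWord _ (reduced_seg (ι c) (ι (c + 1)))
  have hw : ∀ c, w c ∈ wordsOver M j₀ := fun c => only_seg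
  have hdir : ∀ c c', c ≠ c' → ¬ SameDir 1 (w c) (w c') := by
    intro c c' hcc h
    have h1 : dist (w c) (w c') = (dist (ι c) (ι (c + 1)) + (1 : Route M).len) + dist 1 (w c') := by
      refine dist_of_not_seg (hιne c) (by simp [w]) fun z m hz hm => ?_
      rw [route_one, one_mul] at hm
      have h2 : seg (M := M) (ι c') (ι (c' + 1)) * 1 = seg (ι c) z * m := by
        rw [mul_one]; exact hm
      rw [seg_of_ne (hιne c'), seg_of_ne hz] at h2
      have h3 := (single_mul_inj h2).1
      rw [Letter.mk.injEq] at h3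
      exact hcc (hι (eq_of_heq h3.2.1)).symm
    have h2 : dist 1 (w c) = dist (ι c) (ι (c + 1)) := by
      rw [dist_one_left]
      simp [w]
    unfold SameDir at h
    rw [h1, dist_comm (w c), h2, Route.len_one] at h
    linarith
  have hφ : ∀ g, diff e.1 (diff e.1.inv g) = g := fun g => by
    simpa using diff_inv_diff e.1.inv g
  have hsd : ∀ c c', SameDir e.1 (diff e.1.inv (w c)) (diff e.1.inv (w c')) →
      SameDir 1 (w c) (w c') := by
    intro c c' h
    unfold SameDir at *
    rw [← (diffEquiv e.1).isometry.dist_eq, ← (diffEquiv e.1).isometry.dist_eq (diff e.1.inv (w c)),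
      ← (diffEquiv e.1).isometry.dist_eq e.1] at h
    simpa only [diffEquiv_apply, hφ, diff_self] using h
  refine hT.mk_dir_eq (mk_wordsOver_le hc)
    (fun c => ⟨diff e.1.inv (w c), diff_mem_wordsOver (inv_mem_wordsOver e.2) (hw c)⟩)
    (fun c h => ?_) fun c c' hcc h => hdir c c' hcc (hsd c c' h)
  have h1 := congrArg (fun g : wordsOver M j₀ => diff e.1 g.1) h
  simp only [hφ, diff_self] at h1
  have h2 := congrArg Word.len h1
  simp only [w, len_toWord, len_seg, Word.len_one] at h2
  exact hιne c (dist_eq_zero.1 h2)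

end Word

end

end TreeGraded

namespace TreeGraded

noncomputable section

/-! ### Pieces and transversal trees -/

section Transfer

variable {X : Type u} {Y : Type v} [MetricSpace X] [MetricSpace Y]

theorem IsGeodesicSpace.of_isometryEquiv (h : IsGeodesicSpace X) (φ : X ≃ᵢ Y) :
    IsGeodesicSpace Y := by
  intro x y
  obtain ⟨γ, hγ⟩ := h (φ.symm x) (φ.symm y)
  have := hγ.map φ.isometry
  rw [φ.apply_symm_apply, φ.apply_symm_apply] at this
  exact ⟨_, this⟩

theorem IsRTree.of_isometryEquiv (h : IsRTree X) (φ : X ≃ᵢ Y) : IsRTree Y :=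
  ⟨h.1.of_isometryEquiv φ, fun x y z w => by
    simpa only [φ.symm.isometry.dist_eq] using
      h.2 (φ.symm x) (φ.symm y) (φ.symm z) (φ.symm w)⟩

theorem mapsTo_transversalTree {P : Set (Set X)} (φ : X ≃ᵢ X) (hP : ∀ S ∈ P, φ.symm '' S ∈ P)
    (x : X) : MapsTo φ (transversalTree P x) (transversalTree P (φ x)) := by
  intro y hy γ hγ S hS a ha b hb
  have h := hγ.map φ.symm.isometry
  rw [φ.symm_apply_apply, φ.symm_apply_apply] at h
  have key : ∀ a ∈ γ '' Icc 0 (dist (φ x) (φ y)) ∩ S,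
      φ.symm a ∈ (fun t => φ.symm (γ t)) '' Icc 0 (dist x y) ∩ φ.symm '' S := by
    rintro _ ⟨⟨t, ht, rfl⟩, hS⟩
    rw [φ.isometry.dist_eq] at ht
    exact ⟨⟨t, ht, rfl⟩, _, hS, rfl⟩
  exact φ.symm.injective (hy _ h _ (hP S hS) (key a ha) (key b hb))

/-- An isometry that permutes the pieces carries transversal trees to transversal trees. -/
theorem nonempty_isometryEquiv_transversalTree {P : Set (Set X)} (φ : X ≃ᵢ X)
    (h₁ : ∀ S ∈ P, φ '' S ∈ P) (h₂ : ∀ S ∈ P, φ.symm '' S ∈ P) (x : X) :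
    Nonempty (transversalTree P x ≃ᵢ transversalTree P (φ x)) := by
  refine ⟨⟨φ.toEquiv.subtypeEquiv fun y => ⟨fun hy => mapsTo_transversalTree φ h₂ x hy,
    fun hy => ?_⟩, Isometry.of_dist_eq fun a b => φ.isometry.dist_eq a.1 b.1⟩⟩
  have := mapsTo_transversalTree φ.symm (by simpa using h₁) (φ x) hy
  simpa using this

end Transfer

namespace Word

open Route

variable {J : Type v} {M : J → Type u} [∀ j, MetricSpace (M j)]

theorem eq_one_of_one_mem_range_app {p : Word M} {j : J} {x : M j} {h : Avoids p x}
    (h1 : 1 ∈ range (p.app x h)) : p = 1 := by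
  obtain ⟨y, hy⟩ := h1
  have h2 := len_eq_of_route (route_app p x h y)
  rw [hy, len_mul, len_seg, Word.len_one] at h2
  exact route_injective (Route.eq_one_of_len (by
    linarith [dist_nonneg (x := x) (y := y), p.route.len_nonneg]))

/-- Two copies of factors with two different common points coincide: after moving one common
point to the empty word, both copies are determined by the single letter that is the other one. -/
theorem range_app_eq_range_app [Nonempty (Σ j, M j)] {p q e g : Word M} {j k : J} {x : M j}
    {y : M k} {hp : Avoids p x} {hq : Avoids q y} (heg : e ≠ g) (he : e ∈ range (p.app x hp))
    (he' : e ∈ range (q.app y hq)) (hg : g ∈ range (p.app x hp)) (hg' : g ∈ range (q.app y hq)) :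
    range (p.app x hp) = range (q.app y hq) := by
  have hinj : Function.Injective (diff e) := (diffEquiv e).injective
  apply hinj.image_injective
  obtain ⟨p', x', hp', h1⟩ := range_diff_app e hp
  obtain ⟨q', y', hq', h2⟩ := range_diff_app e hq
  replace he := mem_image_of_mem (diff e) he
  replace he' := mem_image_of_mem (diff e) he'
  replace hg := mem_image_of_mem (diff e) hg
  replace hg' := mem_image_of_mem (diff e) hg'
  rw [h1, diff_self] at he
  rw [h2, diff_self] at he'
  rw [h1] at hg
  rw [h2] at hg'
  obtain rfl := eq_one_of_one_mem_range_app he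
  obtain rfl := eq_one_of_one_mem_range_app he'
  obtain ⟨a, ha⟩ := hg
  obtain ⟨b, hb⟩ := hg'
  have hne : diff e g ≠ 1 := fun h => heg (hinj (by rw [h, diff_self]))
  have hxa : x' ≠ a := by
    rintro rfl
    rw [app_self] at ha
    exact hne ha.symm
  have hyb : y' ≠ b := by
    rintro rfl
    rw [app_self] at hb
    exact hne hb.symm
  have hroute := congrArg Word.route (ha.trans hb.symm)
  rw [route_app, route_app, route_one, one_mul, one_mul, seg_of_ne hxa, seg_of_ne hyb,
    ← mul_one (single _), ← mul_one (single (⟨k, y', b, hyb⟩ : Letter M))] at hroute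
  have hl := (single_mul_inj hroute).1
  rw [Letter.mk.injEq] at hl
  obtain ⟨rfl, hx, -⟩ := hl
  obtain rfl := eq_of_heq hx
  rw [h1, h2]

end Word

section Pieces

variable {I : Type v} (M : I → Type u)

/-- The universal tree as a factor of the tree product. -/
def treeEquiv [∀ i, MetricSpace (M i)] : UTree ≃ᵢ withTree M none where
  toEquiv := Equiv.ulift.symm
  isometry_toFun := Isometry.of_dist_eq fun _ _ => rfl

instance : Nonempty (Σ j, withTree M j) := ⟨⟨none, ULift.up (Classical.arbitrary UTree)⟩⟩

variable [∀ i, MetricSpace (M i)]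

instance [h : ∀ i, CompleteSpace (M i)] : ∀ j, CompleteSpace (withTree M j)
  | none => (treeEquiv M).symm.completeSpace
  | some i => h i

variable {M}

theorem isGeodesicSpace_withTree (hM : ∀ i, IsGeodesicSpace (M i)) :
    ∀ j, IsGeodesicSpace (withTree M j)
  | none => UTree.isRTree.1.of_isometryEquiv (treeEquiv M)
  | some i => hM i

open Word Route

theorem mem_pieces {S : Set (TreeProduct M)} : S ∈ pieces M ↔
    ∃ (f : TreeProduct M) (i : I) (x : withTree M (some i)) (h : Avoids f x),
      S = range (f.app x h) := by
  constructor
  · rintro ⟨f, i, x, h, rfl⟩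
    exact ⟨f, i, x, not_endsAt_iff.1 h, copyAt_eq_range _⟩
  · rintro ⟨f, i, x, h, rfl⟩
    exact ⟨f, i, x, not_endsAt_iff.2 h, (copyAt_eq_range h).symm⟩

theorem exists_isometryEquiv_of_mem_pieces {S : Set (TreeProduct M)} (hS : S ∈ pieces M) :
    ∃ i, Nonempty (S ≃ᵢ M i) := by
  obtain ⟨f, i, x, h, rfl⟩ := mem_pieces.1 hS
  exact ⟨i, ⟨(isometry_app h).isometryEquivOnRange.symm⟩⟩

theorem diff_image_mem_pieces (e : TreeProduct M) {S : Set (TreeProduct M)} (hS : S ∈ pieces M) :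
    diff e '' S ∈ pieces M := by
  obtain ⟨f, i, x, h, rfl⟩ := mem_pieces.1 hS
  obtain ⟨q, b, h', hq⟩ := range_diff_app e h
  exact mem_pieces.2 ⟨q, i, b, h', hq⟩

/-- A simple loop lies in the copy of some factor, and this factor is not the `ℝ`-tree. -/
theorem exists_piece_of_simple_loop {c : ℝ → TreeProduct M} {L : ℝ} (hL : 0 < L)
    (hc : ContinuousOn c (Icc 0 L)) (h0 : c 0 = c L) (hinj : InjOn c (Ico 0 L)) :
    ∃ S ∈ pieces M, c '' Icc 0 L ⊆ S := by
  obtain ⟨p, j, x, h, hsub⟩ := exists_copy_of_simple_loop hL hc h0 hinj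
  match j, x, h, hsub with
  | some i, x, h, hsub => exact ⟨_, mem_pieces.2 ⟨p, i, x, h, rfl⟩, hsub⟩
  | none, x, h, hsub =>
    exfalso
    have hiso := isometry_app h
    have : Nonempty (withTree M none) := ⟨x⟩
    choose! c' hc' using fun t (ht : t ∈ Icc 0 L) => hsub (mem_image_of_mem c ht)
    refine (UTree.isRTree.of_isometryEquiv (treeEquiv M)).not_simple_loop (c := c') hL ?_ ?_ ?_
    · rw [hiso.isUniformInducing.isInducing.continuousOn_iff]
      exact hc.congr hc'
    · apply hiso.injective
      rw [hc' 0 ⟨le_rfl, hL.le⟩, hc' L ⟨hL.le, le_rfl⟩, h0]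
    · intro s hs t ht hst
      refine hinj hs ht ?_
      rw [← hc' s (Ico_subset_Icc_self hs), ← hc' t (Ico_subset_Icc_self ht), hst]

theorem isTreeGraded_pieces [∀ i, CompleteSpace (M i)] (hM : ∀ i, IsGeodesicSpace (M i)) :
    IsTreeGraded (TreeProduct M) (pieces M) where
  complete := inferInstance
  geodesic := Word.isGeodesicSpace (isGeodesicSpace_withTree hM)
  piece_nonempty S hS := by
    obtain ⟨f, i, x, h, rfl⟩ := mem_pieces.1 hS
    exact ⟨_, mem_range_self x⟩
  piece_closed S hS := by
    obtain ⟨f, i, x, h, rfl⟩ := mem_pieces.1 hS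
    exact (isometry_app h).isClosedEmbedding.isClosed_range
  piece_geodesic S hS := by
    obtain ⟨i, ⟨φ⟩⟩ := exists_isometryEquiv_of_mem_pieces hS
    exact (hM i).of_isometryEquiv φ.symm
  inter_subsingleton S hS S' hS' hne := by
    obtain ⟨f, i, x, h, rfl⟩ := mem_pieces.1 hS
    obtain ⟨f', i', x', h', rfl⟩ := mem_pieces.1 hS'
    intro a ha b hb
    by_contra hab
    exact hne (range_app_eq_range_app hab ha.1 ha.2 hb.1 hb.2)
  triangle_subset _ _ h := exists_piece_of_simple_loop h.1 h.continuousOn h.2.1 h.2.2.1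

/-- The transversal tree at the empty word consists of the words over the universal tree. -/
theorem transversalTree_one (hM : ∀ i, IsGeodesicSpace (M i)) :
    transversalTree (pieces M) 1 = wordsOver (withTree M) none := by
  ext g
  constructor
  · intro hg t l hl
    obtain ⟨j, x, y, hxy⟩ := l
    match j, x, y, hxy, hl with
    | none, _, _, _, _ => rfl
    | some i, x, y, hxy, hl =>
      exfalso
      obtain ⟨p, q, hpq, -, -⟩ := g.exists_split_letter hl
      rw [← seg_of_ne hxy] at hpq
      have hr := g.reduced
      rw [hpq, ← mul_assoc] at hr
      have hav : Avoids (toWord p hr.left.left) x := fun z => hr.left.swap_seg hxy z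
      obtain ⟨γ, hγ, hon⟩ := exists_geodesic_one (isGeodesicSpace_withTree hM) g
      -- the geodesic runs through both ends of the block of the letter
      have key : ∀ w : TreeProduct M, (∃ m, g.route = w.route * m) →
          w ∈ γ '' Icc 0 (dist 1 g) := by
        rintro w ⟨m, hm⟩
        have hlen := len_eq_of_route hm
        rw [len_mul] at hlen
        have ht : w.len ∈ Icc 0 g.len := ⟨w.len_nonneg, by
          have : w.route.len = w.len := rfl
          linarith [m.len_nonneg]⟩
        rw [Word.dist_one_left]
        refine ⟨_, ht, dist_eq_zero.1 ?_⟩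
        rw [OnGeodesic.dist_eq le_rfl (hon _ ht) (Or.inl ⟨m, hm, rfl⟩), sub_self]
      have h1 := hg γ hγ _ (mem_pieces.2 ⟨_, i, x, hav, rfl⟩)
        ⟨key _ ⟨seg x y * q, by simpa using hpq⟩, x, app_self hav⟩
        ⟨key (app _ x hav y) ⟨q, by simpa [mul_assoc] using hpq⟩, y, rfl⟩
      exact hxy ((isometry_app hav).injective ((app_self hav).trans h1))
  · intro hg γ hγ S hS
    obtain ⟨p, i, x, hav, rfl⟩ := mem_pieces.1 hS
    have key : ∀ a ∈ γ '' Icc 0 (dist 1 g) ∩ range (p.app x hav), a = p := by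
      rintro _ ⟨⟨t, ht, rfl⟩, y, hy⟩
      have hb : γ t ∈ wordsOver (withTree M) none :=
        mem_wordsOver_of_between hg (hγ.between ht).2
      rw [← hy] at hb ⊢
      have hb' : Only none (p.app x hav y).route := hb
      rw [route_app, only_mul] at hb'
      by_cases hxy : x = y
      · rw [← hxy, app_self]
      · cases hb'.2.eq_of_seg hxy
    intro a ha b hb
    rw [key a ha, key b hb]

theorem nonempty_isometryEquiv_UTree [∀ i, CompleteSpace (M i)] (hM : ∀ i, IsGeodesicSpace (M i))
    (f : TreeProduct M) : Nonempty (transversalTree (pieces M) f ≃ᵢ UTree) := by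
  obtain ⟨φ⟩ := nonempty_isometryEquiv_transversalTree (diffEquiv f)
    (fun S hS => diff_image_mem_pieces f hS) (fun S hS => diff_image_mem_pieces f.inv hS) f
  rw [diffEquiv_self, transversalTree_one hM] at φ
  have hT := UTree.isRTree.of_isometryEquiv (treeEquiv M)
  have hR := isRTree_wordsOver (isGeodesicSpace_withTree hM) hT
  have : CompleteSpace (wordsOver (withTree M) none) := (isClosed_wordsOver none).completeSpace_coe
  have : Nonempty (wordsOver (withTree M) none) := ⟨⟨1, one_mem_wordsOver none⟩⟩
  have hc : Cardinal.mk (withTree M none) ≤ Cardinal.continuum := by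
    change Cardinal.mk (ULift UTree) ≤ _
    rw [Cardinal.mk_uLift, Cardinal.lift_le_continuum]
    exact UTree.mk_le_continuum
  have hι : Function.Injective fun c =>
      treeEquiv M ((Classical.arbitrary UTree).extend c) := fun c c' h => by
    by_contra hne
    have h1 := (treeEquiv M).injective h
    refine UTree.not_sameDir_extend (Classical.arbitrary UTree) hne ?_
    rw [← h1]
    exact sameDir_refl (UTree.extend_ne _ _)
  obtain ⟨ψ⟩ := hR.nonempty_isometryEquiv UTree.isRTree (mk_dir_wordsOver hR hc hι) UTree.mk_dir
  exact ⟨φ.trans ψ⟩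

end Pieces

end

end TreeGraded

theorem mainTheorem4 {I : Type v} (M : I → Type u) [∀ i, MetricSpace (M i)]
    [∀ i, CompleteSpace (M i)] (hM : ∀ i, IsGeodesicSpace (M i)) :
    IsUniversalRTree UTree ∧
    ∃ _ : MetricSpace (TreeProduct M),
      (∀ f g : TreeProduct M, dist f g = Word.D f g) ∧
      CompleteSpace (TreeProduct M) ∧
      IsHomogeneous (TreeProduct M) ∧
      IsTreeGraded (TreeProduct M) (pieces M) ∧
      (∀ S ∈ pieces M, ∃ i, Nonempty (S ≃ᵢ M i)) ∧
      ∀ f : TreeProduct M, Nonempty (transversalTree (pieces M) f ≃ᵢ UTree) :=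
  ⟨UTree.isUniversalRTree, inferInstance, fun _ _ => rfl, inferInstance, Word.isHomogeneous,
    isTreeGraded_pieces hM, fun _ => exists_isometryEquiv_of_mem_pieces,
    nonempty_isometryEquiv_UTree hM⟩
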